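/- Let $\gamma$ be Euler's constant, let $I_0(t)=\sum_{n\ge 0}\frac{t^{2n}}{2^{2n}(n!)^2}$ be the modified Bessel function, and put $$A=\int_0^2\frac{\log I_0(t)}{t^2}\,dt+\int_2^\infty\frac{\log I_0(t)-t}{t^2}\,dt .$$ For a Dirichlet character $\chi$ modulo $q$ and real $t\ge 0$ write $S_\chi(t)=\sum_{1\le n\le t}\chi(n)$. Then there are an absolute constant $C$ and real numbers $E_k$ $(k\ge 2)$, depending only on $k$, with $|E_k|\le C/\log k$ for every integer $k\ge2$, such that for every integer $k\ge 2$, every $\varepsilon>0$ and every prime $q$, $$\frac1{\phi(q)}\sum_{\chi\ne\chi_0}|S_\chi(q/2)|^{2k}=\Big(\frac{e^\gamma}{\pi}\Big)^{2k}q^k(\log k)^{2k}\exp\Big(\frac{2k}{\log k}\,(A+E_k)\Big)+O_{k,\varepsilon}\big(q^{k-1+\varepsilon}\big),$$ where the sum runs over all nonprincipal characters $\chi$ modulo $q$ and the implied constant depends only on $k$ and $\varepsilon$. -/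

import Mathlib

noncomputable section

/-- The character sum `S_χ(t) = ∑_{1 ≤ n ≤ t} χ(n)`, for real `t`. -/
def charSum {q : ℕ} (χ : DirichletCharacter ℂ q) (t : ℝ) : ℂ :=
  ∑ n ∈ Finset.Icc 1 ⌊t⌋₊, χ (n : ZMod q)

open Classical in
/-- The set of nonprincipal Dirichlet characters mod `q`, as a finite set. -/
def nonprincipalChars (q : ℕ) [NeZero q] : Finset (DirichletCharacter ℂ q) :=
  Finset.univ.filter fun χ => χ ≠ 1

/-- The modified Bessel function `I₀(t) = ∑_{n ≥ 0} t^{2n} / (2^{2n} (n!)²)`. -/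
def besselI0 (t : ℝ) : ℝ :=
  ∑' n : ℕ, t ^ (2 * n) / (2 ^ (2 * n) * (n.factorial : ℝ) ^ 2)

/-- The constant `A = ∫_0^2 log I₀(t) / t² dt + ∫_2^∞ (log I₀(t) - t) / t² dt`. -/
def constA : ℝ :=
  (∫ t in (0 : ℝ)..2, Real.log (besselI0 t) / t ^ 2) +
    ∫ t in Set.Ioi (2 : ℝ), (Real.log (besselI0 t) - t) / t ^ 2

end

/-! Reduction to a divisor sum. For an odd prime `q`, pairing `n` with `-n` shows that even
nonprincipal characters have vanishing half sums (`sum_nonprincipalChars_eq`). For odd `χ`, Gauss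
sums expand `S_χ(q/2)` into conjugate Dirichlet kernels. At an odd representative `a` of a residue
class such a kernel is `cot(πa/2q)/2`, whose partial fractions run over the odd integers congruent
to `a` mod `q`. Hence `|S_χ(q/2)|` is `(2√q/π) |∑ χ(m)/m|` over odd `m`, up to a truncation error
(`abs_norm_charSum_sub_le`). In the `2k`-th moment, orthogonality over odd characters leaves the
diagonal `D_k / 2`, with `D_k = ∑ d_k(n)²/n²` over odd `n`. The congruences `n ≡ ±m` off the
diagonal force `max(m, n) ≥ q/2` and cost only `q^(-1+ε)` (`exists_abs_moment_oddCharSum_sub_le`).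

From `D_k` to primes. `D_k` is an Euler product over odd primes, and by Parseval the factor at `p`
is the mean of `|1 - z/p|^(-2k)` over the unit circle. Since `I₀(t)` is the mean of `exp(t Re z)`,
the logarithm of this factor is close to `∑_i log I₀(2k/p^i)/i`. An `O(√k)` bound and an `O(k/p²)`
bound for the difference are interpolated so that the total over primes is `O(k^(7/8))`
(`exists_abs_log_localFactor_sub_le`). The missing prime `2` contributes `-2k log 2`, which cancels
the powers of two in `(2/π)^(2k)`.

The prime sum. By `hasSum_logBessel`, `∑ Λ(n)/log n · log I₀(2k/n)` is `2k` times the integral of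
the Mertens sum `M(v) = ∑_{n ≤ e^v} Λ(n)/(n log n)` against a probability density translated by `log
k`. The mean of that density is `A`. Inserting `M(v) = log v + γ + r(v)` and expanding `log v` at `V
= log k` gives `log V + γ + A/V + O(V⁻²)` (`exists_abs_integral_mertensSum_sub_le`).

For `r` no pointwise estimate is needed: integrability of `v⁴ r(v)²` suffices
(`integrableOn_pow_four_mul_mertensError_sq`). The Laplace transform of `v² r(v)` is the second
derivative of `log(s ζ(1+s))/s`. This is regular at `0` and decays like `|Im s|^(-3/4)` uniformly
for `0 < Re s ≤ 1`, by growth bounds for `ζ` and a quantitative 3-4-1 argument; Plancherel then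
applies uniformly as `Re s → 0`.

Finally `E_k` is defined by solving the main term for it (`momentError`), so that
`oddDivisorSeries_eq` is exact and all the asymptotics sit in `exists_abs_momentError_le`. -/

section

open MeasureTheory ProbabilityTheory Filter Topology

/-! ### Parseval on the circle, and `I₀` as a moment generating function -/

/-- The normalised Haar measure on the circle `ℝ/ℤ`. -/
noncomputable def circleMeasure : Measure (AddCircle (1 : ℝ)) := AddCircle.haarAddCircle

instance : IsProbabilityMeasure circleMeasure := by
  unfold circleMeasure; infer_instance

/-- The standard character `x ↦ e^{2πix}` of the circle. -/
noncomputable def circleChar (x : AddCircle (1 : ℝ)) : ℂ := fourier 1 x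

lemma continuous_circleChar : Continuous circleChar := (fourier 1).continuous

lemma norm_circleChar (x : AddCircle (1 : ℝ)) : ‖circleChar x‖ = 1 := by
  simp [circleChar, Circle.norm_coe]

lemma fourier_natCast (n : ℕ) (x : AddCircle (1 : ℝ)) : fourier (n : ℤ) x = circleChar x ^ n := by
  simp [circleChar, fourier_apply, AddCircle.toCircle_nsmul]

lemma integral_circleChar_pow_mul_conj (n m : ℕ) :
    ∫ x, circleChar x ^ n * (starRingEnd ℂ) (circleChar x ^ m) ∂circleMeasure
      = if n = m then 1 else 0 := by
  have h := orthonormal_iff_ite.mp (orthonormal_fourier (T := 1)) (m : ℤ) (n : ℤ)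
  rw [ContinuousMap.inner_toLp] at h
  simp only [fourier_natCast] at h
  rw [circleMeasure, h]
  simp [eq_comm]

lemma integral_norm_sq_finset_sum (a : ℕ → ℝ) (N : ℕ) :
    ∫ x, ‖∑ n ∈ Finset.range N, (a n : ℂ) * circleChar x ^ n‖ ^ 2 ∂circleMeasure
      = ∑ n ∈ Finset.range N, a n ^ 2 := by
  have hc := continuous_circleChar
  have hint : ∀ f : AddCircle (1 : ℝ) → ℂ, Continuous f → Integrable f circleMeasure := fun f hf =>
    hf.integrable_of_hasCompactSupport (HasCompactSupport.of_compactSpace f)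
  have h1 : ∀ x, ((‖∑ n ∈ Finset.range N, (a n : ℂ) * circleChar x ^ n‖ ^ 2 : ℝ) : ℂ)
      = ∑ n ∈ Finset.range N, ∑ m ∈ Finset.range N,
        (a n * a m : ℂ) * (circleChar x ^ n * (starRingEnd ℂ) (circleChar x ^ m)) := by
    intro x
    rw [Complex.ofReal_pow, ← Complex.mul_conj', map_sum, Finset.sum_mul_sum]
    refine Finset.sum_congr rfl fun n _ => Finset.sum_congr rfl fun m _ => ?_
    simp; ring
  have h2 : ((∫ x, ‖∑ n ∈ Finset.range N, (a n : ℂ) * circleChar x ^ n‖ ^ 2 ∂circleMeasure : ℝ) : ℂ)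
      = ∑ n ∈ Finset.range N, (a n : ℂ) ^ 2 := by
    rw [← integral_complex_ofReal]
    simp_rw [h1]
    rw [integral_finsetSum _ fun n _ => hint _ (by fun_prop)]
    refine Finset.sum_congr rfl fun n hn => ?_
    rw [integral_finsetSum _ fun n _ => hint _ (by fun_prop)]
    simp_rw [integral_const_mul, integral_circleChar_pow_mul_conj]
    simp [Finset.mem_range.mp hn, sq]
  exact_mod_cast h2

lemma summable_sq_of_summable_abs {a : ℕ → ℝ} (ha : Summable fun n => |a n|) :
    Summable fun n => a n ^ 2 := by
  refine Summable.of_norm_bounded_eventually_nat ha ?_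
  have := ha.tendsto_atTop_zero.eventually (gt_mem_nhds one_pos)
  filter_upwards [this] with n hn
  rw [Real.norm_of_nonneg (by positivity), ← sq_abs]
  nlinarith [abs_nonneg (a n)]

/-- Parseval's identity for absolutely summable power series on the unit circle. -/
lemma integral_norm_sq_tsum (a : ℕ → ℝ) (ha : Summable fun n => |a n|) :
    ∫ x, ‖∑' n, (a n : ℂ) * circleChar x ^ n‖ ^ 2 ∂circleMeasure = ∑' n, a n ^ 2 := by
  have hs : ∀ x, Summable fun n => ‖(a n : ℂ) * circleChar x ^ n‖ := fun x => by
    simpa [norm_circleChar] using ha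
  have hlim1 : Tendsto (fun N => ∫ x, ‖∑ n ∈ Finset.range N, (a n : ℂ) * circleChar x ^ n‖ ^ 2
      ∂circleMeasure) atTop
      (𝓝 (∫ x, ‖∑' n, (a n : ℂ) * circleChar x ^ n‖ ^ 2 ∂circleMeasure)) := by
    refine tendsto_integral_of_dominated_convergence (fun _ => (∑' n, |a n|) ^ 2) ?_
      (integrable_const _) ?_ ?_
    · intro N
      have hc := continuous_circleChar
      exact Continuous.aestronglyMeasurable (by fun_prop)
    · intro N
      refine Eventually.of_forall fun x => ?_
      rw [Real.norm_of_nonneg (by positivity)]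
      gcongr
      refine (norm_sum_le _ _).trans ?_
      simp only [norm_mul, norm_pow, norm_circleChar, one_pow, mul_one, Complex.norm_real,
        Real.norm_eq_abs]
      exact ha.sum_le_tsum _ fun _ _ => abs_nonneg _
    · refine Eventually.of_forall fun x => ?_
      exact ((hs x).of_norm.hasSum.tendsto_sum_nat.norm.pow 2)
  simp_rw [integral_norm_sq_finset_sum] at hlim1
  exact tendsto_nhds_unique hlim1 (summable_sq_of_summable_abs ha).hasSum.tendsto_sum_nat

/-- This is the squared `ℓ²` norm of the Taylor coefficients of `exp(t z / 2)`, the form to which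
Parseval applies. -/
lemma besselI0_eq_tsum_sq (t : ℝ) : besselI0 t = ∑' n : ℕ, ((t / 2) ^ n / n.factorial) ^ 2 := by
  unfold besselI0
  refine tsum_congr fun n => ?_
  rw [div_pow, div_pow, div_pow, pow_mul, pow_mul, ← pow_mul 2 n 2, ← pow_mul t n 2, ← pow_mul 2 2 n,
    ← pow_mul t 2 n, mul_comm n 2, div_div]

lemma summable_abs_pow_div_factorial (x : ℝ) : Summable fun n : ℕ => |x ^ n / n.factorial| := by
  have := Real.summable_pow_div_factorial |x|
  refine this.congr fun n => ?_
  simp [abs_div, abs_pow]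

/-- `I₀(t)` is the moment generating function of `cos` under the uniform measure. -/
lemma besselI0_eq_mgf (t : ℝ) :
    besselI0 t = mgf (fun x => (circleChar x).re) circleMeasure t := by
  rw [besselI0_eq_tsum_sq, ← integral_norm_sq_tsum _ (summable_abs_pow_div_factorial (t / 2)), mgf]
  refine integral_congr_ae (Eventually.of_forall fun x => ?_)
  have : ∑' n : ℕ, (((t / 2) ^ n / n.factorial : ℝ) : ℂ) * circleChar x ^ n
      = Complex.exp ((t / 2 : ℝ) * circleChar x) := by
    rw [Complex.exp_eq_exp_ℂ, NormedSpace.exp_eq_tsum_div]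
    refine tsum_congr fun n => ?_
    push_cast
    rw [mul_pow]; ring
  simp only [this]
  -- Squaring undoes the halved argument: `‖exp(t z / 2)‖² = exp(t Re z)`.
  rw [Complex.norm_exp, Complex.re_ofReal_mul, ← Real.exp_nat_mul]
  congr 1; push_cast; ring

lemma abs_circleChar_re_le (x : AddCircle (1 : ℝ)) : |(circleChar x).re| ≤ 1 :=
  (Complex.abs_re_le_norm _).trans (norm_circleChar x).le

lemma integrable_circleMeasure {f : AddCircle (1 : ℝ) → ℝ} (hf : Continuous f) :
    Integrable f circleMeasure :=
  hf.integrable_of_hasCompactSupport (HasCompactSupport.of_compactSpace f)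

lemma continuous_circleChar_re : Continuous fun x => (circleChar x).re :=
  Complex.continuous_re.comp continuous_circleChar

lemma interior_integrableExpSet_circle (t : ℝ) :
    t ∈ interior (integrableExpSet (fun x => (circleChar x).re) circleMeasure) := by
  have : integrableExpSet (fun x => (circleChar x).re) circleMeasure = Set.univ := by
    ext s
    have := continuous_circleChar_re
    simpa [integrableExpSet] using integrable_circleMeasure (by fun_prop)
  simp [this]

/-! ### Derivatives, convexity and growth of `log I₀` -/

/-- The logarithm of the Bessel function `I₀`. -/
noncomputable def logBessel (t : ℝ) : ℝ := Real.log (besselI0 t)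

lemma logBessel_eq_cgf : logBessel = cgf (fun x => (circleChar x).re) circleMeasure := by
  ext t
  rw [logBessel, besselI0_eq_mgf, cgf]

lemma besselI0_pos (t : ℝ) : 0 < besselI0 t := by
  rw [besselI0_eq_mgf]
  have := continuous_circleChar_re
  exact mgf_pos (integrable_circleMeasure (by fun_prop))

lemma integral_circleChar_re : ∫ x, (circleChar x).re ∂circleMeasure = 0 := by
  have h := integral_circleChar_pow_mul_conj 1 0
  simp only [pow_one, pow_zero, map_one, mul_one, one_ne_zero, if_false] at h
  have := integral_re (μ := circleMeasure) (f := circleChar) (by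
    exact continuous_circleChar.integrable_of_hasCompactSupport
      (HasCompactSupport.of_compactSpace _))
  simp only [RCLike.re_eq_complex_re] at this
  rw [this, h]; rfl

lemma analyticAt_logBessel (t : ℝ) : AnalyticAt ℝ logBessel t := by
  rw [logBessel_eq_cgf]
  exact analyticAt_cgf (interior_integrableExpSet_circle t)

lemma hasDerivAt_logBessel (t : ℝ) : HasDerivAt logBessel (deriv logBessel t) t :=
  (analyticAt_logBessel t).differentiableAt.hasDerivAt

lemma hasDerivAt_deriv_logBessel (t : ℝ) :
    HasDerivAt (deriv logBessel) (deriv (deriv logBessel) t) t :=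
  (analyticAt_logBessel t).deriv.differentiableAt.hasDerivAt

/-- Derivatives of a cumulant generating function are cumulants of the exponentially tilted measure:
the first is a mean and the second a variance. As `|Re z| ≤ 1` on the circle, the mean is at most
`1` and the variance lies between `0` and `1`; the bounds on the second derivative below have the
same source. -/
lemma deriv_logBessel_le_one (t : ℝ) : deriv logBessel t ≤ 1 := by
  have hc := continuous_circleChar_re
  rw [logBessel_eq_cgf, deriv_cgf (interior_integrableExpSet_circle t),
    div_le_one (mgf_pos (integrable_circleMeasure (by fun_prop))), mgf]
  refine integral_mono (integrable_circleMeasure (by fun_prop))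
    (integrable_circleMeasure (by fun_prop)) fun x => ?_
  have := (abs_le.mp (abs_circleChar_re_le x)).2
  have h2 := Real.exp_pos (t * (circleChar x).re)
  simp only
  nlinarith

lemma deriv_logBessel_zero : deriv logBessel 0 = 0 := by
  rw [logBessel_eq_cgf, deriv_cgf_zero (interior_integrableExpSet_circle 0),
    integral_circleChar_re, zero_div]

lemma deriv_deriv_logBessel_eq (t : ℝ) :
    deriv (deriv logBessel) t = iteratedDeriv 2 (cgf (fun x => (circleChar x).re) circleMeasure) t := by
  rw [logBessel_eq_cgf, iteratedDeriv_succ, iteratedDeriv_one]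

lemma deriv_deriv_logBessel_nonneg (t : ℝ) : 0 ≤ deriv (deriv logBessel) t := by
  rw [deriv_deriv_logBessel_eq,
    iteratedDeriv_two_cgf_eq_integral (interior_integrableExpSet_circle t)]
  exact div_nonneg (integral_nonneg fun x => by positivity) mgf_nonneg

lemma deriv_deriv_logBessel_le_one (t : ℝ) : deriv (deriv logBessel) t ≤ 1 := by
  have hc := continuous_circleChar_re
  rw [deriv_deriv_logBessel_eq, iteratedDeriv_two_cgf (interior_integrableExpSet_circle t)]
  refine (sub_le_self _ (sq_nonneg _)).trans ?_
  rw [div_le_one (mgf_pos (integrable_circleMeasure (by fun_prop))), mgf]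
  refine integral_mono (integrable_circleMeasure (by fun_prop))
    (integrable_circleMeasure (by fun_prop)) fun x => ?_
  have := abs_circleChar_re_le x
  have h2 := Real.exp_pos (t * (circleChar x).re)
  have h3 : (circleChar x).re ^ 2 ≤ 1 := by rw [← sq_abs]; nlinarith [abs_nonneg (circleChar x).re]
  simp only
  nlinarith

lemma monotone_deriv_logBessel : Monotone (deriv logBessel) :=
  monotone_of_deriv_nonneg (fun t => (hasDerivAt_deriv_logBessel t).differentiableAt)
    deriv_deriv_logBessel_nonneg

lemma deriv_logBessel_nonneg {t : ℝ} (ht : 0 ≤ t) : 0 ≤ deriv logBessel t := by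
  simpa [deriv_logBessel_zero] using monotone_deriv_logBessel ht

lemma deriv_logBessel_le_self {t : ℝ} (ht : 0 ≤ t) : deriv logBessel t ≤ t := by
  have h : Monotone fun s => s - deriv logBessel s := by
    refine monotone_of_hasDerivAt_nonneg
      (fun s => (hasDerivAt_id s).sub (hasDerivAt_deriv_logBessel s)) fun s => ?_
    simpa using deriv_deriv_logBessel_le_one s
  have := h ht
  simp [deriv_logBessel_zero] at this
  linarith

lemma logBessel_zero : logBessel 0 = 0 := by
  rw [logBessel_eq_cgf]; simp

lemma logBessel_nonneg {t : ℝ} (ht : 0 ≤ t) : 0 ≤ logBessel t := by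
  have h : MonotoneOn logBessel (Set.Ici 0) := by
    refine monotoneOn_of_deriv_nonneg (convex_Ici 0)
      (fun s _ => (hasDerivAt_logBessel s).continuousAt.continuousWithinAt)
      (fun s _ => (hasDerivAt_logBessel s).differentiableAt.differentiableWithinAt) fun s hs => ?_
    rw [interior_Ici] at hs
    exact deriv_logBessel_nonneg (le_of_lt hs)
  simpa [logBessel_zero] using h Set.self_mem_Ici ht ht

lemma logBessel_le_self {t : ℝ} (ht : 0 ≤ t) : logBessel t ≤ t := by
  have h : Monotone fun s => s - logBessel s := by
    refine monotone_of_hasDerivAt_nonneg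
      (fun s => (hasDerivAt_id s).sub (hasDerivAt_logBessel s)) fun s => ?_
    simpa using deriv_logBessel_le_one s
  have := h ht
  simp [logBessel_zero] at this
  linarith

lemma logBessel_le_sq {t : ℝ} (ht : 0 ≤ t) : logBessel t ≤ t ^ 2 := by
  have h : MonotoneOn (fun s => s ^ 2 - logBessel s) (Set.Ici 0) := by
    refine monotoneOn_of_hasDerivWithinAt_nonneg (convex_Ici 0)
      (f' := fun s => 2 * s - deriv logBessel s)
      (fun s _ => ((continuousAt_id.pow 2).sub
        (hasDerivAt_logBessel s).continuousAt).continuousWithinAt)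
      (fun s _ => ?_) fun s hs => ?_
    · have h1 : HasDerivAt (fun s => s ^ 2 - logBessel s) (2 * s - deriv logBessel s) s := by
        simpa using (hasDerivAt_pow 2 s).fun_sub (hasDerivAt_logBessel s)
      exact h1.hasDerivWithinAt
    · rw [interior_Ici] at hs
      have := deriv_logBessel_le_self (le_of_lt hs)
      have : (0 : ℝ) < s := hs
      linarith
  have := h Set.self_mem_Ici ht ht
  simp [logBessel_zero] at this
  linarith

/-- Convexity together with `log I₀(0) = 0`: the difference of the two sides has derivative `s ·
(log I₀)''(s)`. It is what makes `besselDensity` nonnegative. -/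
lemma logBessel_le_mul_deriv {t : ℝ} (ht : 0 ≤ t) : logBessel t ≤ t * deriv logBessel t := by
  have h : MonotoneOn (fun s => s * deriv logBessel s - logBessel s) (Set.Ici 0) := by
    refine monotoneOn_of_hasDerivWithinAt_nonneg (convex_Ici 0)
      (f' := fun s => s * deriv (deriv logBessel) s)
      (fun s _ => ((continuousAt_id.mul (hasDerivAt_deriv_logBessel s).continuousAt).sub
        (hasDerivAt_logBessel s).continuousAt).continuousWithinAt)
      (fun s _ => ?_) fun s hs => ?_
    · have h1 : HasDerivAt (fun s => s * deriv logBessel s - logBessel s)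
          (s * deriv (deriv logBessel) s) s := by
        have := ((hasDerivAt_id' s).fun_mul (hasDerivAt_deriv_logBessel s)).fun_sub
          (hasDerivAt_logBessel s)
        simpa using this
      exact h1.hasDerivWithinAt
    · rw [interior_Ici] at hs
      exact mul_nonneg (le_of_lt hs) (deriv_deriv_logBessel_nonneg s)
  have := h Set.self_mem_Ici ht ht
  simp [logBessel_zero] at this
  linarith

/-! ### Comparison of `ℓ¹` and `ℓ²` norms, and `I₀(t)` against `e^t` -/

/-- If a nonnegative sequence decays geometrically from index `M` on, its `ℓ¹` norm is controlled
by its `ℓ²` norm. -/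
lemma tsum_sq_le_of_ratio_le {u : ℕ → ℝ} (hu : ∀ n, 0 ≤ u n) (hs : Summable u) {M : ℕ}
    (hM : ∀ n, M ≤ n → u (n + 1) ≤ 3 / 4 * u n) :
    (∑' n, u n) ^ 2 ≤ (2 * M + 32) * ∑' n, u n ^ 2 := by
  have hsq : Summable fun n => u n ^ 2 :=
    summable_sq_of_summable_abs (by simpa only [abs_of_nonneg (hu _)] using hs)
  have htail : ∀ n, u (n + M) ≤ u M * (3 / 4) ^ n := by
    intro n
    induction n with
    | zero => simp
    | succ n ih =>
      have := hM (n + M) (by omega)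
      rw [pow_succ, show n + 1 + M = n + M + 1 by ring]
      linarith
  have h1 : ∑' n, u (n + M) ≤ 4 * u M := by
    have hg := (hasSum_geometric_of_lt_one (by norm_num : (0 : ℝ) ≤ 3 / 4) (by norm_num)).mul_left (u M)
    have := ((summable_nat_add_iff M).mpr hs).tsum_le_tsum htail hg.summable
    rw [hg.tsum_eq] at this
    linarith
  have h2 : (∑ n ∈ Finset.range M, u n) ^ 2 ≤ M * ∑' n, u n ^ 2 := by
    have := sq_sum_le_card_mul_sum_sq (s := Finset.range M) (f := u)
    rw [Finset.card_range] at this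
    refine this.trans ?_
    gcongr
    exact hsq.sum_le_tsum _ fun _ _ => by positivity
  have h3 : u M ^ 2 ≤ ∑' n, u n ^ 2 := hsq.le_tsum M fun _ _ => by positivity
  have h4 := hs.sum_add_tsum_nat_add M
  have h5 : 0 ≤ ∑' n, u (n + M) := tsum_nonneg fun n => hu _
  -- `(a + b)² ≤ 2a² + 2b²`: Cauchy–Schwarz on the first `M` terms yields `2M`, and the tail bound
  -- `4 u_M` yields `2 · 16 = 32`.
  rw [← h4]
  nlinarith [sq_nonneg (∑ n ∈ Finset.range M, u n - ∑' n, u (n + M)), hu M]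

/-- `e^t` is the square of the sum of `(t/2)^n / n!`, while `I₀(t)` is the sum of the squares.
Consecutive terms have ratio at most `1/2` from `M = ⌈t⌉ ≤ t + 1` on, so `2M + 32 ≤ 2t + 34`. -/
lemma exp_sq_le_besselI0 {t : ℝ} (ht : 0 ≤ t) : Real.exp t ≤ (2 * t + 34) * besselI0 t := by
  have h := tsum_sq_le_of_ratio_le (u := fun n : ℕ => (t / 2) ^ n / n.factorial) (M := ⌈t⌉₊)
    (fun n => by positivity) (Real.summable_pow_div_factorial _) fun n hn => by
      have h1 : t ≤ n := (Nat.le_ceil t).trans (by exact_mod_cast hn)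
      rw [pow_succ, Nat.factorial_succ, Nat.cast_mul, mul_comm ((n + 1 : ℕ) : ℝ), mul_div_mul_comm,
        mul_comm]
      refine mul_le_mul_of_nonneg_right ?_ (by positivity)
      rw [div_le_iff₀ (by positivity)]
      push_cast
      linarith
  rw [← besselI0_eq_tsum_sq, ← NormedSpace.expSeries_div_hasSum_exp (t / 2) |>.tsum_eq.symm,
    ← Real.exp_eq_exp_ℝ, ← Real.exp_nat_mul] at h
  have h2 := Nat.ceil_lt_add_one ht
  have h3 := besselI0_pos t
  calc Real.exp t = Real.exp ((2 : ℕ) * (t / 2)) := by congr 1; push_cast; ring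
    _ ≤ _ := h
    _ ≤ _ := by nlinarith

/-- `I₀(t)` is `e^t` up to a polynomial factor, in logarithmic form. -/
lemma exists_self_sub_logBessel_le : ∃ C : ℝ, 0 < C ∧ ∀ t : ℝ, 0 ≤ t → t - logBessel t ≤ C * √t := by
  refine ⟨100, by norm_num, fun t ht => ?_⟩
  by_cases h1 : t ≤ 1
  · have h2 : t ≤ √t := by
      have h3 := Real.sqrt_nonneg t
      have h4 : √t ≤ 1 := Real.sqrt_le_one.mpr h1
      nlinarith [Real.sq_sqrt ht]
    have := logBessel_nonneg ht
    nlinarith [Real.sqrt_nonneg t]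
  · push Not at h1
    have h := exp_sq_le_besselI0 ht
    have h3 := besselI0_pos t
    have h4 := Real.log_le_log (Real.exp_pos t) h
    rw [Real.log_exp, Real.log_mul (by positivity) h3.ne'] at h4
    have h5 : Real.log (2 * t + 34) ≤ 100 * √t := by
      have h6 : 1 ≤ √t := Real.one_le_sqrt.mpr h1.le
      have h7 : Real.log (2 * t + 34) ≤ Real.log ((6 * √t) ^ 2) := by
        refine Real.log_le_log (by positivity) ?_
        rw [mul_pow, Real.sq_sqrt ht]; linarith
      rw [Real.log_pow] at h7
      have h8 := Real.log_le_sub_one_of_pos (show 0 < 6 * √t by positivity)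
      push_cast at h7
      linarith
    rw [logBessel]
    linarith

/-! ### Local Euler factors, compared with `I₀` and with `(1 - x)^(-2(j+1))` -/

/-- The `ℓ²` norm squared of the coefficients of `(1 - xz)^{-(j+1)}`. -/
noncomputable def localFactor (j : ℕ) (x : ℝ) : ℝ := ∑' a : ℕ, ((a + j).choose j * x ^ a) ^ 2

lemma summable_choose_mul_pow (j : ℕ) {x : ℝ} (h0 : 0 ≤ x) (h1 : x < 1) :
    Summable fun a : ℕ => ((a + j).choose j : ℝ) * x ^ a :=
  summable_choose_mul_geometric_of_norm_lt_one j (by rwa [Real.norm_of_nonneg h0])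

lemma summable_localFactor (j : ℕ) {x : ℝ} (h0 : 0 ≤ x) (h1 : x < 1) :
    Summable fun a : ℕ => (((a + j).choose j : ℝ) * x ^ a) ^ 2 := by
  refine summable_sq_of_summable_abs ((summable_choose_mul_pow j h0 h1).congr fun a => ?_)
  rw [abs_of_nonneg (by positivity)]

lemma one_le_localFactor (j : ℕ) {x : ℝ} (h0 : 0 ≤ x) (h1 : x < 1) : 1 ≤ localFactor j x := by
  have := (summable_localFactor j h0 h1).le_tsum 0 fun _ _ => by positivity
  simpa [localFactor] using this

lemma localFactor_eq_integral (j : ℕ) {x : ℝ} (h0 : 0 ≤ x) (h1 : x < 1) :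
    localFactor j x = ∫ z, ‖1 / (1 - x * circleChar z) ^ (j + 1)‖ ^ 2 ∂circleMeasure := by
  rw [localFactor, ← integral_norm_sq_tsum]
  · refine integral_congr_ae (Eventually.of_forall fun z => ?_)
    have hz : ‖(x : ℂ) * circleChar z‖ < 1 := by
      simpa [norm_circleChar, abs_of_nonneg h0] using h1
    simp only [← tsum_choose_mul_geometric_of_norm_lt_one j hz]
    congr 2
    refine tsum_congr fun a => ?_
    push_cast
    ring
  · refine (summable_choose_mul_pow j h0 h1).congr fun a => ?_
    rw [abs_of_nonneg (by positivity)]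

/-- This is `-log(1 - w) = w + O(‖w‖²)`; the real part of the linear term is kept exactly because it
produces the Bessel function after integration. -/
lemma norm_inv_one_sub_le {w : ℂ} (hw : ‖w‖ ≤ 1 / 2) :
    ‖1 / (1 - w)‖ ≤ Real.exp (w.re + ‖w‖ ^ 2) := by
  have h1 := Complex.norm_log_one_sub_inv_sub_self_le (z := w) (by linarith)
  have h2 : (1 - w) ≠ 0 := by
    intro h
    have : w = 1 := by linear_combination -h
    rw [this] at hw; norm_num at hw
  have h3 : ‖1 / (1 - w)‖ = Real.exp (Complex.log (1 - w)⁻¹).re := by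
    rw [← Complex.norm_exp, Complex.exp_log (inv_ne_zero h2), one_div]
  rw [h3]
  refine Real.exp_le_exp.mpr ?_
  have h4 := (Complex.re_le_norm (Complex.log (1 - w)⁻¹ - w)).trans h1
  rw [Complex.sub_re] at h4
  have h5 : ‖w‖ ^ 2 * (1 - ‖w‖)⁻¹ / 2 ≤ ‖w‖ ^ 2 := by
    have : (1 - ‖w‖)⁻¹ ≤ 2 := by
      rw [inv_le_comm₀ (by linarith) (by norm_num)]; linarith
    nlinarith [sq_nonneg ‖w‖]
  linarith

lemma localFactor_le_besselI0 (j : ℕ) {x : ℝ} (h0 : 0 ≤ x) (h1 : x ≤ 1 / 2) :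
    localFactor j x ≤
      besselI0 (2 * (j + 1) * x) * Real.exp (2 * (j + 1) * x ^ 2) := by
  have hc := continuous_circleChar
  have hc' := continuous_circleChar_re
  rw [localFactor_eq_integral j h0 (by linarith), besselI0_eq_mgf, mgf, ← integral_mul_const]
  refine integral_mono_of_nonneg (Eventually.of_forall fun z => by positivity)
    (integrable_circleMeasure (by fun_prop)) (Eventually.of_forall fun z => ?_)
  have hz : ‖(x : ℂ) * circleChar z‖ = x := by simp [norm_circleChar, abs_of_nonneg h0]
  have h2 := norm_inv_one_sub_le (hz.trans_le h1)
  rw [hz, Complex.re_ofReal_mul] at h2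
  simp only
  rw [← one_div_pow, norm_pow, ← pow_mul, ← Real.exp_add]
  refine (pow_le_pow_left₀ (norm_nonneg _) h2 _).trans_eq ?_
  rw [← Real.exp_nat_mul]
  congr 1; push_cast; ring

/-- The inequality holds coefficient by coefficient: `(j+1)^a / a! ≤ (a+j choose j)`, since the
rising factorial from `j+1` has all its `a` factors at least `j+1`. -/
lemma besselI0_le_localFactor (j : ℕ) {x : ℝ} (h0 : 0 ≤ x) (h1 : x < 1) :
    besselI0 (2 * (j + 1) * x) ≤ localFactor j x := by
  rw [besselI0_eq_tsum_sq, localFactor]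
  refine (summable_sq_of_summable_abs (summable_abs_pow_div_factorial _)).tsum_le_tsum ?_
    (summable_localFactor j h0 h1)
  intro a
  rw [show 2 * ((j : ℝ) + 1) * x / 2 = (j + 1) * x by ring, mul_pow, mul_div_right_comm]
  gcongr
  rw [div_le_iff₀ (by positivity)]
  have h2 : (j + 1) ^ a ≤ a.factorial * (j + a).choose a := by
    rw [← Nat.ascFactorial_eq_factorial_mul_choose]
    exact Nat.pow_succ_le_ascFactorial _ _
  have h3 : (j + a).choose a = (a + j).choose j := by
    rw [add_comm j a, Nat.choose_symm_add]
  rw [h3] at h2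
  have : ((j : ℝ) + 1) ^ a ≤ a.factorial * (a + j).choose j := by exact_mod_cast h2
  linarith

lemma localFactor_le_pow (j : ℕ) {x : ℝ} (h0 : 0 ≤ x) (h1 : x < 1) :
    localFactor j x ≤ (1 / (1 - x)) ^ (2 * (j + 1)) := by
  rw [localFactor_eq_integral j h0 h1]
  have : ∀ z, ‖1 / (1 - x * circleChar z) ^ (j + 1)‖ ^ 2 ≤ (1 / (1 - x)) ^ (2 * (j + 1)) := by
    intro z
    rw [← one_div_pow, norm_pow, ← pow_mul, mul_comm (j + 1)]
    refine pow_le_pow_left₀ (norm_nonneg _) ?_ _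
    rw [norm_div, norm_one]
    refine one_div_le_one_div_of_le (by linarith) ?_
    have := norm_sub_norm_le 1 ((x : ℂ) * circleChar z)
    simpa [norm_circleChar, abs_of_nonneg h0] using this
  calc _ ≤ ∫ z, (1 / (1 - x)) ^ (2 * (j + 1)) ∂circleMeasure :=
        integral_mono_of_nonneg (Eventually.of_forall fun z => by positivity)
          (integrable_const _) (Eventually.of_forall this)
    _ = _ := by simp

/-- The coefficients sum to `(1 - x)^(-(j+1))`, so this is the `ℓ¹`–`ℓ²` comparison. From `n = 2j`
on, consecutive binomials have ratio `(n+1+j)/(n+1) ≤ 3/2`, and `x ≤ 1/2` turns this into `3/4`;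
hence `2M + 32 = 4j + 32`. -/
lemma pow_le_localFactor (j : ℕ) {x : ℝ} (h0 : 0 ≤ x) (h1 : x ≤ 1 / 2) :
    (1 / (1 - x)) ^ (2 * (j + 1)) ≤ (4 * j + 32) * localFactor j x := by
  have h := tsum_sq_le_of_ratio_le (u := fun a : ℕ => ((a + j).choose j : ℝ) * x ^ a) (M := 2 * j)
    (fun n => by positivity) (summable_choose_mul_pow j h0 (by linarith)) fun n hn => by
      have h2 : (n + 1 + j).choose j * (n + 1) = (n + j).choose j * (n + 1 + j) := by
        have := Nat.add_one_mul_choose_eq (n + j) n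
        rw [show (n + j).choose n = (n + j).choose j from Nat.choose_symm_add,
          show (n + j + 1).choose (n + 1) = (n + 1 + j).choose j by
            rw [show n + j + 1 = n + 1 + j by ring]; exact Nat.choose_symm_add] at this
        linarith
      have h3 : ((n + 1 + j).choose j : ℝ) * (n + 1) = (n + j).choose j * (n + 1 + j) := by
        exact_mod_cast h2
      have h4 : ((n + 1 + j).choose j : ℝ) ≤ 3 / 2 * (n + j).choose j := by
        have h5 : ((n + j).choose j : ℝ) * (n + 1 + j) ≤ (n + j).choose j * (3 / 2 * (n + 1)) := by
          gcongr
          have : (2 : ℝ) * j ≤ n := by exact_mod_cast hn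
          linarith
        have : (0 : ℝ) < n + 1 := by positivity
        nlinarith
      rw [pow_succ]
      calc ((n + 1 + j).choose j : ℝ) * (x ^ n * x)
          ≤ (3 / 2 * (n + j).choose j) * (x ^ n * (1 / 2)) := by gcongr
        _ = _ := by ring
  have h2 := tsum_choose_mul_geometric_of_norm_lt_one (𝕜 := ℝ) j (r := x)
    (by rw [Real.norm_of_nonneg h0]; linarith)
  simp only [h2] at h
  rw [mul_comm 2 (j + 1), pow_mul, one_div_pow]
  push_cast at h
  unfold localFactor
  linarith

/-! ### Continuation of `(s - 1) ζ(s)` and growth of `ζ` near `Re s = 1` -/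

/-- The `n`-th term of the Euler–Maclaurin expansion of `(s - 1) ζ(s) - 1`. -/
noncomputable def zetaTerm (n : ℕ) (s : ℂ) : ℂ :=
  (s - 1) * ((n : ℂ) + 1) ^ (-s) + (((n : ℂ) + 2) ^ (1 - s) - ((n : ℂ) + 1) ^ (1 - s))

lemma hasDerivAt_add_cpow {n : ℕ} (s : ℂ) {x : ℝ} (hx : 0 ≤ x) :
    HasDerivAt (fun x : ℝ => ((n : ℂ) + 1 + x) ^ s) (s * ((n : ℂ) + 1 + x) ^ (s - 1)) x := by
  have h1 : HasDerivAt (fun z : ℂ => ((n : ℂ) + 1 + z) ^ s) (s * ((n : ℂ) + 1 + x) ^ (s - 1) * 1)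
      (x : ℂ) := by
    refine HasDerivAt.cpow_const ((hasDerivAt_id _).const_add _) (Or.inl ?_)
    simp; positivity
  simpa using h1.comp_ofReal

/-- The term equals `(s - 1) ∫₀¹ ((n+1)^(-s) - (n+1+x)^(-s)) dx`. The mean value inequality is used
once for the integrand and once for the integral; the cancellation gains a factor of order `1/n`, so
the series converges for `Re s > 0`. -/
lemma norm_zetaTerm_le (n : ℕ) {s : ℂ} (hs : 0 < s.re) :
    ‖zetaTerm n s‖ ≤ ‖s - 1‖ * ‖s‖ * ((n : ℝ) + 1) ^ (-s.re - 1) := by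
  have hpow : ∀ (w : ℂ) {x : ℝ}, 0 ≤ x →
      ‖((n : ℂ) + 1 + x) ^ w‖ = ((n : ℝ) + 1 + x) ^ w.re := by
    intro w x hx
    rw [show (n : ℂ) + 1 + x = ((n + 1 + x : ℝ) : ℂ) by push_cast; ring,
      Complex.norm_cpow_eq_rpow_re_of_pos (by positivity)]
  have h1 : ∀ x ∈ Set.Icc (0 : ℝ) 1, ‖((n : ℂ) + 1) ^ (-s) - ((n : ℂ) + 1 + x) ^ (-s)‖
      ≤ ‖s‖ * ((n : ℝ) + 1) ^ (-s.re - 1) := by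
    intro x hx
    have := norm_image_sub_le_of_norm_deriv_le_segment' (a := 0) (b := 1)
      (f := fun x : ℝ => ((n : ℂ) + 1 + x) ^ (-s))
      (f' := fun x : ℝ => -s * ((n : ℂ) + 1 + x) ^ (-s - 1))
      (C := ‖s‖ * ((n : ℝ) + 1) ^ (-s.re - 1))
      (fun y hy => (hasDerivAt_add_cpow (-s) hy.1).hasDerivWithinAt)
      (fun y hy => by
        rw [norm_mul, norm_neg, hpow _ hy.1]
        gcongr
        simp only [Complex.sub_re, Complex.neg_re, Complex.one_re]
        exact Real.rpow_le_rpow_of_nonpos (by positivity) (by linarith [hy.1]) (by linarith)) x hx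
    rw [norm_sub_rev]
    simp only [Complex.ofReal_zero, add_zero, sub_zero] at this
    refine this.trans (mul_le_of_le_one_right (by positivity) hx.2)
  have h2 := norm_image_sub_le_of_norm_deriv_le_segment_01'
    (f := fun x : ℝ => (s - 1) * (x * ((n : ℂ) + 1) ^ (-s)) + ((n : ℂ) + 1 + x) ^ (1 - s))
    (f' := fun x : ℝ => (s - 1) * (((n : ℂ) + 1) ^ (-s) - ((n : ℂ) + 1 + x) ^ (-s)))
    (C := ‖s - 1‖ * (‖s‖ * ((n : ℝ) + 1) ^ (-s.re - 1)))
    (fun x hx => by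
      have h3 : HasDerivAt (fun x : ℝ => (x : ℂ)) 1 x := Complex.ofRealCLM.hasDerivAt
      have h4 := ((h3.mul_const (((n : ℂ) + 1) ^ (-s))).const_mul (s - 1)).fun_add
        (hasDerivAt_add_cpow (n := n) (1 - s) hx.1)
      refine HasDerivAt.hasDerivWithinAt ?_
      convert h4 using 1
      rw [show 1 - s - 1 = -s by ring]; ring)
    (fun x hx => by
      rw [norm_mul]
      gcongr
      exact h1 x ⟨hx.1, hx.2.le⟩)
  rw [mul_assoc]
  refine (le_of_eq ?_).trans h2
  rw [zetaTerm]
  congr 1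
  push_cast
  rw [show (n : ℂ) + 1 + 1 = n + 2 by ring, show (n : ℂ) + 1 + 0 = n + 1 by ring]
  ring

lemma summable_add_one_rpow {a : ℝ} (ha : a < -1) : Summable fun n : ℕ => ((n : ℝ) + 1) ^ a := by
  have := (summable_nat_add_iff 1).mpr (Real.summable_nat_rpow.mpr ha)
  simpa using this

lemma summable_zetaTerm {s : ℂ} (hs : 0 < s.re) : Summable fun n => zetaTerm n s :=
  Summable.of_norm_bounded ((summable_add_one_rpow (by linarith)).mul_left _)
    fun n => norm_zetaTerm_le n hs

lemma tendsto_nat_add_one_cpow_neg {s : ℂ} (hs : s.re < 0) :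
    Tendsto (fun n : ℕ => ((n : ℂ) + 1) ^ s) atTop (𝓝 0) := by
  rw [tendsto_zero_iff_norm_tendsto_zero]
  have h1 : ∀ n : ℕ, ‖((n : ℂ) + 1) ^ s‖ = ((n + 1 : ℕ) : ℝ) ^ (-(-s.re)) := by
    intro n
    rw [show (n : ℂ) + 1 = (((n + 1 : ℕ) : ℝ) : ℂ) by push_cast; ring,
      Complex.norm_cpow_eq_rpow_re_of_pos (by positivity), neg_neg]
  simp_rw [h1]
  exact ((tendsto_rpow_neg_atTop (by linarith : 0 < -s.re)).comp tendsto_natCast_atTop_atTop).comp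
    (tendsto_add_atTop_nat 1)

lemma sum_zetaTerm (N : ℕ) (s : ℂ) :
    1 + ∑ n ∈ Finset.range N, zetaTerm n s
      = (s - 1) * ∑ n ∈ Finset.range N, ((n : ℂ) + 1) ^ (-s) + ((N : ℂ) + 1) ^ (1 - s) := by
  induction N with
  | zero => simp
  | succ N ih =>
    rw [Finset.sum_range_succ, ← add_assoc, ih, Finset.sum_range_succ, zetaTerm]
    push_cast
    rw [show (N : ℂ) + 1 + 1 = N + 2 by ring]
    ring

lemma riemannZeta₁_eq_of_one_lt {s : ℂ} (hs : 1 < s.re) :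
    riemannZeta₁ s = 1 + ∑' n, zetaTerm n s := by
  have hs1 : s ≠ 1 := by rintro rfl; simp at hs
  have hz : riemannZeta₁ s = (s - 1) * riemannZeta s := by
    rw [riemannZeta_eq_inv_sub_mul hs1, mul_inv_cancel_left₀ (sub_ne_zero.mpr hs1)]
  have h1 : HasSum (fun n : ℕ => ((n : ℂ) + 1) ^ (-s)) (riemannZeta s) := by
    rw [zeta_eq_tsum_one_div_nat_add_one_cpow hs]
    have : Summable fun n : ℕ => 1 / ((n : ℂ) + 1) ^ s := by
      have := (summable_nat_add_iff 1).mpr (Complex.summable_one_div_nat_cpow.mpr hs)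
      simpa using this
    refine (this.hasSum).congr_fun fun n => ?_
    rw [Complex.cpow_neg, one_div]
  have h2 := ((h1.tendsto_sum_nat).const_mul (s - 1)).add
    (tendsto_nat_add_one_cpow_neg (s := 1 - s) (by simpa using hs))
  have h3 := (summable_zetaTerm (s := s) (by linarith)).hasSum.tendsto_sum_nat.const_add 1
  simp_rw [sum_zetaTerm] at h3
  rw [hz, ← tendsto_nhds_unique h2 h3, add_zero]

lemma differentiable_zetaTerm (n : ℕ) : Differentiable ℂ (zetaTerm n) := by
  unfold zetaTerm
  have h1 : (n : ℂ) + 1 ≠ 0 := by exact_mod_cast Nat.succ_ne_zero n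
  have h2 : (n : ℂ) + 2 ≠ 0 := by exact_mod_cast Nat.succ_ne_zero (n + 1)
  intro s
  refine DifferentiableAt.add (DifferentiableAt.mul (by fun_prop) ?_) (DifferentiableAt.sub ?_ ?_)
  · exact (by fun_prop : DifferentiableAt ℂ (fun s : ℂ => -s) s).const_cpow (Or.inl h1)
  · exact (by fun_prop : DifferentiableAt ℂ (fun s : ℂ => 1 - s) s).const_cpow (Or.inl h2)
  · exact (by fun_prop : DifferentiableAt ℂ (fun s : ℂ => 1 - s) s).const_cpow (Or.inl h1)

/-- The Euler–Maclaurin expansion of `(s - 1) ζ(s)`, here in the half plane `Re s > 1/2`. -/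
lemma riemannZeta₁_eq {s : ℂ} (hs : 1 / 2 < s.re) :
    riemannZeta₁ s = 1 + ∑' n, zetaTerm n s := by
  -- Intersecting with a ball bounds the factor `‖w - 1‖ ‖w‖` of the terms uniformly. The radius is
  -- large enough to contain both `s` and the point `2`, near which the identity is already known.
  set R : ℝ := ‖s‖ + 3
  set U : Set ℂ := {w | 1 / 2 < w.re} ∩ Metric.ball 0 R
  have hU : IsOpen U := (isOpen_lt continuous_const Complex.continuous_re).inter Metric.isOpen_ball
  have hUc : IsPreconnected U :=
    ((convex_halfSpace_re_gt (1 / 2)).inter (convex_ball 0 R)).isPreconnected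
  have hd : DifferentiableOn ℂ (fun w => 1 + ∑' n, zetaTerm n w) U := by
    refine (differentiableOn_const _).add ?_
    refine Complex.differentiableOn_tsum_of_summable_norm
      (u := fun n : ℕ => (R + 1) * R * ((n : ℝ) + 1) ^ (-3 / 2 : ℝ))
      ((summable_add_one_rpow (by norm_num)).mul_left _)
      (fun n => (differentiable_zetaTerm n).differentiableOn) hU fun n w hw => ?_
    have hw1 : 1 / 2 < w.re := hw.1
    have hw2 : ‖w‖ ≤ R := by simpa using (Metric.mem_ball.mp hw.2).le
    refine (norm_zetaTerm_le n (by linarith)).trans ?_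
    have h1 : ‖w - 1‖ ≤ R + 1 := (norm_sub_le _ _).trans (by simpa using hw2)
    have h2 : ((n : ℝ) + 1) ^ (-w.re - 1) ≤ ((n : ℝ) + 1) ^ (-3 / 2 : ℝ) :=
      Real.rpow_le_rpow_of_exponent_le (by linarith [(n.cast_nonneg : (0 : ℝ) ≤ n)]) (by linarith)
    gcongr
  have hmem : (2 : ℂ) ∈ U := by
    refine ⟨by simp; norm_num, ?_⟩
    simp only [Metric.mem_ball, dist_zero_right, R]
    norm_num
    linarith [norm_nonneg s]
  have hev : riemannZeta₁ =ᶠ[𝓝 2] fun w => 1 + ∑' n, zetaTerm n w := by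
    have : {w : ℂ | 1 < w.re} ∈ 𝓝 (2 : ℂ) :=
      (isOpen_lt continuous_const Complex.continuous_re).mem_nhds (by simp)
    filter_upwards [this] with w hw using riemannZeta₁_eq_of_one_lt hw
  refine (AnalyticOnNhd.eqOn_of_preconnected_of_eventuallyEq
    (differentiable_riemannZeta₁.differentiableOn.analyticOnNhd hU) (hd.analyticOnNhd hU) hUc hmem hev)
    ⟨hs, ?_⟩
  simp only [Metric.mem_ball, dist_zero_right, R]
  linarith

lemma sum_add_one_rpow_le (N : ℕ) :
    ∑ n ∈ Finset.range N, ((n : ℝ) + 1) ^ (-199 / 200 : ℝ)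
      ≤ ((N : ℝ) + 1) ^ (1 / 100 : ℝ) * ∑' n : ℕ, ((n : ℝ) + 1) ^ (-201 / 200 : ℝ) := by
  refine le_trans ?_ (mul_le_mul_of_nonneg_left ((summable_add_one_rpow (a := -201 / 200)
    (by norm_num)).sum_le_tsum (Finset.range N) fun _ _ => by positivity) (by positivity))
  rw [Finset.mul_sum]
  refine Finset.sum_le_sum fun n hn => ?_
  have : (n : ℝ) + 1 ≤ N + 1 := by
    have := Finset.mem_range.mp hn
    exact_mod_cast (by omega : n + 1 ≤ N + 1)
  calc ((n : ℝ) + 1) ^ (-199 / 200 : ℝ)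
      = ((n : ℝ) + 1) ^ (1 / 100 : ℝ) * ((n : ℝ) + 1) ^ (-201 / 200 : ℝ) := by
        rw [← Real.rpow_add (by positivity)]; norm_num
    _ ≤ _ := by gcongr

/-- `ζ` grows slowly in vertical strips slightly to the left of the line `Re s = 1`. -/
lemma exists_norm_riemannZeta_le : ∃ C : ℝ, 0 < C ∧ ∀ s : ℂ, 199 / 200 ≤ s.re → s.re ≤ 3 →
    1 ≤ |s.im| → ‖riemannZeta s‖ ≤ C * |s.im| ^ (1 / 40 : ℝ) := by
  set A := ∑' n : ℕ, ((n : ℝ) + 1) ^ (-201 / 200 : ℝ)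
  set B := ∑' n : ℕ, ((n : ℝ) + 1) ^ (-5 / 4 : ℝ)
  have hA : 0 ≤ A := tsum_nonneg fun n => by positivity
  have hB : 0 ≤ B := tsum_nonneg fun n => by positivity
  refine ⟨4 * A + 4 + 4 * B, by positivity, fun s h1 h2 h3 => ?_⟩
  set t := |s.im|
  -- With `N` about `t²` the finite sum costs `N^(1/100)`, of order `t^(1/50)`. In the tail the
  -- exponent `-399/200` is split as `-5/4 - 149/200`: the first part keeps the series convergent,
  -- and `N^(-149/200)` beats the factor `‖s‖`, which is of order `t`.
  set N : ℕ := ⌊t ^ 2⌋₊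
  have hN1 : (N : ℝ) + 1 ≤ 2 * t ^ 2 := by
    have := Nat.floor_le (sq_nonneg t)
    nlinarith
  have hN2 : t ^ 2 ≤ (N : ℝ) + 1 := (Nat.lt_floor_add_one _).le
  have hs1 : s ≠ 1 := by
    rintro rfl; simp [t] at h3; linarith
  have ht1 : t ≤ ‖s - 1‖ := by simpa [t] using Complex.abs_im_le_norm (s - 1)
  have hs0 : ‖s‖ ≤ 4 * t := by
    refine (Complex.norm_le_abs_re_add_abs_im s).trans ?_
    rw [abs_of_nonneg (by linarith)]
    change s.re + t ≤ _
    linarith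
  have hpos : 0 < ‖s - 1‖ := by linarith
  have hsplit : riemannZeta₁ s = (s - 1) * ∑ n ∈ Finset.range N, ((n : ℂ) + 1) ^ (-s)
      + ((N : ℂ) + 1) ^ (1 - s) + ∑' n, zetaTerm (n + N) s := by
    rw [riemannZeta₁_eq (by linarith), ← sum_zetaTerm,
      ← (summable_zetaTerm (s := s) (by linarith)).sum_add_tsum_nat_add N, add_assoc]
  have hz : riemannZeta s = (s - 1)⁻¹ * riemannZeta₁ s := riemannZeta_eq_inv_sub_mul hs1
  have hNt : ((N : ℝ) + 1) ^ (1 / 100 : ℝ) ≤ 4 * t ^ (1 / 40 : ℝ) := by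
    calc ((N : ℝ) + 1) ^ (1 / 100 : ℝ) ≤ (2 * t ^ 2) ^ (1 / 100 : ℝ) := by gcongr
      _ = 2 ^ (1 / 100 : ℝ) * t ^ (1 / 50 : ℝ) := by
        rw [Real.mul_rpow (by norm_num) (by positivity), ← Real.rpow_natCast t 2,
          ← Real.rpow_mul (by positivity)]
        norm_num
      _ ≤ 4 * t ^ (1 / 40 : ℝ) := by
        gcongr
        · calc (2 : ℝ) ^ (1 / 100 : ℝ) ≤ 2 ^ (1 : ℝ) := by gcongr <;> norm_num
            _ ≤ 4 := by norm_num
        · norm_num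
  have hb1 : ‖∑ n ∈ Finset.range N, ((n : ℂ) + 1) ^ (-s)‖ ≤ 4 * A * t ^ (1 / 40 : ℝ) := by
    refine (norm_sum_le _ _).trans ?_
    have : ∀ n ∈ Finset.range N, ‖((n : ℂ) + 1) ^ (-s)‖ ≤ ((n : ℝ) + 1) ^ (-199 / 200 : ℝ) := by
      intro n _
      rw [show (n : ℂ) + 1 = ((n + 1 : ℝ) : ℂ) by push_cast; ring,
        Complex.norm_cpow_eq_rpow_re_of_pos (by positivity), Complex.neg_re]
      exact Real.rpow_le_rpow_of_exponent_le (by linarith [(n.cast_nonneg : (0 : ℝ) ≤ n)])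
        (by linarith)
    refine (Finset.sum_le_sum this).trans ((sum_add_one_rpow_le N).trans ?_)
    exact (mul_le_mul_of_nonneg_right hNt hA).trans_eq (by ring)
  have hb2 : ‖((N : ℂ) + 1) ^ (1 - s)‖ ≤ 4 * t ^ (1 / 40 : ℝ) := by
    rw [show (N : ℂ) + 1 = ((N + 1 : ℝ) : ℂ) by push_cast; ring,
      Complex.norm_cpow_eq_rpow_re_of_pos (by positivity)]
    refine le_trans ?_ hNt
    refine Real.rpow_le_rpow_of_exponent_le (by linarith [(N.cast_nonneg : (0 : ℝ) ≤ N)]) ?_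
    simp; linarith
  have hb3 : ‖∑' n, zetaTerm (n + N) s‖ ≤ ‖s - 1‖ * (4 * B * t ^ (1 / 40 : ℝ)) := by
    have hterm : ∀ n, ‖zetaTerm (n + N) s‖ ≤
        ‖s - 1‖ * 4 * t ^ (1 / 40 : ℝ) * ((n : ℝ) + 1) ^ (-5 / 4 : ℝ) := by
      intro n
      refine (norm_zetaTerm_le (n + N) (by linarith)).trans ?_
      have e1 : (((n + N : ℕ) : ℝ) + 1) ^ (-s.re - 1)
          ≤ ((n : ℝ) + 1) ^ (-5 / 4 : ℝ) * ((N : ℝ) + 1) ^ (-149 / 200 : ℝ) := by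
        have hn0 : (0 : ℝ) ≤ n := n.cast_nonneg
        have hN0 : (0 : ℝ) ≤ N := N.cast_nonneg
        calc (((n + N : ℕ) : ℝ) + 1) ^ (-s.re - 1)
            ≤ (((n + N : ℕ) : ℝ) + 1) ^ (-5 / 4 + -149 / 200 : ℝ) := by
              refine Real.rpow_le_rpow_of_exponent_le (by push_cast; linarith) (by linarith)
          _ = (((n + N : ℕ) : ℝ) + 1) ^ (-5 / 4 : ℝ) * (((n + N : ℕ) : ℝ) + 1) ^ (-149 / 200 : ℝ) := by
              rw [Real.rpow_add (by positivity)]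
          _ ≤ _ := by
              gcongr ?_ * ?_
              · exact Real.rpow_le_rpow_of_nonpos (by positivity) (by push_cast; linarith)
                  (by norm_num)
              · exact Real.rpow_le_rpow_of_nonpos (by positivity) (by push_cast; linarith)
                  (by norm_num)
      have e2 : ‖s‖ * ((N : ℝ) + 1) ^ (-149 / 200 : ℝ) ≤ 4 * t ^ (1 / 40 : ℝ) := by
        calc ‖s‖ * ((N : ℝ) + 1) ^ (-149 / 200 : ℝ) ≤ (4 * t) * (t ^ 2) ^ (-149 / 200 : ℝ) := by
              gcongr ?_ * ?_
              exact Real.rpow_le_rpow_of_nonpos (by positivity) hN2 (by norm_num)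
          _ = 4 * t ^ (1 + 2 * (-149 / 200) : ℝ) := by
              rw [← Real.rpow_natCast t 2, ← Real.rpow_mul (by positivity),
                Real.rpow_add (by positivity), Real.rpow_one]
              push_cast; ring
          _ ≤ _ := by gcongr; norm_num
      calc ‖s - 1‖ * ‖s‖ * (((n + N : ℕ) : ℝ) + 1) ^ (-s.re - 1)
          ≤ ‖s - 1‖ * ‖s‖ * (((n : ℝ) + 1) ^ (-5 / 4 : ℝ) * ((N : ℝ) + 1) ^ (-149 / 200 : ℝ)) := by
            gcongr
        _ = ‖s - 1‖ * (‖s‖ * ((N : ℝ) + 1) ^ (-149 / 200 : ℝ)) * ((n : ℝ) + 1) ^ (-5 / 4 : ℝ) := by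
            ring
        _ ≤ ‖s - 1‖ * (4 * t ^ (1 / 40 : ℝ)) * ((n : ℝ) + 1) ^ (-5 / 4 : ℝ) := by gcongr
        _ = _ := by ring
    have := tsum_of_norm_bounded
      ((summable_add_one_rpow (a := -5 / 4) (by norm_num)).mul_left _).hasSum hterm
    rw [tsum_mul_left] at this
    refine this.trans (le_of_eq ?_)
    ring
  rw [hz, norm_mul, norm_inv, inv_mul_le_iff₀ hpos, hsplit]
  have hb2' : ‖((N : ℂ) + 1) ^ (1 - s)‖ ≤ ‖s - 1‖ * (4 * t ^ (1 / 40 : ℝ)) :=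
    hb2.trans (le_mul_of_one_le_left (by positivity) (by linarith))
  calc _ ≤ ‖s - 1‖ * (4 * A * t ^ (1 / 40 : ℝ)) + ‖s - 1‖ * (4 * t ^ (1 / 40 : ℝ))
        + ‖s - 1‖ * (4 * B * t ^ (1 / 40 : ℝ)) := by
        refine (norm_add₃_le).trans ?_
        rw [norm_mul]
        gcongr
    _ = _ := by ring

lemma abs_sub_le_of_mem_closedBall {s w : ℂ} {r : ℝ} (h : ‖w - s‖ ≤ r) :
    |w.re - s.re| ≤ r ∧ |w.im - s.im| ≤ r :=
  ⟨(Complex.abs_re_le_norm (w - s)).trans h, (Complex.abs_im_le_norm (w - s)).trans h⟩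

/-- Cauchy's estimate on a disc of radius `1/200`, which stays inside the region `Re w ≥ 199/200`
where growth is already controlled. This is the reason for bounding `ζ` slightly to the left of the
line. -/
lemma exists_norm_iteratedDeriv_riemannZeta_le (n : ℕ) : ∃ C : ℝ, 0 < C ∧ ∀ s : ℂ, 1 ≤ s.re →
    s.re ≤ 2 → 2 ≤ |s.im| → ‖iteratedDeriv n riemannZeta s‖ ≤ C * |s.im| ^ (1 / 40 : ℝ) := by
  obtain ⟨C, hC, h⟩ := exists_norm_riemannZeta_le
  refine ⟨n.factorial * (2 * C) / (1 / 200) ^ n, by positivity, fun s h1 h2 h3 => ?_⟩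
  have hmem : ∀ w : ℂ, ‖w - s‖ ≤ 1 / 200 → 199 / 200 ≤ w.re ∧ w.re ≤ 3 ∧ 1 ≤ |w.im| ∧
      |w.im| ≤ 2 * |s.im| := by
    intro w hw
    obtain ⟨ha, hb⟩ := abs_sub_le_of_mem_closedBall hw
    have hc := abs_le.mp ha
    have hd := (abs_abs_sub_abs_le_abs_sub w.im s.im).trans hb
    have he := abs_le.mp hd
    refine ⟨by linarith, by linarith, by linarith, by linarith⟩
  have hd : DiffContOnCl ℂ riemannZeta (Metric.ball s (1 / 200)) := by
    refine DifferentiableOn.diffContOnCl fun w hw => ?_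
    rw [closure_ball _ (by norm_num), Metric.mem_closedBall, dist_eq_norm] at hw
    refine (differentiableAt_riemannZeta ?_).differentiableWithinAt
    rintro rfl
    have := (hmem 1 hw).2.2.1
    norm_num at this
  have := Complex.norm_iteratedDeriv_le_of_forall_mem_sphere_norm_le n
    (by norm_num : (0 : ℝ) < 1 / 200) hd (C := 2 * C * |s.im| ^ (1 / 40 : ℝ)) (by
    intro w hw
    rw [Metric.mem_sphere, dist_eq_norm] at hw
    obtain ⟨ha, hb, hc, hd⟩ := hmem w hw.le
    refine (h w ha hb hc).trans ?_
    calc C * |w.im| ^ (1 / 40 : ℝ) ≤ C * (2 * |s.im|) ^ (1 / 40 : ℝ) := by gcongr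
      _ = C * (2 ^ (1 / 40 : ℝ) * |s.im| ^ (1 / 40 : ℝ)) := by
        rw [Real.mul_rpow (by norm_num) (by positivity)]
      _ ≤ C * (2 ^ (1 : ℝ) * |s.im| ^ (1 / 40 : ℝ)) := by gcongr <;> norm_num
      _ = _ := by rw [Real.rpow_one]; ring)
  refine this.trans (le_of_eq ?_)
  ring

/-! ### Lower bounds for `ζ` and growth of its logarithmic derivative -/

lemma exists_riemannZeta_le_div : ∃ C : ℝ, 0 < C ∧ ∀ x : ℝ, 0 < x → x ≤ 1 →
    ‖riemannZeta (1 + x)‖ ≤ C / x := by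
  have hcont : Continuous fun x : ℝ => riemannZeta₁ (1 + x) :=
    differentiable_riemannZeta₁.continuous.comp (by fun_prop)
  obtain ⟨C, hC⟩ := isCompact_Icc.exists_bound_of_continuousOn
    (s := Set.Icc (0 : ℝ) 1) hcont.continuousOn
  refine ⟨max C 1, by positivity, fun x h0 h1 => ?_⟩
  have hne : (1 + x : ℂ) ≠ 1 := by
    simpa using h0.ne'
  rw [riemannZeta_eq_inv_sub_mul hne, add_sub_cancel_left, norm_mul, norm_inv, Complex.norm_real,
    Real.norm_of_nonneg h0.le, inv_mul_eq_div]
  gcongr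
  exact (hC x ⟨h0.le, h1⟩).trans (le_max_left _ _)

lemma riemannZeta_product_ge_one {x : ℝ} (hx : 0 < x) (y : ℝ) :
    1 ≤ ‖riemannZeta (1 + x)‖ ^ 3 * ‖riemannZeta (1 + x + Complex.I * y)‖ ^ 4 *
      ‖riemannZeta (1 + x + 2 * Complex.I * y)‖ := by
  have := DirichletCharacter.norm_LFunction_product_ge_one (1 : DirichletCharacter ℂ 1) hx y
  simpa [DirichletCharacter.LFunctionTrivChar] using this

/-- A quantitative form of the nonvanishing of `ζ` on the line `Re s = 1`. -/
lemma exists_le_norm_riemannZeta : ∃ c : ℝ, 0 < c ∧ ∀ s : ℂ, 1 < s.re → s.re ≤ 2 → 2 ≤ |s.im| →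
    c * |s.im| ^ (-(1 / 10) : ℝ) ≤ ‖riemannZeta s‖ := by
  obtain ⟨C₀, hC₀, h0⟩ := exists_riemannZeta_le_div
  obtain ⟨C₁, hC₁, h1⟩ := exists_norm_riemannZeta_le
  obtain ⟨D, hD, hd⟩ := exists_norm_iteratedDeriv_riemannZeta_le 1
  obtain ⟨c, hc, hc4⟩ : ∃ c : ℝ, 0 < c ∧ c ^ 4 * (C₀ ^ 3 * (2 * C₁)) ≤ 1 := by
    refine ⟨min 1 (C₀ ^ 3 * (2 * C₁))⁻¹, by positivity, ?_⟩
    have hm1 : min 1 (C₀ ^ 3 * (2 * C₁))⁻¹ ≤ 1 := min_le_left _ _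
    have hm2 : min 1 (C₀ ^ 3 * (2 * C₁))⁻¹ ≤ (C₀ ^ 3 * (2 * C₁))⁻¹ := min_le_right _ _
    have hm0 : 0 < min 1 (C₀ ^ 3 * (2 * C₁))⁻¹ := by positivity
    set m := min 1 (C₀ ^ 3 * (2 * C₁))⁻¹
    have : m ^ 4 ≤ m := by
      calc m ^ 4 ≤ m ^ 1 := pow_le_pow_of_le_one hm0.le hm1 (by norm_num)
        _ = m := pow_one m
    calc m ^ 4 * (C₀ ^ 3 * (2 * C₁)) ≤ (C₀ ^ 3 * (2 * C₁))⁻¹ * (C₀ ^ 3 * (2 * C₁)) := by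
          gcongr; exact this.trans hm2
      _ = 1 := inv_mul_cancel₀ (by positivity)
  obtain ⟨a, ha, ha1, hac⟩ : ∃ a : ℝ, 0 < a ∧ a ≤ 1 ∧ D * a ≤ c / 2 :=
    ⟨min 1 (c / (2 * D)), by positivity, min_le_left _ _, by
      calc D * min 1 (c / (2 * D)) ≤ D * (c / (2 * D)) := by gcongr; exact min_le_right _ _
        _ = c / 2 := by field_simp⟩
  -- The 3-4-1 inequality bounds `‖ζ(1+x+iy)‖⁴` below by a multiple of `x³ |y|^(-1/40)`. The
  -- parameter `b` plays the part of `x^(1/4)`, which keeps fractional powers of `x` out of the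
  -- argument.
  have hlow : ∀ x : ℝ, 0 < x → x ≤ 1 → ∀ y : ℝ, 2 ≤ |y| → ∀ b : ℝ, 0 ≤ b → b ^ 4 ≤ x →
      c * b ^ 3 * |y| ^ (-(1 / 160) : ℝ) ≤ ‖riemannZeta (1 + x + Complex.I * y)‖ := by
    intro x hx0 hx1 y hy b hb hbx
    have e1 := riemannZeta_product_ge_one hx0 y
    have e2 := h0 x hx0 hx1
    have e3 := h1 (1 + x + 2 * Complex.I * y) (by simp; linarith) (by simp; linarith)
      (by simp [abs_mul]; linarith)
    simp only [Complex.add_im, Complex.one_im, Complex.ofReal_im, Complex.mul_im, Complex.mul_re,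
      Complex.re_ofNat, Complex.im_ofNat, Complex.I_re, Complex.I_im, Complex.ofReal_re] at e3
    norm_num at e3
    have e4 : ‖riemannZeta (1 + x + 2 * Complex.I * y)‖ ≤ 2 * C₁ * |y| ^ (1 / 40 : ℝ) := by
      refine e3.trans ?_
      rw [Real.mul_rpow (by positivity) (by positivity)]
      calc C₁ * (2 ^ (1 / 40 : ℝ) * |y| ^ (1 / 40 : ℝ))
          ≤ C₁ * (2 ^ (1 : ℝ) * |y| ^ (1 / 40 : ℝ)) := by gcongr <;> norm_num
        _ = _ := by rw [Real.rpow_one]; ring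
    have hy0 : 0 < |y| := by linarith
    set Z := ‖riemannZeta (1 + x + Complex.I * y)‖
    have hpw : (|y| ^ (-(1 / 160) : ℝ)) ^ 4 * |y| ^ (1 / 40 : ℝ) = 1 := by
      rw [← Real.rpow_natCast, ← Real.rpow_mul hy0.le, ← Real.rpow_add hy0]
      norm_num
    have e5 : 1 ≤ (C₀ / x) ^ 3 * Z ^ 4 * (2 * C₁ * |y| ^ (1 / 40 : ℝ)) :=
      e1.trans (by gcongr)
    have e6 : x ^ 3 ≤ C₀ ^ 3 * (2 * C₁) * |y| ^ (1 / 40 : ℝ) * Z ^ 4 := by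
      have := mul_le_mul_of_nonneg_left e5 (by positivity : 0 ≤ x ^ 3)
      calc x ^ 3 = x ^ 3 * 1 := by ring
        _ ≤ _ := this
        _ = _ := by field_simp
    refine le_of_pow_le_pow_left₀ (n := 4) (by norm_num) (norm_nonneg _) ?_
    have e7 : b ^ 12 ≤ x ^ 3 := by
      calc b ^ 12 = (b ^ 4) ^ 3 := by ring
        _ ≤ x ^ 3 := by gcongr
    set u := (|y| ^ (-(1 / 160) : ℝ)) ^ 4
    have hu : 0 ≤ u := by positivity
    calc (c * b ^ 3 * |y| ^ (-(1 / 160) : ℝ)) ^ 4 = c ^ 4 * b ^ 12 * u := by ring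
      _ ≤ c ^ 4 * (C₀ ^ 3 * (2 * C₁) * |y| ^ (1 / 40 : ℝ) * Z ^ 4) * u := by
        gcongr; exact e7.trans e6
      _ = (c ^ 4 * (C₀ ^ 3 * (2 * C₁))) * (u * |y| ^ (1 / 40 : ℝ)) * Z ^ 4 := by ring
      _ = (c ^ 4 * (C₀ ^ 3 * (2 * C₁))) * Z ^ 4 := by rw [hpw, mul_one]
      _ ≤ Z ^ 4 := mul_le_of_le_one_left (by positivity) hc4
  refine ⟨c * a ^ 3 / 2, by positivity, fun s hs1 hs2 hs3 => ?_⟩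
  set t := |s.im|
  have ht0 : 0 < t := by linarith
  -- The exponent balances two bounds. At distance at least `b⁴` from the line, `hlow` gives `c b³
  -- t^(-1/160) = c a³ t^(-1/10)`. Closer in, moving horizontally from `Re w = 1 + b⁴` costs at most
  -- `D t^(1/40) b⁴ = D a · a³ t^(-1/10)`, which is at most half of that, because `D a ≤ c/2`.
  set b := a * t ^ (-(1 / 32) : ℝ)
  have hb0 : 0 < b := by positivity
  have hb1 : b ≤ 1 := by
    refine mul_le_one₀ ha1 (by positivity) (Real.rpow_le_one_of_one_le_of_nonpos (by linarith) ?_)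
    norm_num
  have hbe : b ^ 3 * t ^ (-(1 / 160) : ℝ) = a ^ 3 * t ^ (-(1 / 10) : ℝ) := by
    rw [mul_pow, mul_assoc, ← Real.rpow_natCast (t ^ _), ← Real.rpow_mul ht0.le,
      ← Real.rpow_add ht0]
    norm_num
  have hs : (1 + (s.re - 1 : ℝ) + Complex.I * s.im : ℂ) = s := by
    apply Complex.ext <;> simp
  by_cases hcase : b ^ 4 ≤ s.re - 1
  · have := hlow (s.re - 1) (by linarith) (by linarith) s.im hs3 b hb0.le hcase
    rw [hs, mul_assoc, hbe] at this
    refine le_trans ?_ this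
    have : 0 ≤ c * (a ^ 3 * t ^ (-(1 / 10) : ℝ)) := by positivity
    calc _ = c * (a ^ 3 * t ^ (-(1 / 10) : ℝ)) / 2 := by ring
      _ ≤ _ := by linarith
  · push Not at hcase
    have hb4 : b ^ 4 ≤ 1 := pow_le_one₀ hb0.le hb1
    have e1 := hlow (b ^ 4) (by positivity) hb4 s.im hs3 b hb0.le le_rfl
    rw [mul_assoc, hbe] at e1
    set w : ℂ := 1 + (b ^ 4 : ℝ) + Complex.I * s.im
    have hwre : w.re = 1 + b ^ 4 := by simp [w, -Complex.ofReal_pow]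
    have hwim : w.im = s.im := by simp [w, -Complex.ofReal_pow]
    have e2 : ‖riemannZeta w - riemannZeta s‖ ≤ D * t ^ (1 / 40 : ℝ) * ‖w - s‖ := by
      refine Convex.norm_image_sub_le_of_norm_deriv_le (𝕜 := ℂ)
        (s := {z : ℂ | 1 ≤ z.re ∧ z.re ≤ 2 ∧ z.im = s.im}) ?_ ?_ ?_ ?_ ?_
      · rintro z ⟨_, _, hz⟩
        refine differentiableAt_riemannZeta ?_
        rintro rfl
        rw [Complex.one_im] at hz
        simp [t, ← hz] at ht0
      · rintro z ⟨hz1, hz2, hz3⟩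
        have := hd z hz1 hz2 (by rw [hz3]; exact hs3)
        rwa [iteratedDeriv_one, hz3] at this
      · have h1 : Convex ℝ {z : ℂ | 1 ≤ z.re} := convex_halfSpace_re_ge 1
        have h2 : Convex ℝ {z : ℂ | z.re ≤ 2} := convex_halfSpace_re_le 2
        have h3 : Convex ℝ {z : ℂ | z.im = s.im} :=
          (convex_singleton s.im).is_linear_preimage (f := Complex.im) ⟨fun _ _ => rfl, by simp⟩
        exact h1.inter (h2.inter h3)
      · exact ⟨hs1.le, hs2, rfl⟩
      · exact ⟨by rw [hwre]; linarith [pow_pos hb0 4], by rw [hwre]; linarith, hwim⟩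
    have e3 : ‖w - s‖ ≤ b ^ 4 := by
      have : w - s = ((1 + b ^ 4 - s.re : ℝ) : ℂ) := by
        apply Complex.ext
        · rw [Complex.sub_re, hwre]; simp [-Complex.ofReal_pow]
        · rw [Complex.sub_im, hwim]; simp [-Complex.ofReal_pow]
      rw [this, Complex.norm_real, Real.norm_of_nonneg (by linarith)]
      linarith
    have e4 : D * t ^ (1 / 40 : ℝ) * ‖w - s‖ ≤ c * (a ^ 3 * t ^ (-(1 / 10) : ℝ)) / 2 := by
      have : t ^ (1 / 40 : ℝ) * b ^ 4 = a ^ 4 * t ^ (-(1 / 10) : ℝ) := by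
        rw [mul_pow, mul_left_comm, ← Real.rpow_natCast (t ^ _), ← Real.rpow_mul ht0.le,
          ← Real.rpow_add ht0]
        norm_num
      calc D * t ^ (1 / 40 : ℝ) * ‖w - s‖ ≤ D * t ^ (1 / 40 : ℝ) * b ^ 4 := by gcongr
        _ = (D * a) * (a ^ 3 * t ^ (-(1 / 10) : ℝ)) := by rw [mul_assoc, this]; ring
        _ ≤ (c / 2) * (a ^ 3 * t ^ (-(1 / 10) : ℝ)) := by gcongr
        _ = _ := by ring
    have e5 := norm_sub_norm_le (riemannZeta w) (riemannZeta s)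
    have e6 : c * (a ^ 3 * t ^ (-(1 / 10) : ℝ)) ≤ ‖riemannZeta w‖ := e1
    calc _ = c * (a ^ 3 * t ^ (-(1 / 10) : ℝ)) - c * (a ^ 3 * t ^ (-(1 / 10) : ℝ)) / 2 := by ring
      _ ≤ _ := by linarith

/-- Growth of `ζ'/ζ` and its derivative to the right of the line `Re s = 1`. -/
lemma exists_norm_logDeriv_riemannZeta_le : ∃ C : ℝ, 0 < C ∧ ∀ s : ℂ, 1 < s.re → s.re ≤ 2 →
    2 ≤ |s.im| → ‖deriv riemannZeta s / riemannZeta s‖ ≤ C * |s.im| ^ (1 / 4 : ℝ) ∧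
      ‖deriv (fun w => deriv riemannZeta w / riemannZeta w) s‖ ≤ C * |s.im| ^ (1 / 4 : ℝ) := by
  obtain ⟨c, hc, h0⟩ := exists_le_norm_riemannZeta
  obtain ⟨C₁, hC₁, h1⟩ := exists_norm_iteratedDeriv_riemannZeta_le 1
  obtain ⟨C₂, hC₂, h2⟩ := exists_norm_iteratedDeriv_riemannZeta_le 2
  refine ⟨C₁ / c + C₂ / c + (C₁ / c) ^ 2, by positivity, fun s hs1 hs2 hs3 => ?_⟩
  have a0 := h0 s hs1 hs2 hs3
  have a1 := h1 s hs1.le hs2 hs3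
  have a2 := h2 s hs1.le hs2 hs3
  rw [iteratedDeriv_one] at a1
  rw [iteratedDeriv_succ, iteratedDeriv_one] at a2
  set t := |s.im|
  have ht0 : 0 < t := by linarith
  have ht1 : 1 ≤ t := by linarith
  have hz : riemannZeta s ≠ 0 := riemannZeta_ne_zero_of_one_le_re hs1.le
  have hs : s ≠ 1 := by rintro rfl; simp at hs1
  -- The exponents add as `1/40 + 1/10 = 1/8`; the square of the logarithmic derivative, which
  -- occurs in its derivative, accounts for the final `1/4`.
  have hdiv : ∀ {A : ℝ} {z : ℂ}, 0 ≤ A → ‖z‖ ≤ A * t ^ (1 / 40 : ℝ) →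
      ‖z / riemannZeta s‖ ≤ A / c * t ^ (1 / 8 : ℝ) := by
    intro A z hA hz
    rw [norm_div]
    calc ‖z‖ / ‖riemannZeta s‖ ≤ A * t ^ (1 / 40 : ℝ) / (c * t ^ (-(1 / 10) : ℝ)) := by gcongr
      _ = A / c * (t ^ (1 / 40 : ℝ) / t ^ (-(1 / 10) : ℝ)) := by rw [mul_div_mul_comm]
      _ = _ := by rw [← Real.rpow_sub ht0]; norm_num
  have b1 := hdiv hC₁.le a1
  have b2 := hdiv hC₂.le a2
  have hle : t ^ (1 / 8 : ℝ) ≤ t ^ (1 / 4 : ℝ) := by gcongr; norm_num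
  have hsq : (t ^ (1 / 8 : ℝ)) ^ 2 = t ^ (1 / 4 : ℝ) := by
    rw [← Real.rpow_natCast, ← Real.rpow_mul ht0.le]; norm_num
  have hpos : 0 ≤ t ^ (1 / 4 : ℝ) := by positivity
  have p1 : 0 < C₁ / c := by positivity
  have p2 : 0 < C₂ / c := by positivity
  constructor
  · calc _ ≤ C₁ / c * t ^ (1 / 8 : ℝ) := b1
      _ ≤ C₁ / c * t ^ (1 / 4 : ℝ) := by gcongr
      _ ≤ _ := by gcongr; nlinarith
  · have hopen : IsOpen ({1}ᶜ : Set ℂ) := isOpen_compl_singleton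
    have hd0 : DifferentiableOn ℂ riemannZeta {1}ᶜ := fun w hw =>
      (differentiableAt_riemannZeta hw).differentiableWithinAt
    have hdd : DifferentiableAt ℂ (deriv riemannZeta) s :=
      (hd0.deriv hopen).differentiableAt (hopen.mem_nhds hs)
    have hderiv : deriv (fun w => deriv riemannZeta w / riemannZeta w) s
        = deriv (deriv riemannZeta) s / riemannZeta s - (deriv riemannZeta s / riemannZeta s) ^ 2 := by
      rw [deriv_fun_div hdd (differentiableAt_riemannZeta hs) hz]
      field_simp
    rw [hderiv]
    refine (norm_sub_le _ _).trans ?_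
    rw [norm_pow]
    calc _ ≤ C₂ / c * t ^ (1 / 8 : ℝ) + (C₁ / c * t ^ (1 / 8 : ℝ)) ^ 2 := by gcongr
      _ = C₂ / c * t ^ (1 / 8 : ℝ) + (C₁ / c) ^ 2 * t ^ (1 / 4 : ℝ) := by rw [mul_pow, hsq]
      _ ≤ C₂ / c * t ^ (1 / 4 : ℝ) + (C₁ / c) ^ 2 * t ^ (1 / 4 : ℝ) := by gcongr
      _ = (C₂ / c + (C₁ / c) ^ 2) * t ^ (1 / 4 : ℝ) := by ring
      _ ≤ _ := by gcongr; linarith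

/-! ### A Plancherel inequality on the line -/

open FourierTransform in
/-- One half of Plancherel's theorem, for integrable square-integrable functions on the line. -/
lemma eLpNorm_le_eLpNorm_fourier {F : ℝ → ℂ} (h1 : Integrable F) (h2 : MemLp F 2)
    (h3 : MemLp (𝓕 F) 2) : eLpNorm F 2 ≤ eLpNorm (𝓕 F) 2 := by
  set G : Lp ℂ 2 (volume : Measure ℝ) := h2.star.toLp with hG
  set A : ℝ := ‖h3.toLp‖
  -- Duality. For Schwartz `φ = 𝓕 ψ`, moving the transform across gives `∫ F φ = ∫ 𝓕 F · ψ`, at most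
  -- `‖𝓕 F‖₂ ‖ψ‖₂ = ‖𝓕 F‖₂ ‖φ‖₂`. Density extends this to all of `L²`, and testing on `G` itself
  -- concludes.
  have key : ∀ h : Lp ℂ 2 (volume : Measure ℝ), ‖inner ℂ G h‖ ≤ A * ‖h‖ := by
    intro h
    refine DenseRange.induction_on (SchwartzMap.denseRange_toLpCLM (E := ℝ) (F := ℂ) (p := 2)
      (μ := volume) ENNReal.ofNat_ne_top) h
      (isClosed_le (by fun_prop) (by fun_prop)) fun φ => ?_
    set ψ : SchwartzMap ℝ ℂ := 𝓕⁻ φ with hψ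
    have hφ : φ = 𝓕 ψ := by simp [hψ]
    have e1 : inner ℂ G (φ.toLp 2) = ∫ x, F x * φ x := by
      rw [L2.inner_def]
      refine integral_congr_ae ?_
      filter_upwards [h2.star.coeFn_toLp, φ.coeFn_toLp 2] with x hx1 hx2
      rw [hG, hx1, hx2]
      simp [mul_comm]
    have e2 : ∫ x, F x * φ x = ∫ x, (𝓕 F) x * ψ x := by
      have := VectorFourier.integral_fourierIntegral_smul_eq_flip (L := innerₗ ℝ)
        (μ := volume) (ν := volume) (f := F) (g := ψ) Real.continuous_fourierChar continuous_inner
        h1 ψ.integrable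
      simp only [smul_eq_mul, flip_innerₗ] at this
      rw [hφ]
      simp only [SchwartzMap.fourier_coe]
      exact this.symm
    have e3 : ∫ x, (𝓕 F) x * ψ x = inner ℂ (h3.star.toLp) (ψ.toLp 2) := by
      rw [L2.inner_def]
      refine integral_congr_ae ?_
      filter_upwards [h3.star.coeFn_toLp, ψ.coeFn_toLp 2] with x hx1 hx2
      rw [hx1, hx2]
      simp [mul_comm]
    have e4 : ‖ψ.toLp 2‖ = ‖φ.toLp 2‖ := by
      rw [hφ]
      exact (SchwartzMap.norm_fourier_toL2_eq ψ).symm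
    have e5 : ‖h3.star.toLp‖ = A := by
      simp only [A, Lp.norm_toLp]
      congr 1
      exact eLpNorm_congr_norm_ae (Eventually.of_forall fun x => by simp)
    change ‖inner ℂ G (φ.toLp 2)‖ ≤ A * ‖φ.toLp 2‖
    rw [e1, e2, e3, ← e4, ← e5]
    exact norm_inner_le_norm _ _
  have h4 := key G
  rw [inner_self_eq_norm_sq_to_K, norm_pow] at h4
  simp only [Complex.coe_algebraMap, Complex.norm_real, norm_norm] at h4
  have h5 : ‖G‖ ≤ A := by
    by_contra hlt
    push Not at hlt
    have : 0 ≤ A := norm_nonneg _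
    nlinarith [norm_nonneg G]
  have h6 : eLpNorm (star F) 2 = eLpNorm F 2 :=
    eLpNorm_congr_norm_ae (Eventually.of_forall fun x => by simp)
  simp only [hG, A, Lp.norm_toLp, h6] at h5
  exact (ENNReal.toReal_le_toReal h2.2.ne h3.2.ne).mp h5

/-! ### The function `log(s ζ(1 + s))` and the decay of the kernel -/

open ArithmeticFunction

/-- The Dirichlet series of `log ζ(1 + s)`. -/
noncomputable def logZetaSeries (s : ℂ) : ℂ := LSeries (fun n => (Λ n : ℂ) / Real.log n) (1 + s)

/-- `log (s ζ(1 + s))` in the half plane `Re s > 0`. -/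
noncomputable def logZetaReg (s : ℂ) : ℂ := logZetaSeries s + Complex.log s

/-- The derivative of `logZetaReg`. -/
noncomputable def logZetaReg' (s : ℂ) : ℂ :=
  deriv riemannZeta (1 + s) / riemannZeta (1 + s) + 1 / s

/-- The second derivative of `logZetaReg`. -/
noncomputable def logZetaReg'' (s : ℂ) : ℂ :=
  deriv (fun w => deriv riemannZeta w / riemannZeta w) (1 + s) - 1 / s ^ 2

lemma abscissa_logZetaSeries_le :
    LSeries.abscissaOfAbsConv (fun n => (Λ n : ℂ) / Real.log n) ≤ 1 := by
  refine LSeries.abscissaOfAbsConv_le_of_forall_lt_LSeriesSummable fun y hy => ?_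
  refine LSeriesSummable_of_bounded_of_one_lt_re (m := 1) (fun n _ => ?_) (by simpa using hy)
  rw [norm_div, Complex.norm_real, Complex.norm_real,
    Real.norm_of_nonneg vonMangoldt_nonneg, Real.norm_of_nonneg (Real.log_natCast_nonneg n)]
  exact div_le_one_of_le₀ vonMangoldt_le_log (Real.log_natCast_nonneg n)

lemma abscissa_logZetaSeries_lt {s : ℂ} (hs : 1 < s.re) :
    LSeries.abscissaOfAbsConv (fun n => (Λ n : ℂ) / Real.log n) < s.re :=
  abscissa_logZetaSeries_le.trans_lt (by exact_mod_cast hs)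

lemma logMul_vonMangoldt_div_log :
    LSeries.logMul (fun n => (Λ n : ℂ) / Real.log n) = fun n => (Λ n : ℂ) := by
  ext n
  rw [LSeries.logMul, ← Complex.natCast_log]
  by_cases h : Real.log n = 0
  · have : Λ n = 0 := le_antisymm (vonMangoldt_le_log.trans h.le) vonMangoldt_nonneg
    simp [this]
  · have : (Real.log n : ℂ) ≠ 0 := by exact_mod_cast h
    field_simp

lemma hasDerivAt_logZetaSeries {s : ℂ} (hs : 0 < s.re) :
    HasDerivAt logZetaSeries (deriv riemannZeta (1 + s) / riemannZeta (1 + s)) s := by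
  have h1 := LSeries_hasDerivAt (abscissa_logZetaSeries_lt (s := 1 + s) (by simpa using hs))
  rw [logMul_vonMangoldt_div_log, LSeries_vonMangoldt_eq_deriv_riemannZeta_div (by simpa using hs)] at h1
  have h2 := h1.comp_const_add 1 s
  rw [neg_div, neg_neg] at h2
  exact h2

lemma mem_slitPlane_of_re_pos {s : ℂ} (hs : 0 < s.re) : s ∈ Complex.slitPlane := Or.inl hs

lemma ne_zero_of_re_pos' {s : ℂ} (hs : 0 < s.re) : s ≠ 0 := by
  rintro rfl; simp at hs

lemma hasDerivAt_logZetaReg {s : ℂ} (hs : 0 < s.re) : HasDerivAt logZetaReg (logZetaReg' s) s := by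
  have := (hasDerivAt_logZetaSeries hs).fun_add
    (Complex.hasDerivAt_log (mem_slitPlane_of_re_pos hs))
  rw [← one_div] at this
  exact this

lemma analyticAt_logDeriv_riemannZeta {s : ℂ} (hs : 1 ≤ s.re) (h1 : s ≠ 1) :
    AnalyticAt ℂ (fun w => deriv riemannZeta w / riemannZeta w) s := by
  have hopen : IsOpen ({1}ᶜ : Set ℂ) := isOpen_compl_singleton
  have hd0 : DifferentiableOn ℂ riemannZeta {1}ᶜ := fun w hw =>
    (differentiableAt_riemannZeta hw).differentiableWithinAt
  have ha : AnalyticAt ℂ riemannZeta s := hd0.analyticAt (hopen.mem_nhds h1)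
  exact ha.deriv.fun_div ha (riemannZeta_ne_zero_of_one_le_re hs)

lemma hasDerivAt_logZetaReg' {s : ℂ} (hs : 0 < s.re) :
    HasDerivAt logZetaReg' (logZetaReg'' s) s := by
  have h1 := (analyticAt_logDeriv_riemannZeta (s := 1 + s) (by simpa using hs.le)
    (by simpa using ne_zero_of_re_pos' hs)).differentiableAt.hasDerivAt.comp_const_add 1 s
  have h2 := (hasDerivAt_inv (ne_zero_of_re_pos' hs))
  have := h1.fun_add h2
  simp only [← one_div, ← sub_eq_add_neg] at this
  change HasDerivAt (fun w => deriv riemannZeta (1 + w) / riemannZeta (1 + w) + 1 / w) _ s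
  simpa [logZetaReg'', sub_eq_add_neg, div_eq_mul_inv, neg_mul] using this

lemma exp_logZetaReg {s : ℂ} (hs : 0 < s.re) :
    Complex.exp (logZetaReg s) = riemannZeta₁ (1 + s) := by
  have h0 := ne_zero_of_re_pos' hs
  rw [logZetaReg, Complex.exp_add, Complex.exp_log h0, logZetaSeries,
    riemannZeta_eq_exp_LSeries (by simpa using hs), riemannZeta_eq_inv_sub_mul (by simpa using h0)]
  rw [add_sub_cancel_left]
  field_simp

/-- Reality on the real axis fixes the branch when `logZetaReg` is identified with a principal
logarithm near `0`. -/
lemma logZetaSeries_ofReal (x : ℝ) : (logZetaSeries x).im = 0 := by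
  rw [logZetaSeries, LSeries_def₀ (by simp)]
  have : ∀ n : ℕ, (Λ n : ℂ) / Real.log n / (n : ℂ) ^ (1 + x : ℂ)
      = ((Λ n / Real.log n / (n : ℝ) ^ (1 + x) : ℝ) : ℂ) := by
    intro n
    push_cast
    rw [Complex.ofReal_cpow (by positivity)]
    push_cast
    rfl
  simp_rw [this, ← Complex.ofReal_tsum]
  simp

/-- The function `logZetaReg` extends analytically to a neighbourhood of `0`, where it vanishes. -/
lemma exists_logZetaReg_eq_mul : ∃ ρ : ℝ, 0 < ρ ∧ ∃ M : ℂ → ℂ,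
    DifferentiableOn ℂ M (Metric.ball 0 ρ) ∧
      ∀ s ∈ Metric.ball (0 : ℂ) ρ, 0 < s.re → logZetaReg s = s * M s := by
  set H : ℂ → ℂ := fun s => riemannZeta₁ (1 + s)
  have hH : Differentiable ℂ H := differentiable_riemannZeta₁.comp (by fun_prop)
  have hH0 : H 0 = 1 := by simp [H]
  obtain ⟨ρ, hρ, hball⟩ : ∃ ρ > 0, Metric.ball (0 : ℂ) ρ ⊆ {s : ℂ | H s ∈ Complex.slitPlane} := by
    refine Metric.mem_nhds_iff.mp ((Complex.isOpen_slitPlane.preimage hH.continuous).mem_nhds ?_)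
    change H 0 ∈ Complex.slitPlane
    rw [hH0]; exact Complex.one_mem_slitPlane
  have hG : DifferentiableOn ℂ (fun s => Complex.log (H s)) (Metric.ball 0 ρ) := fun s hs =>
    ((hH s).clog (hball hs)).differentiableWithinAt
  refine ⟨ρ, hρ, dslope (fun s => Complex.log (H s)) 0, ?_, ?_⟩
  · exact (Complex.differentiableOn_dslope (Metric.ball_mem_nhds 0 hρ)).mpr hG
  · intro s hs hre
    have hs0 := ne_zero_of_re_pos' hre
    set U := Metric.ball (0 : ℂ) ρ ∩ {s | 0 < s.re}
    have hUo : IsOpen U := Metric.isOpen_ball.inter (isOpen_lt continuous_const Complex.continuous_re)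
    have hUc : IsPreconnected U :=
      ((convex_ball (0 : ℂ) ρ).inter (convex_halfSpace_re_gt 0)).isPreconnected
    have hx : (((ρ / 2 : ℝ) : ℂ)) ∈ U := by
      refine ⟨?_, ?_⟩
      · simp only [Metric.mem_ball, dist_zero_right, Complex.norm_real]
        rw [Real.norm_of_nonneg (by positivity)]; linarith
      · simp only [Set.mem_ofPred_eq, Complex.ofReal_re]; positivity
    -- Both functions have derivative `H'/H` on the connected half ball, and at the real point `ρ/2`
    -- no multiple of `2πi` can separate them.
    have heq : Set.EqOn logZetaReg (fun s => Complex.log (H s)) U := by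
      refine hUo.eqOn_of_deriv_eq hUc
        (fun w hw => (hasDerivAt_logZetaReg hw.2).differentiableAt.differentiableWithinAt)
        (hG.mono Set.inter_subset_left) (fun w hw => ?_) hx ?_
      · have hw0 : H w ≠ 0 := Complex.slitPlane_ne_zero (hball hw.1)
        have hd : HasDerivAt H (Complex.exp (logZetaReg w) * logZetaReg' w) w := by
          refine ((hasDerivAt_logZetaReg hw.2).cexp).congr_of_eventuallyEq ?_
          filter_upwards [(isOpen_lt continuous_const Complex.continuous_re).mem_nhds hw.2]
            with z hz
          exact (exp_logZetaReg hz).symm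
        rw [(hasDerivAt_logZetaReg hw.2).deriv, (hd.clog (hball hw.1)).deriv,
          exp_logZetaReg hw.2]
        change _ = H w * _ / H w
        field_simp
      · have h1 := exp_logZetaReg hx.2
        change _ = H _ at h1
        change logZetaReg _ = Complex.log (H _)
        rw [← h1, Complex.log_exp]
        all_goals
          rw [logZetaReg, Complex.add_im, logZetaSeries_ofReal, zero_add,
            ← Complex.ofReal_log (by positivity), Complex.ofReal_im]
          linarith [Real.pi_pos]
    rw [heq ⟨hs, hre⟩]
    have := sub_smul_dslope (fun s => Complex.log (H s)) 0 s
    simp only [sub_zero, smul_eq_mul, hH0, Complex.log_one] at this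
    exact this.symm

/-- For `|Im s| ≤ 2` this is compactness of a rectangle with a neighbourhood of the pole removed,
its left edge on `Re = 1` being allowed by nonvanishing there; for larger `|Im s|` it is the growth
bound. -/
lemma exists_norm_logDeriv_riemannZeta_le_of_le_norm {ρ : ℝ} (hρ : 0 < ρ) :
    ∃ C : ℝ, 0 < C ∧ ∀ s : ℂ, 0 < s.re → s.re ≤ 1 → ρ ≤ ‖s‖ →
      ‖deriv riemannZeta (1 + s) / riemannZeta (1 + s)‖ ≤ C * (1 + |s.im|) ^ (1 / 4 : ℝ) ∧
      ‖deriv (fun w => deriv riemannZeta w / riemannZeta w) (1 + s)‖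
        ≤ C * (1 + |s.im|) ^ (1 / 4 : ℝ) := by
  obtain ⟨C₀, hC₀, h0⟩ := exists_norm_logDeriv_riemannZeta_le
  set S : Set ℂ := (Set.Icc 0 1 ×ℂ Set.Icc (-2) 2) ∩ {s : ℂ | ρ ≤ ‖s‖}
  have hS : IsCompact S := (isCompact_Icc.reProdIm isCompact_Icc).inter_right
    (isClosed_le continuous_const continuous_norm)
  have hana : ∀ s ∈ S, AnalyticAt ℂ (fun w => deriv riemannZeta w / riemannZeta w) (1 + s) := by
    rintro s ⟨hs1, hs2⟩
    refine analyticAt_logDeriv_riemannZeta ?_ ?_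
    · simpa using hs1.1.1
    · intro h
      have : s = 0 := by linear_combination h
      rw [this] at hs2
      simp only [Set.mem_ofPred_eq, norm_zero] at hs2
      linarith
  have hcs : Continuous fun s : ℂ => 1 + s := by fun_prop
  obtain ⟨C₁, h1⟩ := hS.exists_bound_of_continuousOn
    (f := fun s => deriv riemannZeta (1 + s) / riemannZeta (1 + s)) fun s hs =>
    (ContinuousAt.comp (f := fun s : ℂ => 1 + s) (hana s hs).continuousAt
      hcs.continuousAt).continuousWithinAt
  obtain ⟨C₂, h2⟩ := hS.exists_bound_of_continuousOn
    (f := fun s => deriv (fun w => deriv riemannZeta w / riemannZeta w) (1 + s)) fun s hs =>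
    (ContinuousAt.comp (f := fun s : ℂ => 1 + s) (hana s hs).deriv.continuousAt
      hcs.continuousAt).continuousWithinAt
  refine ⟨C₀ + |C₁| + |C₂|, by positivity, fun s hs1 hs2 hs3 => ?_⟩
  have hone : (1 : ℝ) ≤ (1 + |s.im|) ^ (1 / 4 : ℝ) :=
    Real.one_le_rpow (by linarith [abs_nonneg s.im]) (by norm_num)
  by_cases hc : |s.im| ≤ 2
  · have hm : s ∈ S := ⟨⟨⟨hs1.le, hs2⟩, abs_le.mp hc⟩, hs3⟩
    constructor
    · calc _ ≤ C₁ := h1 s hm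
        _ ≤ (C₀ + |C₁| + |C₂|) * 1 := by linarith [le_abs_self C₁, abs_nonneg C₂]
        _ ≤ _ := by gcongr
    · calc _ ≤ C₂ := h2 s hm
        _ ≤ (C₀ + |C₁| + |C₂|) * 1 := by linarith [le_abs_self C₂, abs_nonneg C₁]
        _ ≤ _ := by gcongr
  · push Not at hc
    have := h0 (1 + s) (by simpa using hs1) (by simp; linarith) (by simpa using hc.le)
    have him : (1 + s).im = s.im := by simp
    rw [him] at this
    have hle : C₀ * |s.im| ^ (1 / 4 : ℝ) ≤ (C₀ + |C₁| + |C₂|) * (1 + |s.im|) ^ (1 / 4 : ℝ) := by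
      gcongr
      · linarith [abs_nonneg C₁, abs_nonneg C₂]
      · linarith
    exact ⟨this.1.trans hle, this.2.trans hle⟩

/-- The logarithm is recovered by integrating its derivative along a horizontal segment ending on
`Re s = 1`, where the Dirichlet series converges absolutely. Linear growth is harmless, as the
kernel divides this function by `s³`. -/
lemma exists_norm_logZetaReg_le {ρ : ℝ} (hρ : 0 < ρ) :
    ∃ C : ℝ, 0 < C ∧ ∀ s : ℂ, 0 < s.re → s.re ≤ 1 → ρ ≤ ‖s‖ →
      ‖logZetaReg s‖ ≤ C * (1 + |s.im|) ∧ ‖logZetaReg' s‖ ≤ C * (1 + |s.im|) ^ (1 / 4 : ℝ) ∧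
      ‖logZetaReg'' s‖ ≤ C * (1 + |s.im|) ^ (1 / 4 : ℝ) := by
  obtain ⟨C₀, hC₀, h0⟩ := exists_norm_logDeriv_riemannZeta_le_of_le_norm hρ
  set P : ℝ := ∑' n, ‖LSeries.term (fun n => (Λ n : ℂ) / Real.log n) 2 n‖
  have hP : 0 ≤ P := tsum_nonneg fun n => norm_nonneg _
  have hPs : Summable fun n => ‖LSeries.term (fun n => (Λ n : ℂ) / Real.log n) 2 n‖ :=
    (LSeriesSummable_of_abscissaOfAbsConv_lt_re
      (abscissa_logZetaSeries_lt (s := 2) (by simp))).norm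
  have hone : ∀ s : ℂ, (1 : ℝ) ≤ (1 + |s.im|) ^ (1 / 4 : ℝ) := fun s =>
    Real.one_le_rpow (by linarith [abs_nonneg s.im]) (by norm_num)
  have h1 : ∀ s : ℂ, 0 < s.re → s.re ≤ 1 → ρ ≤ ‖s‖ →
      ‖logZetaReg' s‖ ≤ (C₀ + 1 / ρ) * (1 + |s.im|) ^ (1 / 4 : ℝ) := by
    intro s hs1 hs2 hs3
    refine (norm_add_le _ _).trans ?_
    rw [add_mul]
    refine add_le_add (h0 s hs1 hs2 hs3).1 ?_
    rw [norm_div, norm_one]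
    calc 1 / ‖s‖ ≤ 1 / ρ * 1 := by rw [mul_one]; gcongr
      _ ≤ _ := by gcongr; exact hone s
  have h2 : ∀ s : ℂ, 0 < s.re → s.re ≤ 1 → ρ ≤ ‖s‖ →
      ‖logZetaReg'' s‖ ≤ (C₀ + 1 / ρ ^ 2) * (1 + |s.im|) ^ (1 / 4 : ℝ) := by
    intro s hs1 hs2 hs3
    refine (norm_sub_le _ _).trans ?_
    rw [add_mul]
    refine add_le_add (h0 s hs1 hs2 hs3).2 ?_
    rw [norm_div, norm_one, norm_pow]
    calc 1 / ‖s‖ ^ 2 ≤ 1 / ρ ^ 2 * 1 := by rw [mul_one]; gcongr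
      _ ≤ _ := by gcongr; exact hone s
  have h3 : ∀ t : ℝ, ‖logZetaReg (1 + t * Complex.I)‖ ≤ (P + 5) * (1 + |t|) := by
    intro t
    have e1 : ‖logZetaSeries (1 + t * Complex.I)‖ ≤ P := by
      rw [logZetaSeries, LSeries]
      refine tsum_of_norm_bounded hPs.hasSum fun n => ?_
      refine LSeries.norm_term_le_of_re_le_re _ (by simp; norm_num) n
    have e2 : ‖Complex.log (1 + t * Complex.I)‖ ≤ |t| + 5 := by
      refine (Complex.norm_le_abs_re_add_abs_im _).trans ?_
      rw [Complex.log_re, Complex.log_im]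
      have a1 := (Complex.abs_arg_le_pi (1 + t * Complex.I)).trans Real.pi_lt_d2.le
      have a2 : 1 ≤ ‖(1 + t * Complex.I : ℂ)‖ := by
        have := Complex.abs_re_le_norm (1 + t * Complex.I)
        simpa using this
      have a3 : ‖(1 + t * Complex.I : ℂ)‖ ≤ 1 + |t| := by
        refine (norm_add_le _ _).trans ?_
        simp
      rw [abs_of_nonneg (Real.log_nonneg a2)]
      have := Real.log_le_sub_one_of_pos (lt_of_lt_of_le one_pos a2)
      linarith
    refine (norm_add_le _ _).trans ?_
    nlinarith [abs_nonneg t]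
  refine ⟨(P + 5) + (C₀ + 1 / ρ) + (C₀ + 1 / ρ ^ 2), by positivity, fun s hs1 hs2 hs3 => ?_⟩
  have hq : (0 : ℝ) ≤ (1 + |s.im|) ^ (1 / 4 : ℝ) := by linarith [hone s]
  have p1 : 0 ≤ C₀ + 1 / ρ := by positivity
  have p2 : 0 ≤ C₀ + 1 / ρ ^ 2 := by positivity
  refine ⟨?_, (h1 s hs1 hs2 hs3).trans (mul_le_mul_of_nonneg_right (by linarith) hq),
    (h2 s hs1 hs2 hs3).trans (mul_le_mul_of_nonneg_right (by linarith) hq)⟩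
  have hmv : ‖logZetaReg s - logZetaReg (1 + s.im * Complex.I)‖
      ≤ (C₀ + 1 / ρ) * (1 + |s.im|) ^ (1 / 4 : ℝ) * ‖s - (1 + s.im * Complex.I)‖ := by
    refine Convex.norm_image_sub_le_of_norm_hasDerivWithin_le (𝕜 := ℂ) (f' := logZetaReg')
      (s := {z : ℂ | s.re ≤ z.re ∧ z.re ≤ 1 ∧ z.im = s.im}) ?_ ?_ ?_ ?_ ?_
    · rintro z ⟨hz, _, _⟩
      exact (hasDerivAt_logZetaReg (by linarith)).hasDerivWithinAt
    · rintro z ⟨hz1, hz2, hz3⟩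
      rw [← hz3]
      refine h1 z (by linarith) hz2 (hs3.trans ?_)
      rw [Complex.norm_eq_sqrt_sq_add_sq, Complex.norm_eq_sqrt_sq_add_sq, hz3]
      gcongr
    · have h1 : Convex ℝ {z : ℂ | s.re ≤ z.re} := convex_halfSpace_re_ge _
      have h2 : Convex ℝ {z : ℂ | z.re ≤ 1} := convex_halfSpace_re_le 1
      have h3 : Convex ℝ {z : ℂ | z.im = s.im} :=
        (convex_singleton s.im).is_linear_preimage (f := Complex.im) ⟨fun _ _ => rfl, by simp⟩
      exact h1.inter (h2.inter h3)
    · exact ⟨by simpa using hs2, by simp, by simp⟩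
    · exact ⟨le_rfl, hs2, rfl⟩
  have hlen : ‖s - (1 + s.im * Complex.I)‖ ≤ 1 := by
    have : s - (1 + s.im * Complex.I) = ((s.re - 1 : ℝ) : ℂ) := by
      apply Complex.ext <;> simp
    rw [this, Complex.norm_real, Real.norm_eq_abs, abs_le]
    constructor <;> linarith
  have hqle : (1 + |s.im|) ^ (1 / 4 : ℝ) ≤ 1 + |s.im| :=
    Real.rpow_le_self_of_one_le (by linarith [abs_nonneg s.im]) (by norm_num)
  have e1 := norm_sub_norm_le (logZetaReg s) (logZetaReg (1 + s.im * Complex.I))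
  have e2 := h3 s.im
  have e3 : (C₀ + 1 / ρ) * (1 + |s.im|) ^ (1 / 4 : ℝ) * ‖s - (1 + s.im * Complex.I)‖
      ≤ (C₀ + 1 / ρ) * (1 + |s.im|) * 1 := by gcongr
  have e4 : 0 ≤ (C₀ + 1 / ρ ^ 2) * (1 + |s.im|) := by positivity
  linarith

/-- The second derivative of `log (s ζ(1 + s)) / s`. -/
noncomputable def logZetaKernel (s : ℂ) : ℂ :=
  logZetaReg'' s / s - 2 * logZetaReg' s / s ^ 2 + 2 * logZetaReg s / s ^ 3

/-- Near `0` one has `logZetaReg s = s M(s)` with `M` analytic, so the kernel is simply `M''`: the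
apparent poles cancel. -/
lemma exists_norm_logZetaKernel_le_near : ∃ ρ : ℝ, 0 < ρ ∧ ∃ C : ℝ, ∀ s : ℂ, 0 < s.re →
    ‖s‖ ≤ ρ → ‖logZetaKernel s‖ ≤ C := by
  obtain ⟨ρ, hρ, M, hM, hK⟩ := exists_logZetaReg_eq_mul
  have hUo : IsOpen (Metric.ball (0 : ℂ) ρ) := Metric.isOpen_ball
  have hM1 := hM.deriv hUo
  have hM2 := hM1.deriv hUo
  have hsub : Metric.closedBall (0 : ℂ) (ρ / 2) ⊆ Metric.ball 0 ρ :=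
    Metric.closedBall_subset_ball (by linarith)
  obtain ⟨C, hC⟩ := (isCompact_closedBall (0 : ℂ) (ρ / 2)).exists_bound_of_continuousOn
    (hM2.continuousOn.mono hsub)
  refine ⟨ρ / 2, by positivity, C, fun s hre hs => ?_⟩
  have hs0 := ne_zero_of_re_pos' hre
  have hmem : s ∈ Metric.closedBall (0 : ℂ) (ρ / 2) := by simpa using hs
  have hev : ∀ z ∈ Metric.ball (0 : ℂ) ρ ∩ {z | 0 < z.re},
      ∀ᶠ w in 𝓝 z, w ∈ Metric.ball (0 : ℂ) ρ ∩ {z | 0 < z.re} := fun z hz =>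
    (Metric.isOpen_ball.inter (isOpen_lt continuous_const Complex.continuous_re)).mem_nhds hz
  have hK1 : ∀ z ∈ Metric.ball (0 : ℂ) ρ ∩ {z | 0 < z.re},
      logZetaReg' z = M z + z * deriv M z := by
    intro z hz
    have h1 : HasDerivAt (fun z => z * M z) (1 * M z + z * deriv M z) z :=
      (hasDerivAt_id' z).mul (hM.hasDerivAt (hUo.mem_nhds hz.1))
    have h2 := h1.congr_of_eventuallyEq (f₁ := logZetaReg) (by
      filter_upwards [hev z hz] with w hw using hK w hw.1 hw.2)
    rw [(hasDerivAt_logZetaReg hz.2).unique h2, one_mul]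
  have hK2 : logZetaReg'' s = 2 * deriv M s + s * deriv (deriv M) s := by
    have h1 : HasDerivAt (fun z => M z + z * deriv M z)
        (deriv M s + (1 * deriv M s + s * deriv (deriv M) s)) s :=
      (hM.hasDerivAt (hUo.mem_nhds (hsub hmem))).add
        ((hasDerivAt_id' s).mul (hM1.hasDerivAt (hUo.mem_nhds (hsub hmem))))
    have h2 := h1.congr_of_eventuallyEq (f₁ := logZetaReg') (by
      filter_upwards [hev s ⟨hsub hmem, hre⟩] with w hw using hK1 w hw)
    rw [(hasDerivAt_logZetaReg' hre).unique h2]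
    ring
  have : logZetaKernel s = deriv (deriv M) s := by
    rw [logZetaKernel, hK2, hK1 s ⟨hsub hmem, hre⟩, hK s (hsub hmem) hre]
    field_simp
    ring
  rw [this]
  exact hC s hmem

/-- The uniform decay of `logZetaKernel` on vertical lines, in square integrable form. -/
lemma exists_norm_logZetaKernel_le : ∃ C : ℝ, 0 < C ∧ ∀ s : ℂ, 0 < s.re → s.re ≤ 1 →
    ‖logZetaKernel s‖ ≤ C * (1 + |s.im|) ^ (-(3 / 4) : ℝ) := by
  obtain ⟨ρ, hρ, C₀, h0⟩ := exists_norm_logZetaKernel_le_near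
  obtain ⟨C₁, hC₁, h1⟩ := exists_norm_logZetaReg_le hρ
  set D : ℝ := 1 + 2 / ρ
  have hD : 0 < D := by positivity
  refine ⟨|C₀| * (1 + ρ) + C₁ * D + 2 * C₁ * D ^ 2 + 2 * C₁ * D ^ 3, by positivity,
    fun s hs1 hs2 => ?_⟩
  set T := 1 + |s.im|
  have hT : 1 ≤ T := by linarith [abs_nonneg s.im]
  have hT0 : 0 < T := by linarith
  have hTm : T⁻¹ ≤ T ^ (-(3 / 4) : ℝ) := by
    rw [← Real.rpow_neg_one]
    exact Real.rpow_le_rpow_of_exponent_le hT (by norm_num)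
  have q0 : 0 ≤ T ^ (-(3 / 4) : ℝ) := by positivity
  by_cases hc : ‖s‖ ≤ ρ
  · have hTρ : T ≤ 1 + ρ := by
      have := Complex.abs_im_le_norm s
      linarith
    calc ‖logZetaKernel s‖ ≤ |C₀| := (h0 s hs1 hc).trans (le_abs_self _)
      _ = |C₀| * (T * T⁻¹) := by rw [mul_inv_cancel₀ hT0.ne', mul_one]
      _ ≤ |C₀| * ((1 + ρ) * T ^ (-(3 / 4) : ℝ)) := by gcongr
      _ = |C₀| * (1 + ρ) * T ^ (-(3 / 4) : ℝ) := by ring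
      _ ≤ _ := by
        gcongr
        have : 0 ≤ C₁ * D + 2 * C₁ * D ^ 2 + 2 * C₁ * D ^ 3 := by positivity
        linarith
  · push Not at hc
    obtain ⟨k0, k1, k2⟩ := h1 s hs1 hs2 hc.le
    change _ ≤ C₁ * T at k0
    change _ ≤ C₁ * T ^ _ at k1 k2
    have hsT : T ≤ D * ‖s‖ := by
      have h2 := Complex.abs_im_le_norm s
      have h3 : 1 ≤ 2 / ρ * ‖s‖ := by
        rw [div_mul_eq_mul_div, le_div_iff₀ hρ]; linarith
      simp only [T, D]
      linarith
    have hinv : ‖s‖⁻¹ ≤ D * T⁻¹ := by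
      rw [inv_le_iff_one_le_mul₀ (by linarith)]
      rw [mul_right_comm, ← div_eq_mul_inv, one_le_div hT0]
      exact hsT
    have hT1 : T⁻¹ ≤ 1 := inv_le_one_of_one_le₀ hT
    have hq : T ^ (1 / 4 : ℝ) * T⁻¹ = T ^ (-(3 / 4) : ℝ) := by
      rw [← Real.rpow_neg_one, ← Real.rpow_add hT0]; norm_num
    have a1 : ‖logZetaReg'' s / s‖ ≤ C₁ * D * T ^ (-(3 / 4) : ℝ) := by
      rw [norm_div, div_eq_mul_inv]
      calc _ ≤ C₁ * T ^ (1 / 4 : ℝ) * (D * T⁻¹) := by gcongr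
        _ = C₁ * D * (T ^ (1 / 4 : ℝ) * T⁻¹) := by ring
        _ = _ := by rw [hq]
    have a2 : ‖2 * logZetaReg' s / s ^ 2‖ ≤ 2 * C₁ * D ^ 2 * T ^ (-(3 / 4) : ℝ) := by
      rw [norm_div, norm_mul, norm_pow, Complex.norm_ofNat, div_eq_mul_inv, ← inv_pow]
      calc _ ≤ 2 * (C₁ * T ^ (1 / 4 : ℝ)) * (D * T⁻¹) ^ 2 := by gcongr
        _ = 2 * C₁ * D ^ 2 * (T ^ (1 / 4 : ℝ) * T⁻¹) * T⁻¹ := by ring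
        _ ≤ 2 * C₁ * D ^ 2 * T ^ (-(3 / 4) : ℝ) * 1 := by rw [hq]; gcongr
        _ = _ := by ring
    have a3 : ‖2 * logZetaReg s / s ^ 3‖ ≤ 2 * C₁ * D ^ 3 * T ^ (-(3 / 4) : ℝ) := by
      rw [norm_div, norm_mul, norm_pow, Complex.norm_ofNat, div_eq_mul_inv, ← inv_pow]
      calc _ ≤ 2 * (C₁ * T) * (D * T⁻¹) ^ 3 := by gcongr
        _ = 2 * C₁ * D ^ 3 * (T * T⁻¹) * (T⁻¹ * T⁻¹) := by ring
        _ ≤ 2 * C₁ * D ^ 3 * 1 * (1 * T ^ (-(3 / 4) : ℝ)) := by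
          rw [mul_inv_cancel₀ hT0.ne']; gcongr
        _ = _ := by ring
    have a4 : ‖logZetaKernel s‖ ≤ ‖logZetaReg'' s / s‖ + ‖2 * logZetaReg' s / s ^ 2‖
        + ‖2 * logZetaReg s / s ^ 3‖ :=
      (norm_add_le _ _).trans (add_le_add_left (norm_sub_le _ _) _)
    calc _ ≤ _ := a4
      _ ≤ C₁ * D * T ^ (-(3 / 4) : ℝ) + 2 * C₁ * D ^ 2 * T ^ (-(3 / 4) : ℝ)
          + 2 * C₁ * D ^ 3 * T ^ (-(3 / 4) : ℝ) := by gcongr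
      _ = (C₁ * D + 2 * C₁ * D ^ 2 + 2 * C₁ * D ^ 3) * T ^ (-(3 / 4) : ℝ) := by ring
      _ ≤ _ := by
        gcongr
        have : 0 ≤ |C₀| * (1 + ρ) := by positivity
        linarith

/-! ### The Mertens error and its Laplace transform -/

/-- The Mertens-type sum `∑_{2 ≤ n ≤ e^v} Λ(n) / (n log n)`. -/
noncomputable def mertensSum (v : ℝ) : ℝ :=
  ∑ n ∈ Finset.Icc 1 ⌊Real.exp v⌋₊, Λ n / (n * Real.log n)

/-- The error term in Mertens' theorem. -/
noncomputable def mertensError (v : ℝ) : ℝ :=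
  mertensSum v - Real.log v - Real.eulerMascheroniConstant

lemma mertensCoeff_nonneg (n : ℕ) : 0 ≤ Λ n / (n * Real.log n) :=
  div_nonneg vonMangoldt_nonneg (mul_nonneg n.cast_nonneg (Real.log_natCast_nonneg n))

lemma mertensCoeff_le (n : ℕ) : Λ n / (n * Real.log n) ≤ 1 / n := by
  rw [mul_comm, ← div_div]
  refine div_le_div_of_nonneg_right ?_ n.cast_nonneg
  exact div_le_one_of_le₀ vonMangoldt_le_log (Real.log_natCast_nonneg n)

lemma monotone_mertensSum : Monotone mertensSum := by
  intro v w h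
  refine Finset.sum_le_sum_of_subset_of_nonneg (Finset.Icc_subset_Icc_right ?_)
    fun n _ _ => mertensCoeff_nonneg n
  gcongr

lemma mertensSum_nonneg (v : ℝ) : 0 ≤ mertensSum v :=
  Finset.sum_nonneg fun n _ => mertensCoeff_nonneg n

lemma mertensSum_le {v : ℝ} (hv : 0 ≤ v) : mertensSum v ≤ 1 + v := by
  have h1 : mertensSum v ≤ (harmonic ⌊Real.exp v⌋₊ : ℝ) := by
    rw [harmonic_eq_sum_Icc]
    push_cast
    refine Finset.sum_le_sum fun n _ => ?_
    simpa using mertensCoeff_le n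
  refine h1.trans ((harmonic_floor_le_one_add_log _ (Real.one_le_exp hv)).trans ?_)
  rw [Real.log_exp]

lemma abs_log_le_add_inv {v : ℝ} (hv : 0 < v) : |Real.log v| ≤ v + v⁻¹ := by
  have h1 := Real.log_le_sub_one_of_pos hv
  have h2 := Real.log_le_sub_one_of_pos (inv_pos.mpr hv)
  rw [Real.log_inv] at h2
  have := inv_pos.mpr hv
  rw [abs_le]; constructor <;> linarith

lemma eulerMascheroniConstant_nonneg_le_one :
    0 ≤ Real.eulerMascheroniConstant ∧ Real.eulerMascheroniConstant ≤ 1 := by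
  have h1 := Real.one_half_lt_eulerMascheroniConstant
  have h2 := Real.eulerMascheroniConstant_lt_two_thirds
  constructor <;> linarith

/-- A crude bound, sufficient for absolute convergence of the Laplace integrals; the factor `v²`
absorbs the singularity of `log v` at `0`. -/
lemma sq_mul_abs_mertensError_le {v : ℝ} (hv : 0 < v) :
    v ^ 2 * |mertensError v| ≤ 4 * (1 + v) ^ 3 := by
  have h1 := mertensSum_nonneg v
  have h2 := mertensSum_le hv.le
  have h3 := abs_log_le_add_inv hv
  obtain ⟨h4, h5⟩ := eulerMascheroniConstant_nonneg_le_one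
  have h6 : |mertensError v| ≤ 2 + 2 * v + v⁻¹ := by
    unfold mertensError
    have := abs_le.mp h3
    rw [abs_le]; constructor <;> linarith
  calc v ^ 2 * |mertensError v| ≤ v ^ 2 * (2 + 2 * v + v⁻¹) := by gcongr
    _ = 2 * v ^ 2 + 2 * v ^ 3 + v := by field_simp
    _ ≤ _ := by nlinarith [pow_pos hv 2, pow_pos hv 3]

lemma one_add_pow_three_le {σ : ℝ} (hσ : 0 < σ) {v : ℝ} (hv : 0 ≤ v) :
    (1 + v) ^ 3 ≤ (1 + 6 / σ) ^ 3 * Real.exp (σ * v / 2) := by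
  have h1 : 1 + v ≤ (1 + 6 / σ) * Real.exp (σ * v / 6) := by
    have h2 := Real.add_one_le_exp (σ * v / 6)
    have h3 : 0 < 6 / σ := by positivity
    calc 1 + v ≤ (1 + 6 / σ) * (σ * v / 6 + 1) := by
          have : (1 + 6 / σ) * (σ * v / 6 + 1) = 1 + v + σ * v / 6 + 6 / σ := by
            field_simp; ring
          rw [this]
          have : 0 ≤ σ * v / 6 := by positivity
          linarith
      _ ≤ _ := by gcongr
  calc (1 + v) ^ 3 ≤ ((1 + 6 / σ) * Real.exp (σ * v / 6)) ^ 3 := by gcongr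
    _ = _ := by
      rw [mul_pow, ← Real.exp_nat_mul]
      congr 2; push_cast; ring

lemma measurable_mertensError : Measurable mertensError :=
  ((monotone_mertensSum.measurable).sub Real.measurable_log).sub_const _

lemma hasDerivAt_sq_mul_exp {s : ℂ} (hs : s ≠ 0) (v : ℝ) :
    HasDerivAt (fun v : ℝ => -(Complex.exp (-s * v) * (v ^ 2 / s + 2 * v / s ^ 2 + 2 / s ^ 3)))
      (v ^ 2 * Complex.exp (-s * v)) v := by
  have h0 : HasDerivAt (fun z : ℂ => -(Complex.exp (-s * z) * (z ^ 2 / s + 2 * z / s ^ 2 + 2 / s ^ 3)))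
      ((v : ℂ) ^ 2 * Complex.exp (-s * v)) (v : ℂ) := by
    have h1 : HasDerivAt (fun z : ℂ => Complex.exp (-s * z)) (Complex.exp (-s * v) * (-s * 1)) v :=
      ((hasDerivAt_id' (v : ℂ)).const_mul (-s)).cexp
    have h2 : HasDerivAt (fun z : ℂ => z ^ 2 / s + 2 * z / s ^ 2 + 2 / s ^ 3)
        (2 * v / s + 2 * 1 / s ^ 2) v := by
      have := (((hasDerivAt_pow 2 (v : ℂ)).div_const s).fun_add
        (((hasDerivAt_id' (v : ℂ)).const_mul 2).div_const (s ^ 2))).add_const (2 / s ^ 3)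
      simpa using this
    refine (h1.fun_mul h2).fun_neg.congr_deriv ?_
    field_simp
    ring
  exact h0.comp_ofReal

lemma norm_sq_mul_exp (s : ℂ) (v : ℝ) :
    ‖(v : ℂ) ^ 2 * Complex.exp (-s * v)‖ = v ^ 2 * Real.exp (-s.re * v) := by
  rw [norm_mul, norm_pow, Complex.norm_real, Complex.norm_exp, Real.norm_eq_abs, sq_abs]
  simp

lemma integrableOn_pow_mul_exp (n : ℕ) {σ : ℝ} (hσ : 0 < σ) :
    IntegrableOn (fun v : ℝ => v ^ n * Real.exp (-σ * v)) (Set.Ioi 0) := by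
  have := integrableOn_rpow_mul_exp_neg_mul_rpow (p := 1) (s := n) (b := σ)
    (by linarith [(n.cast_nonneg : (0 : ℝ) ≤ n)]) zero_lt_one hσ
  simpa using this

lemma integrableOn_sq_mul_cexp {s : ℂ} (hs : 0 < s.re) :
    IntegrableOn (fun v : ℝ => (v : ℂ) ^ 2 * Complex.exp (-s * v)) (Set.Ioi 0) := by
  refine ((integrableOn_pow_mul_exp 2 hs)).mono' (Continuous.aestronglyMeasurable (by fun_prop))
    (Eventually.of_forall fun v => (norm_sq_mul_exp s v).le)

lemma integral_sq_mul_cexp {s : ℂ} (hs : 0 < s.re) {L : ℝ} (hL : 0 ≤ L) :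
    ∫ v in Set.Ioi L, (v : ℂ) ^ 2 * Complex.exp (-s * v)
      = Complex.exp (-s * L) * (L ^ 2 / s + 2 * L / s ^ 2 + 2 / s ^ 3) := by
  have hs0 := ne_zero_of_re_pos' hs
  have htend : Tendsto (fun v : ℝ => -(Complex.exp (-s * v) * (v ^ 2 / s + 2 * v / s ^ 2 + 2 / s ^ 3)))
      atTop (𝓝 0) := by
    have hk : ∀ n : ℕ, Tendsto (fun v : ℝ => Complex.exp (-s * v) * (v : ℂ) ^ n) atTop (𝓝 0) := by
      intro n
      rw [tendsto_zero_iff_norm_tendsto_zero]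
      have := Real.tendsto_pow_mul_exp_neg_atTop_nhds_zero n
      have h2 := (Real.tendsto_pow_mul_exp_neg_atTop_nhds_zero n).comp
        (tendsto_id.const_mul_atTop hs)
      have h3 := h2.const_mul (s.re ^ n)⁻¹
      rw [mul_zero] at h3
      refine h3.congr' ?_
      filter_upwards [eventually_ge_atTop 0] with v hv
      rw [norm_mul, Complex.norm_exp, norm_pow, Complex.norm_real, Real.norm_of_nonneg hv]
      simp only [Function.comp, id, mul_pow]
      have : s.re ^ n ≠ 0 := by positivity
      field_simp
      simp [mul_comm]
    have h0 := (((hk 2).const_mul (1 / s)).add ((hk 1).const_mul (2 / s ^ 2))).add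
      ((hk 0).const_mul (2 / s ^ 3))
    have h1 := h0.neg
    simp only [mul_zero, add_zero, neg_zero] at h1
    refine h1.congr fun v => ?_
    ring
  rw [integral_Ioi_of_hasDerivAt_of_tendsto' (fun v _ => hasDerivAt_sq_mul_exp hs0 v)
    ((integrableOn_sq_mul_cexp hs).mono_set (Set.Ioi_subset_Ioi hL)) htend]
  ring

/-- Writing the partial sum as a superposition of steps at the points `log n` lets integrals against
it be evaluated term by term. -/
lemma hasSum_mertensSum (v : ℝ) :
    HasSum (fun n : ℕ => (Set.Ici (Real.log n)).indicator (fun _ => Λ n / (n * Real.log n)) v)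
      (mertensSum v) := by
  have hsum : mertensSum v = ∑ n ∈ Finset.Icc 1 ⌊Real.exp v⌋₊,
      (Set.Ici (Real.log n)).indicator (fun _ => Λ n / (n * Real.log n)) v := by
    refine Finset.sum_congr rfl fun n hn => ?_
    rw [Finset.mem_Icc] at hn
    have hn0 : (0 : ℝ) < n := by exact_mod_cast hn.1
    rw [Set.indicator_of_mem]
    rw [Set.mem_Ici, Real.log_le_iff_le_exp hn0]
    exact (Nat.le_floor_iff (Real.exp_pos v).le).mp hn.2
  rw [hsum]
  refine hasSum_sum_of_ne_finset_zero fun n hn => ?_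
  by_cases h0 : n = 0
  · simp [h0]
  refine Set.indicator_of_notMem (fun h => hn ?_) _
  have hn0 : (0 : ℝ) < n := by exact_mod_cast Nat.pos_of_ne_zero h0
  rw [Set.mem_Ici, Real.log_le_iff_le_exp hn0] at h
  exact Finset.mem_Icc.mpr ⟨Nat.pos_of_ne_zero h0, (Nat.le_floor_iff (Real.exp_pos v).le).mpr h⟩

/-- The weight of `n` in the Laplace transform of `v² mertensSum v`. -/
lemma integral_mertens_term {s : ℂ} (hs : 0 < s.re) (n : ℕ) :
    IntegrableOn (fun v : ℝ => (Set.Ici (Real.log n)).indicator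
        (fun v => ((Λ n / (n * Real.log n) : ℝ) : ℂ) * ((v : ℂ) ^ 2 * Complex.exp (-s * v))) v)
        (Set.Ioi 0) ∧
      ∫ v in Set.Ioi (0 : ℝ), (Set.Ici (Real.log n)).indicator
        (fun v : ℝ => ((Λ n / (n * Real.log n) : ℝ) : ℂ) * ((v : ℂ) ^ 2 * Complex.exp (-s * v))) v
      = ((Λ n / (n * Real.log n) : ℝ) : ℂ) * (Complex.exp (-s * Real.log n) *
          (Real.log n ^ 2 / s + 2 * Real.log n / s ^ 2 + 2 / s ^ 3)) := by
  refine ⟨((integrableOn_sq_mul_cexp hs).const_mul _).indicator measurableSet_Ici, ?_⟩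
  by_cases h0 : Λ n / (n * Real.log n) = 0
  · simp [h0]
  have hL : 0 < Real.log n := by
    refine lt_of_le_of_ne (Real.log_natCast_nonneg n) fun h => h0 ?_
    rw [← h]; simp
  rw [setIntegral_indicator measurableSet_Ici, Set.inter_eq_right.mpr (Set.Ici_subset_Ioi.mpr hL),
    integral_Ici_eq_integral_Ioi, integral_const_mul, integral_sq_mul_cexp hs hL.le]

/-- Since `exp(-s log n)/n = n^(-(1+s))`, the three powers of `log n` select the series of `log ζ`
and, up to sign, of its first two derivatives. -/
lemma logZeta_term_eq {n : ℕ} {s : ℂ} (hs : 0 < s.re) :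
    ((Λ n / (n * Real.log n) : ℝ) : ℂ) * (Complex.exp (-s * Real.log n) *
          (Real.log n ^ 2 / s + 2 * Real.log n / s ^ 2 + 2 / s ^ 3))
      = LSeries.term (LSeries.logMul fun n => (Λ n : ℂ)) (1 + s) n / s
        + 2 * LSeries.term (fun n => (Λ n : ℂ)) (1 + s) n / s ^ 2
        + 2 * LSeries.term (fun n => (Λ n : ℂ) / Real.log n) (1 + s) n / s ^ 3 := by
  rcases Nat.lt_or_ge n 2 with h | h
  · interval_cases n <;> simp [LSeries.term, LSeries.logMul]
  have hn0 : n ≠ 0 := by omega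
  have hlog : Real.log n ≠ 0 := (Real.log_pos (by exact_mod_cast h)).ne'
  have hn : (n : ℂ) ≠ 0 := by exact_mod_cast hn0
  have hlog' : (Real.log n : ℂ) ≠ 0 := by exact_mod_cast hlog
  rw [LSeries.term_of_ne_zero hn0, LSeries.term_of_ne_zero hn0, LSeries.term_of_ne_zero hn0,
    LSeries.logMul, ← Complex.natCast_log, Complex.cpow_add _ _ hn, Complex.cpow_one,
    Complex.cpow_def_of_ne_zero hn, ← Complex.natCast_log, neg_mul, Complex.exp_neg,
    mul_comm (s : ℂ) (Real.log n : ℂ)]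
  have he := Complex.exp_ne_zero ((Real.log n : ℂ) * s)
  have hs0 := ne_zero_of_re_pos' hs
  rw [Complex.ofReal_div, Complex.ofReal_mul, Complex.ofReal_natCast]
  generalize ((Real.log n : ℝ) : ℂ) = l at *
  field_simp

lemma logZeta_summable {s : ℂ} (hs : 0 < s.re) :
    LSeriesSummable (LSeries.logMul fun n => (Λ n : ℂ)) (1 + s) ∧
    LSeriesSummable (fun n => (Λ n : ℂ)) (1 + s) ∧
    LSeriesSummable (fun n => (Λ n : ℂ) / Real.log n) (1 + s) := by
  have h := abscissa_logZetaSeries_lt (s := 1 + s) (by simpa using hs)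
  have h1 := LSeries.abscissaOfAbsConv_logMul (f := fun n => (Λ n : ℂ) / Real.log n)
  rw [logMul_vonMangoldt_div_log] at h1
  have h2 := LSeries.abscissaOfAbsConv_logMul (f := fun n => (Λ n : ℂ))
  refine ⟨LSeriesSummable_of_abscissaOfAbsConv_lt_re ?_,
    LSeriesSummable_of_abscissaOfAbsConv_lt_re ?_, LSeriesSummable_of_abscissaOfAbsConv_lt_re h⟩
  · rw [h2, h1]; exact h
  · rw [h1]; exact h

/-- Termwise integration is justified by passing to `Re s`: there the integrals of the norms are
themselves terms of the same formula, so their summability is absolute convergence of the Dirichlet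
series at `1 + Re s`. -/
lemma laplace_mertensSum {s : ℂ} (hs : 0 < s.re) :
    IntegrableOn (fun v : ℝ => (mertensSum v : ℂ) * ((v : ℂ) ^ 2 * Complex.exp (-s * v)))
      (Set.Ioi 0) ∧
    ∫ v in Set.Ioi (0 : ℝ), (mertensSum v : ℂ) * ((v : ℂ) ^ 2 * Complex.exp (-s * v))
      = deriv (fun w => deriv riemannZeta w / riemannZeta w) (1 + s) / s
        - 2 * (deriv riemannZeta (1 + s) / riemannZeta (1 + s)) / s ^ 2
        + 2 * logZetaSeries s / s ^ 3 := by
  set F : ℕ → ℝ → ℂ := fun n => (Set.Ici (Real.log n)).indicator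
        (fun v => ((Λ n / (n * Real.log n) : ℝ) : ℂ) * ((v : ℂ) ^ 2 * Complex.exp (-s * v)))
  have hsum : ∀ v : ℝ, HasSum (fun n => F n v)
      ((mertensSum v : ℂ) * ((v : ℂ) ^ 2 * Complex.exp (-s * v))) := by
    intro v
    have := (Complex.hasSum_ofReal.mpr (hasSum_mertensSum v)).mul_right
      ((v : ℂ) ^ 2 * Complex.exp (-s * v))
    refine this.congr_fun fun n => ?_
    by_cases h : v ∈ Set.Ici (Real.log n)
    · simp only [F, Set.indicator_of_mem h]
    · simp only [F, Set.indicator_of_notMem h]; simp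
  have hsr : 0 < ((s.re : ℝ) : ℂ).re := by simpa using hs
  have hnorm : ∀ n, ∫ v in Set.Ioi (0 : ℝ), ‖F n v‖
      = ‖((Λ n / (n * Real.log n) : ℝ) : ℂ) * (Complex.exp (-(s.re : ℂ) * Real.log n) *
          (Real.log n ^ 2 / (s.re : ℂ) + 2 * Real.log n / (s.re : ℂ) ^ 2 + 2 / (s.re : ℂ) ^ 3))‖ := by
    intro n
    rw [← (integral_mertens_term hsr n).2]
    have h1 : ∀ v : ℝ, (Set.Ici (Real.log n)).indicator
        (fun v : ℝ => ((Λ n / (n * Real.log n) : ℝ) : ℂ) *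
          ((v : ℂ) ^ 2 * Complex.exp (-(s.re : ℂ) * v))) v = ((‖F n v‖ : ℝ) : ℂ) := by
      intro v
      by_cases h : v ∈ Set.Ici (Real.log n)
      · simp only [F, Set.indicator_of_mem h, norm_mul]
        rw [← norm_mul, norm_sq_mul_exp, Complex.norm_real,
          Real.norm_of_nonneg (mertensCoeff_nonneg n)]
        push_cast
        rfl
      · simp only [F, Set.indicator_of_notMem h]; simp
    simp_rw [h1]
    rw [integral_complex_ofReal, Complex.norm_real, Real.norm_of_nonneg]
    exact integral_nonneg fun v => norm_nonneg _
  have hsummable : Summable fun n => ∫ v in Set.Ioi (0 : ℝ), ‖F n v‖ := by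
    simp_rw [hnorm, logZeta_term_eq hsr]
    obtain ⟨a, b, c⟩ := logZeta_summable hsr
    exact (((a.div_const _).add ((b.mul_left 2).div_const _)).add ((c.mul_left 2).div_const _)).norm
  have hint : ∀ n, IntegrableOn (F n) (Set.Ioi 0) := fun n => (integral_mertens_term hs n).1
  have hkey := hasSum_integral_of_summable_integral_norm hint hsummable
  constructor
  · have hle : ∀ v ∈ Set.Ioi (0 : ℝ), ‖(mertensSum v : ℂ) * ((v : ℂ) ^ 2 * Complex.exp (-s * v))‖
        ≤ v ^ 2 * Real.exp (-s.re * v) + v ^ 3 * Real.exp (-s.re * v) := by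
      intro v hv
      rw [norm_mul, norm_sq_mul_exp, Complex.norm_real, Real.norm_of_nonneg (mertensSum_nonneg v)]
      have := mertensSum_le (le_of_lt hv)
      calc _ ≤ (1 + v) * (v ^ 2 * Real.exp (-s.re * v)) := by gcongr
        _ = _ := by ring
    refine ((integrableOn_pow_mul_exp 2 hs).add (integrableOn_pow_mul_exp 3 hs)).mono' ?_
      ((ae_restrict_iff' measurableSet_Ioi).mpr (Eventually.of_forall hle))
    have hm : Measurable fun v : ℝ => (mertensSum v : ℂ) :=
      Complex.measurable_ofReal.comp monotone_mertensSum.measurable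
    exact (hm.mul (Continuous.measurable (by fun_prop))).aestronglyMeasurable
  · simp_rw [(hsum _).tsum_eq] at hkey
    obtain ⟨a, b, c⟩ := logZeta_summable hs
    have h2 := ((a.hasSum.div_const s).add ((b.hasSum.mul_left 2).div_const (s ^ 2))).add
      ((c.hasSum.mul_left 2).div_const (s ^ 3))
    have hF : ∀ n, ∫ v in Set.Ioi (0 : ℝ), F n v = _ := fun n =>
      ((integral_mertens_term hs n).2).trans (logZeta_term_eq hs)
    simp_rw [hF] at hkey
    rw [hkey.unique h2]
    have hs1 : 1 < (1 + s).re := by simpa using hs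
    have e1 : ∀ {w : ℂ}, 1 < w.re → ∑' n, LSeries.term (fun n => (Λ n : ℂ)) w n
        = -(deriv riemannZeta w / riemannZeta w) := fun hw => by
      rw [← neg_div]; exact LSeries_vonMangoldt_eq_deriv_riemannZeta_div hw
    have e2 : ∑' n, LSeries.term (LSeries.logMul fun n => (Λ n : ℂ)) (1 + s) n
        = deriv (fun w => deriv riemannZeta w / riemannZeta w) (1 + s) := by
      have habs : LSeries.abscissaOfAbsConv (fun n => (Λ n : ℂ)) < (1 + s).re := by
        have h1 := LSeries.abscissaOfAbsConv_logMul (f := fun n => (Λ n : ℂ) / Real.log n)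
        rw [logMul_vonMangoldt_div_log] at h1
        rw [h1]; exact abscissa_logZetaSeries_lt hs1
      have h3 := LSeries_deriv habs
      have h4 : LSeries (fun n => (Λ n : ℂ)) =ᶠ[𝓝 (1 + s)]
          fun w => -(deriv riemannZeta w / riemannZeta w) := by
        filter_upwards [(isOpen_lt continuous_const Complex.continuous_re).mem_nhds hs1] with w hw
        exact e1 hw
      rw [h4.deriv_eq, deriv.fun_neg] at h3
      exact (neg_injective h3).symm
    rw [e2, e1 hs1]
    change _ + 2 * logZetaSeries s / s ^ 3 = _
    ring

/-- The substitution `u = x v` reduces this to `Γ'(3) = 3 - 2γ` and `Γ(3) = 2`; the `γ` in the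
integrand cancels the one in `Γ'(3)`. This is how Euler's constant enters Mertens' theorem here. -/
lemma laplace_log_ofReal {x : ℝ} (hx : 0 < x) :
    ∫ v in Set.Ioi (0 : ℝ), ((Real.log v + Real.eulerMascheroniConstant : ℝ) : ℂ) *
        ((v : ℂ) ^ 2 * Complex.exp (-x * v)) = (3 - 2 * Complex.log x) / x ^ 3 := by
  set γ := Real.eulerMascheroniConstant
  have hG : ∫ t : ℝ in Set.Ioi 0, (t : ℂ) ^ ((3 : ℂ) - 1) * (Real.log t * Real.exp (-t))
      = 3 - 2 * γ := by
    have h1 := (Complex.hasDerivAt_GammaIntegral (s := 3) (by norm_num))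
    have h2 : HasDerivAt Complex.GammaIntegral (3 - 2 * γ : ℂ) 3 := by
      have h3 := Complex.hasDerivAt_Gamma_nat 2
      have h4 : ((2 : ℕ) + 1 : ℂ) = 3 := by norm_num
      rw [h4] at h3
      have h5 : Complex.GammaIntegral =ᶠ[𝓝 3] Complex.Gamma := by
        filter_upwards [(isOpen_lt continuous_const Complex.continuous_re).mem_nhds
          (show (0 : ℝ) < (3 : ℂ).re by norm_num)] with w hw
        exact (Complex.Gamma_eq_integral hw).symm
      refine (h3.congr_of_eventuallyEq h5).congr_deriv ?_
      simp [harmonic, Finset.sum_range_succ, Nat.factorial, γ]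
      ring
    exact h1.unique h2
  have hG2 : ∫ t : ℝ in Set.Ioi 0, t ^ 2 * (Real.log t * Real.exp (-t)) = 3 - 2 * γ := by
    rw [← Complex.ofReal_inj, ← integral_complex_ofReal]
    push_cast
    rw [← hG]
    refine setIntegral_congr_fun measurableSet_Ioi fun t ht => ?_
    have h2 : (3 : ℂ) - 1 = (2 : ℕ) := by norm_num
    simp only [h2, Complex.cpow_natCast]
    push_cast
    rw [Complex.ofReal_log (le_of_lt ht)]
  have hE : ∫ t : ℝ in Set.Ioi 0, t ^ 2 * Real.exp (-t) = 2 := by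
    have h1 := Real.Gamma_eq_integral (s := 3) (by norm_num)
    have h2 : Real.Gamma 3 = 2 := by
      have := Real.Gamma_nat_eq_factorial 2
      rw [show ((2 : ℕ) : ℝ) + 1 = 3 by norm_num] at this
      rw [this]; norm_num [Nat.factorial]
    rw [h2] at h1
    rw [h1]
    refine setIntegral_congr_fun measurableSet_Ioi fun t ht => ?_
    have h2 : (3 : ℝ) - 1 = (2 : ℕ) := by norm_num
    simp only [h2, Real.rpow_natCast]
    ring
  have hi1 : IntegrableOn (fun t : ℝ => t ^ 2 * (Real.log t * Real.exp (-t))) (Set.Ioi 0) := by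
    have : 0 < (1 : ℝ) := one_pos
    have h3 := ((integrableOn_pow_mul_exp 3 this).add (integrableOn_pow_mul_exp 1 this))
    refine h3.mono' ?_ ((ae_restrict_iff' measurableSet_Ioi).mpr (Eventually.of_forall fun t ht => ?_))
    · exact (Measurable.mul (by fun_prop) (Real.measurable_log.mul (by fun_prop))).aestronglyMeasurable
    · have ht : 0 < t := ht
      rw [norm_mul, norm_mul, Real.norm_of_nonneg (sq_nonneg t), Real.norm_eq_abs,
        Real.norm_of_nonneg (Real.exp_pos _).le]
      calc t ^ 2 * (|Real.log t| * Real.exp (-t)) ≤ t ^ 2 * ((t + t⁻¹) * Real.exp (-t)) := by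
            gcongr; exact abs_log_le_add_inv ht
        _ = t ^ 3 * Real.exp (-1 * t) + t ^ 1 * Real.exp (-1 * t) := by
            rw [neg_one_mul]; field_simp
        _ = _ := rfl
  have hi2 : IntegrableOn (fun t : ℝ => t ^ 2 * Real.exp (-t)) (Set.Ioi 0) := by
    simpa using integrableOn_pow_mul_exp 2 (σ := 1) one_pos
  have hreal : ∫ v in Set.Ioi (0 : ℝ), (Real.log v + γ) * (v ^ 2 * Real.exp (-x * v))
      = (3 - 2 * Real.log x) / x ^ 3 := by
    have h1 := integral_comp_mul_left_Ioi
      (fun u => u ^ 2 * (Real.log u * Real.exp (-u)) + (γ - Real.log x) * (u ^ 2 * Real.exp (-u))) 0 hx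
    rw [mul_zero, integral_add hi1 (hi2.const_mul _), integral_const_mul, hG2, hE] at h1
    have h2 : ∫ v in Set.Ioi (0 : ℝ), (Real.log v + γ) * (v ^ 2 * Real.exp (-x * v))
        = ∫ v in Set.Ioi (0 : ℝ), (x ^ 2)⁻¹ * ((x * v) ^ 2 * (Real.log (x * v) * Real.exp (-(x * v)))
          + (γ - Real.log x) * ((x * v) ^ 2 * Real.exp (-(x * v)))) := by
      refine setIntegral_congr_fun measurableSet_Ioi fun v hv => ?_
      have hv : 0 < v := hv
      simp only [Real.log_mul hx.ne' hv.ne', neg_mul]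
      field_simp
      ring
    rw [h2, integral_const_mul, h1, smul_eq_mul]
    field_simp
    ring
  rw [← Complex.ofReal_log hx.le]
  have := congrArg (fun r : ℝ => (r : ℂ)) hreal
  simp only [← integral_complex_ofReal] at this
  push_cast at this ⊢
  exact this

lemma norm_log_add_mul_le {s : ℂ} {v : ℝ} (hv : 0 < v) :
    ‖((Real.log v + Real.eulerMascheroniConstant : ℝ) : ℂ) * ((v : ℂ) ^ 2 * Complex.exp (-s * v))‖
      ≤ (v ^ 1 + v ^ 2 + v ^ 3) * Real.exp (-s.re * v) := by
  rw [norm_mul, norm_sq_mul_exp, Complex.norm_real, Real.norm_eq_abs]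
  have h1 := abs_log_le_add_inv hv
  obtain ⟨h4, h5⟩ := eulerMascheroniConstant_nonneg_le_one
  have h2 : |Real.log v + Real.eulerMascheroniConstant| ≤ v + v⁻¹ + 1 := by
    refine (abs_add_le _ _).trans ?_
    rw [abs_of_nonneg h4]
    linarith
  calc _ ≤ (v + v⁻¹ + 1) * (v ^ 2 * Real.exp (-s.re * v)) := by gcongr
    _ = _ := by field_simp; ring

lemma integrableOn_log_add_mul {s : ℂ} (hs : 0 < s.re) :
    IntegrableOn (fun v : ℝ => ((Real.log v + Real.eulerMascheroniConstant : ℝ) : ℂ) *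
        ((v : ℂ) ^ 2 * Complex.exp (-s * v))) (Set.Ioi 0) := by
  have h3 := ((integrableOn_pow_mul_exp 1 hs).add (integrableOn_pow_mul_exp 2 hs)).add
    (integrableOn_pow_mul_exp 3 hs)
  refine h3.mono' ?_ ((ae_restrict_iff' measurableSet_Ioi).mpr (Eventually.of_forall fun t ht => ?_))
  · have hm : Measurable fun v : ℝ => ((Real.log v + Real.eulerMascheroniConstant : ℝ) : ℂ) :=
      Complex.measurable_ofReal.comp (Real.measurable_log.add_const _)
    exact (hm.mul (Continuous.measurable (by fun_prop))).aestronglyMeasurable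
  · refine (norm_log_add_mul_le ht).trans (le_of_eq ?_)
    simp only [Pi.add_apply]
    ring

lemma differentiableAt_laplace_log {s : ℂ} (hs : 0 < s.re) :
    DifferentiableAt ℂ (fun s : ℂ => ∫ v in Set.Ioi (0 : ℝ),
      ((Real.log v + Real.eulerMascheroniConstant : ℝ) : ℂ) *
        ((v : ℂ) ^ 2 * Complex.exp (-s * v))) s := by
  set F : ℂ → ℝ → ℂ := fun s v => ((Real.log v + Real.eulerMascheroniConstant : ℝ) : ℂ) *
        ((v : ℂ) ^ 2 * Complex.exp (-s * v))
  have hσ : 0 < s.re / 2 := by linarith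
  have hnhds : {w : ℂ | s.re / 2 < w.re} ∈ 𝓝 s :=
    (isOpen_lt continuous_const Complex.continuous_re).mem_nhds (by simp; linarith)
  have hmeas : ∀ w, AEStronglyMeasurable (F w) (volume.restrict (Set.Ioi 0)) := by
    intro w
    have hm : Measurable fun v : ℝ => ((Real.log v + Real.eulerMascheroniConstant : ℝ) : ℂ) :=
      Complex.measurable_ofReal.comp (Real.measurable_log.add_const _)
    exact (hm.mul (Continuous.measurable (by fun_prop))).aestronglyMeasurable
  refine (hasDerivAt_integral_of_dominated_loc_of_deriv_le (F := F)
    (F' := fun s v => -(v : ℂ) * F s v)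
    (bound := fun v => v ^ 2 * Real.exp (-(s.re / 2) * v) + v ^ 3 * Real.exp (-(s.re / 2) * v)
      + v ^ 4 * Real.exp (-(s.re / 2) * v)) hnhds
    (Eventually.of_forall hmeas) (integrableOn_log_add_mul hs) ?_ ?_ ?_ ?_).2.differentiableAt
  · have : Continuous fun v : ℝ => -(v : ℂ) := by fun_prop
    exact this.aestronglyMeasurable.mul (hmeas s)
  · refine (ae_restrict_iff' measurableSet_Ioi).mpr (Eventually.of_forall fun v hv w hw => ?_)
    have hv : 0 < v := hv
    have hw : s.re / 2 < w.re := hw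
    rw [norm_mul, norm_neg, Complex.norm_real, Real.norm_of_nonneg hv.le]
    calc v * ‖F w v‖ ≤ v * ((v ^ 1 + v ^ 2 + v ^ 3) * Real.exp (-w.re * v)) := by
          gcongr; exact norm_log_add_mul_le hv
      _ ≤ v * ((v ^ 1 + v ^ 2 + v ^ 3) * Real.exp (-(s.re / 2) * v)) := by gcongr
      _ = _ := by ring
  · exact ((integrableOn_pow_mul_exp 2 hσ).add (integrableOn_pow_mul_exp 3 hσ)).add
      (integrableOn_pow_mul_exp 4 hσ)
  · refine Eventually.of_forall fun v w _ => ?_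
    have h1 : HasDerivAt (fun s : ℂ => Complex.exp (-s * v)) (Complex.exp (-w * v) * (-1 * v)) w :=
      (((hasDerivAt_id' w).fun_neg).mul_const (v : ℂ)).cexp
    refine ((h1.const_mul ((v : ℂ) ^ 2)).const_mul
      ((Real.log v + Real.eulerMascheroniConstant : ℝ) : ℂ)).congr_deriv ?_
    simp only [F]
    ring

/-- Both sides are analytic in the half plane and agree at the real points `1 + 1/(n+1)`, which
accumulate at `1`. -/
lemma laplace_log {s : ℂ} (hs : 0 < s.re) :
    ∫ v in Set.Ioi (0 : ℝ), ((Real.log v + Real.eulerMascheroniConstant : ℝ) : ℂ) *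
        ((v : ℂ) ^ 2 * Complex.exp (-s * v)) = (3 - 2 * Complex.log s) / s ^ 3 := by
  set U : Set ℂ := {w | 0 < w.re}
  have hU : IsOpen U := isOpen_lt continuous_const Complex.continuous_re
  have hUc : IsPreconnected U := (convex_halfSpace_re_gt 0).isPreconnected
  have h1 : AnalyticOnNhd ℂ (fun s : ℂ => ∫ v in Set.Ioi (0 : ℝ),
      ((Real.log v + Real.eulerMascheroniConstant : ℝ) : ℂ) *
        ((v : ℂ) ^ 2 * Complex.exp (-s * v))) U :=
    DifferentiableOn.analyticOnNhd
      (fun w hw => (differentiableAt_laplace_log hw).differentiableWithinAt) hU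
  have h2 : AnalyticOnNhd ℂ (fun s : ℂ => (3 - 2 * Complex.log s) / s ^ 3) U := by
    refine DifferentiableOn.analyticOnNhd (fun w hw => ?_) hU
    refine DifferentiableAt.differentiableWithinAt ?_
    have := (Complex.differentiableAt_log (mem_slitPlane_of_re_pos hw))
    exact ((this.const_mul 2).const_sub 3).fun_div (by fun_prop) (pow_ne_zero _ (ne_zero_of_re_pos' hw))
  refine h1.eqOn_of_preconnected_of_frequently_eq h2 hUc (z₀ := 1) (by simp [U]) ?_ hs
  have htend : Tendsto (fun n : ℕ => ((1 + 1 / ((n : ℝ) + 1) : ℝ) : ℂ)) atTop (𝓝[≠] 1) := by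
    refine tendsto_nhdsWithin_iff.mpr ⟨?_, Eventually.of_forall fun n => ?_⟩
    · have := (tendsto_one_div_add_atTop_nhds_zero_nat (𝕜 := ℝ)).const_add 1
      rw [add_zero] at this
      exact_mod_cast (Complex.continuous_ofReal.tendsto 1).comp this
    · have h3 : (0 : ℝ) < 1 / ((n : ℝ) + 1) := by positivity
      rw [Set.mem_compl_singleton_iff]
      intro h
      have h4 : (1 + 1 / ((n : ℝ) + 1) : ℝ) = 1 := by exact_mod_cast h
      linarith
  refine htend.frequently (Eventually.frequently (Eventually.of_forall fun n => ?_))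
  exact laplace_log_ofReal (by positivity)

/-- The Laplace transform of `v² mertensError v`. -/
lemma laplace_mertensError {s : ℂ} (hs : 0 < s.re) :
    ∫ v in Set.Ioi (0 : ℝ), (mertensError v : ℂ) * ((v : ℂ) ^ 2 * Complex.exp (-s * v))
      = logZetaKernel s := by
  have h1 := laplace_mertensSum hs
  have h2 := laplace_log hs
  have h3 : ∀ v : ℝ, (mertensError v : ℂ) * ((v : ℂ) ^ 2 * Complex.exp (-s * v))
      = (mertensSum v : ℂ) * ((v : ℂ) ^ 2 * Complex.exp (-s * v))
        - ((Real.log v + Real.eulerMascheroniConstant : ℝ) : ℂ) *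
        ((v : ℂ) ^ 2 * Complex.exp (-s * v)) := by
    intro v
    rw [mertensError]
    push_cast
    ring
  simp_rw [h3]
  rw [integral_sub h1.1 (integrableOn_log_add_mul hs), h1.2, h2]
  have hs0 := ne_zero_of_re_pos' hs
  -- The corrections `-1/s²`, `1/s` and `log s` that remove the pole of `ζ` contribute in total `-(3
  -- - 2 log s)/s³`, which is exactly minus the transform of `log v + γ`.
  simp only [logZetaKernel, logZetaReg, logZetaReg', logZetaReg'']
  field_simp
  ring

lemma norm_mertensError_mul_le {σ v : ℝ} (hσ : 0 < σ) (hv : 0 < v) :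
    ‖(mertensError v : ℂ) * ((v : ℂ) ^ 2 * Complex.exp (-(σ : ℂ) * v))‖
      ≤ 4 * (1 + 6 / σ) ^ 3 * Real.exp (-(σ / 2) * v) := by
  rw [norm_mul, norm_sq_mul_exp, Complex.norm_real, Real.norm_eq_abs, Complex.ofReal_re, ← mul_assoc,
    mul_comm (|_|)]
  calc v ^ 2 * |mertensError v| * Real.exp (-σ * v)
      ≤ 4 * ((1 + 6 / σ) ^ 3 * Real.exp (σ * v / 2)) * Real.exp (-σ * v) := by
        refine mul_le_mul_of_nonneg_right ?_ (Real.exp_pos _).le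
        refine (sq_mul_abs_mertensError_le hv).trans ?_
        exact mul_le_mul_of_nonneg_left (one_add_pow_three_le hσ hv.le) (by norm_num)
    _ = 4 * (1 + 6 / σ) ^ 3 * (Real.exp (σ * v / 2) * Real.exp (-σ * v)) := by ring
    _ = _ := by rw [← Real.exp_add]; congr 2; ring

/-! ### The Mertens error in mean square -/

/-- The function whose Fourier transform is `logZetaKernel` on the line `Re s = σ`. -/
noncomputable def dampedError (σ : ℝ) : ℝ → ℂ :=
  (Set.Ioi 0).indicator fun v => (mertensError v : ℂ) * ((v : ℂ) ^ 2 * Complex.exp (-(σ : ℂ) * v))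

lemma measurable_dampedError (σ : ℝ) : Measurable (dampedError σ) := by
  refine Measurable.indicator ?_ measurableSet_Ioi
  exact (Complex.measurable_ofReal.comp measurable_mertensError).mul
    (Continuous.measurable (by fun_prop))

lemma norm_dampedError_le {σ : ℝ} (hσ : 0 < σ) (v : ℝ) :
    ‖dampedError σ v‖ ≤ (Set.Ioi 0).indicator
      (fun v => 4 * (1 + 6 / σ) ^ 3 * Real.exp (-(σ / 2) * v)) v := by
  by_cases h : v ∈ Set.Ioi (0 : ℝ)
  · rw [dampedError, Set.indicator_of_mem h, Set.indicator_of_mem h]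
    exact norm_mertensError_mul_le hσ h
  · rw [dampedError, Set.indicator_of_notMem h, Set.indicator_of_notMem h, norm_zero]

lemma integrable_dampedError {σ : ℝ} (hσ : 0 < σ) : Integrable (dampedError σ) := by
  refine Integrable.mono' ?_ (measurable_dampedError σ).aestronglyMeasurable
    (Eventually.of_forall (norm_dampedError_le hσ))
  rw [integrable_indicator_iff measurableSet_Ioi]
  have := integrableOn_pow_mul_exp 0 (half_pos hσ)
  simp only [pow_zero, one_mul] at this
  exact this.const_mul _

lemma memLp_dampedError {σ : ℝ} (hσ : 0 < σ) : MemLp (dampedError σ) 2 := by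
  rw [memLp_two_iff_integrable_sq_norm (measurable_dampedError σ).aestronglyMeasurable]
  have h1 : Integrable ((Set.Ioi 0).indicator
      (fun v => (4 * (1 + 6 / σ) ^ 3) ^ 2 * Real.exp (-σ * v))) := by
    rw [integrable_indicator_iff measurableSet_Ioi]
    have := integrableOn_pow_mul_exp 0 hσ
    simp only [pow_zero, one_mul] at this
    exact this.const_mul _
  refine h1.mono' ((measurable_dampedError σ).norm.pow_const 2).aestronglyMeasurable
    (Eventually.of_forall fun v => ?_)
  rw [Real.norm_of_nonneg (by positivity)]
  by_cases h : v ∈ Set.Ioi (0 : ℝ)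
  · have := norm_dampedError_le hσ v
    rw [Set.indicator_of_mem h] at this ⊢
    calc _ ≤ (4 * (1 + 6 / σ) ^ 3 * Real.exp (-(σ / 2) * v)) ^ 2 := by gcongr
      _ = _ := by rw [mul_pow, ← Real.exp_nat_mul]; congr 2; push_cast; ring
  · rw [Set.indicator_of_notMem h, dampedError, Set.indicator_of_notMem h]; simp

open FourierTransform in
lemma fourier_dampedError {σ : ℝ} (hσ : 0 < σ) (ξ : ℝ) :
    𝓕 (dampedError σ) ξ = logZetaKernel (σ + 2 * Real.pi * ξ * Complex.I) := by
  have hre : (σ + 2 * Real.pi * ξ * Complex.I : ℂ).re = σ := by simp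
  rw [← laplace_mertensError (by rw [hre]; exact hσ), Real.fourier_real_eq_integral_exp_smul,
    ← integral_indicator measurableSet_Ioi]
  refine integral_congr_ae (Eventually.of_forall fun v => ?_)
  by_cases h : v ∈ Set.Ioi (0 : ℝ)
  · simp only [dampedError, Set.indicator_of_mem h, smul_eq_mul]
    rw [mul_left_comm, mul_left_comm (Complex.exp _), ← Complex.exp_add]
    congr 3
    push_cast
    ring
  · simp only [dampedError, Set.indicator_of_notMem h, smul_zero]

-- The decay exponent `3/4` exceeds `1/2`, so the kernel is square integrable on vertical lines and
-- Plancherel applies. The essential point is that the bound does not depend on `σ`, which may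
-- therefore tend to `0`.
open FourierTransform in
lemma exists_integral_norm_sq_dampedError_le : ∃ B : ℝ, 0 ≤ B ∧ ∀ σ : ℝ, 0 < σ → σ ≤ 1 →
    ∫ v, ‖dampedError σ v‖ ^ 2 ≤ B := by
  obtain ⟨C, hC, h⟩ := exists_norm_logZetaKernel_le
  have hint : Integrable fun ξ : ℝ => (1 + ‖ξ‖) ^ (-(3 / 2) : ℝ) :=
    integrable_one_add_norm (by simp; norm_num)
  refine ⟨∫ ξ : ℝ, C ^ 2 * (1 + ‖ξ‖) ^ (-(3 / 2) : ℝ), integral_nonneg fun ξ => by positivity,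
    fun σ h0 h1 => ?_⟩
  have hbound : ∀ ξ, ‖𝓕 (dampedError σ) ξ‖ ^ 2 ≤ C ^ 2 * (1 + ‖ξ‖) ^ (-(3 / 2) : ℝ) := by
    intro ξ
    rw [fourier_dampedError h0]
    have h2 := h (σ + 2 * Real.pi * ξ * Complex.I) (by simpa using h0) (by simpa using h1)
    have him : (σ + 2 * Real.pi * ξ * Complex.I : ℂ).im = 2 * Real.pi * ξ := by simp
    rw [him] at h2
    have h3 : (1 + |2 * Real.pi * ξ|) ^ (-(3 / 4) : ℝ) ≤ (1 + ‖ξ‖) ^ (-(3 / 4) : ℝ) := by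
      refine Real.rpow_le_rpow_of_nonpos (by positivity) ?_ (by norm_num)
      rw [abs_mul, abs_of_pos (by positivity), Real.norm_eq_abs]
      nlinarith [abs_nonneg ξ, Real.pi_gt_three]
    calc _ ≤ (C * (1 + ‖ξ‖) ^ (-(3 / 4) : ℝ)) ^ 2 := by
          gcongr
          exact h2.trans (by gcongr)
      _ = _ := by
        rw [mul_pow, ← Real.rpow_natCast (_ ^ _), ← Real.rpow_mul (by positivity)]
        norm_num
  have hcont : Continuous (𝓕 (dampedError σ)) :=
    VectorFourier.fourierIntegral_continuous Real.continuous_fourierChar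
      (innerSL ℝ).continuous₂ (integrable_dampedError h0)
  have hL2 : Integrable fun ξ => ‖𝓕 (dampedError σ) ξ‖ ^ 2 := by
    refine (hint.const_mul (C ^ 2)).mono' (hcont.norm.pow 2).aestronglyMeasurable
      (Eventually.of_forall fun ξ => ?_)
    rw [Real.norm_of_nonneg (by positivity)]
    exact hbound ξ
  have hmem : MemLp (𝓕 (dampedError σ)) 2 :=
    (memLp_two_iff_integrable_sq_norm hcont.aestronglyMeasurable).mpr hL2
  have hle := eLpNorm_le_eLpNorm_fourier (integrable_dampedError h0) (memLp_dampedError h0) hmem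
  have hsq : ∀ {f : ℝ → ℂ}, MemLp f 2 → ENNReal.ofReal (∫ v, ‖f v‖ ^ 2) = eLpNorm f 2 ^ 2 := by
    intro f hf
    have e1 := eLpNorm_nnreal_pow_eq_lintegral (f := f) (μ := volume) (p := 2) (by norm_num)
    simp only [NNReal.coe_ofNat, ENNReal.rpow_ofNat, ENNReal.coe_ofNat] at e1
    rw [e1, ofReal_integral_eq_lintegral_ofReal
      ((memLp_two_iff_integrable_sq_norm hf.1).mp hf) (Eventually.of_forall fun v => by positivity)]
    refine lintegral_congr fun v => ?_
    rw [ENNReal.ofReal_pow (norm_nonneg _), ofReal_norm]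
  have h4 : ENNReal.ofReal (∫ v, ‖dampedError σ v‖ ^ 2)
      ≤ ENNReal.ofReal (∫ v, ‖𝓕 (dampedError σ) v‖ ^ 2) := by
    rw [hsq (memLp_dampedError h0), hsq hmem]
    gcongr
  refine ((ENNReal.ofReal_le_ofReal_iff (integral_nonneg fun v => by positivity)).mp h4).trans ?_
  exact integral_mono hL2 (hint.const_mul _) hbound

/-- The error term in Mertens' theorem is `O(v⁻²)` in mean square. -/
lemma integrableOn_pow_four_mul_mertensError_sq :
    IntegrableOn (fun v => v ^ 4 * mertensError v ^ 2) (Set.Ioi 0) := by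
  obtain ⟨B, hB, h⟩ := exists_integral_norm_sq_dampedError_le
  have hsq : ∀ σ v : ℝ, 0 < v →
      v ^ 4 * mertensError v ^ 2 = Real.exp (2 * σ * v) * ‖dampedError σ v‖ ^ 2 := by
    intro σ v hv
    rw [dampedError, Set.indicator_of_mem (Set.mem_Ioi.mpr hv), norm_mul, norm_sq_mul_exp,
      Complex.norm_real,
      Complex.ofReal_re, Real.norm_eq_abs, mul_pow, sq_abs, mul_pow, ← Real.exp_nat_mul]
    rw [show Real.exp (2 * σ * v) * (mertensError v ^ 2 * ((v ^ 2) ^ 2 *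
        Real.exp ((2 : ℕ) * (-σ * v)))) = v ^ 4 * mertensError v ^ 2 *
        (Real.exp (2 * σ * v) * Real.exp ((2 : ℕ) * (-σ * v))) by ring, ← Real.exp_add]
    rw [show 2 * σ * v + (2 : ℕ) * (-σ * v) = 0 by push_cast; ring, Real.exp_zero, mul_one]
  have hint : ∀ R : ℝ, 0 < R → IntegrableOn (fun v => v ^ 4 * mertensError v ^ 2) (Set.Ioc 0 R) := by
    intro R hR
    have h1 := (memLp_two_iff_integrable_sq_norm
      (measurable_dampedError 1).aestronglyMeasurable).mp (memLp_dampedError one_pos)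
    refine ((h1.const_mul (Real.exp (2 * 1 * R))).integrableOn (s := Set.Ioc 0 R)).mono' ?_ ?_
    · exact ((measurable_id.pow_const 4).mul
        (measurable_mertensError.pow_const 2)).aestronglyMeasurable
    · refine (ae_restrict_iff' measurableSet_Ioc).mpr (Eventually.of_forall fun v hv => ?_)
      rw [Real.norm_of_nonneg (by positivity), hsq 1 v hv.1]
      gcongr
      exact hv.2
  refine integrableOn_Ioi_of_intervalIntegral_norm_bounded (l := atTop)
    (b := fun n : ℕ => (n : ℝ) + 1) (Real.exp 2 * B) 0 (fun n => hint _ (by positivity))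
    (tendsto_atTop_add_const_right _ _ tendsto_natCast_atTop_atTop)
    (Eventually.of_forall fun n => ?_)
  -- Damping with `σ = 1/R` costs at most `exp(2σv) ≤ e²` on `(0, R]`, so the integrals up to `R`
  -- stay bounded as `R` grows.
  set R : ℝ := (n : ℝ) + 1
  have hR : 0 < R := by positivity
  have hR1 : 1 ≤ R := by simp [R]
  have hσ : 0 < 1 / R := by positivity
  have hI := (memLp_two_iff_integrable_sq_norm
      (measurable_dampedError (1 / R)).aestronglyMeasurable).mp (memLp_dampedError hσ)
  rw [intervalIntegral.integral_of_le hR.le]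
  calc ∫ v in Set.Ioc 0 R, ‖v ^ 4 * mertensError v ^ 2‖
      ≤ ∫ v in Set.Ioc 0 R, Real.exp 2 * ‖dampedError (1 / R) v‖ ^ 2 := by
        refine setIntegral_mono_on (hint R hR).norm (hI.const_mul _).integrableOn
          measurableSet_Ioc fun v hv => ?_
        rw [Real.norm_of_nonneg (by positivity), hsq (1 / R) v hv.1]
        gcongr
        rw [mul_assoc, one_div_mul_eq_div]
        have : v / R ≤ 1 := (div_le_one hR).mpr hv.2
        linarith
    _ ≤ ∫ v, Real.exp 2 * ‖dampedError (1 / R) v‖ ^ 2 :=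
        setIntegral_le_integral (hI.const_mul _) (Eventually.of_forall fun v => by positivity)
    _ ≤ Real.exp 2 * B := by
        rw [integral_const_mul]
        gcongr
        exact h _ hσ ((div_le_one hR).mpr hR1)

/-! ### The Bessel density: decay, mass `1` and mean `A` -/

/-- The function `w ↦ log I₀(t) / t` at `t = 2 e^{-w}`. -/
noncomputable def besselWeight (w : ℝ) : ℝ := logBessel (2 * Real.exp (-w)) / (2 * Real.exp (-w))

/-- Minus the derivative of `besselWeight`. -/
noncomputable def besselDensity (w : ℝ) : ℝ :=
  deriv logBessel (2 * Real.exp (-w)) - logBessel (2 * Real.exp (-w)) / (2 * Real.exp (-w))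

lemma hasDerivAt_besselWeight (w : ℝ) : HasDerivAt besselWeight (-besselDensity w) w := by
  have h1 : HasDerivAt (fun w : ℝ => 2 * Real.exp (-w)) (2 * (Real.exp (-w) * -1)) w :=
    (((hasDerivAt_id' w).fun_neg).exp).const_mul 2
  have hpos : 0 < 2 * Real.exp (-w) := by positivity
  have h2 := ((hasDerivAt_logBessel (2 * Real.exp (-w))).comp w h1).fun_div h1 hpos.ne'
  refine h2.congr_deriv ?_
  simp only [besselDensity, Function.comp]
  field_simp
  ring

lemma continuous_besselDensity : Continuous besselDensity := by
  have h1 : Continuous logBessel :=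
    continuous_iff_continuousAt.mpr fun t => (hasDerivAt_logBessel t).continuousAt
  have h2 : Continuous (deriv logBessel) :=
    continuous_iff_continuousAt.mpr fun t => (hasDerivAt_deriv_logBessel t).continuousAt
  unfold besselDensity
  refine (h2.comp (by fun_prop)).sub ((h1.comp (by fun_prop)).div (by fun_prop) fun w => ?_)
  positivity

lemma continuous_besselWeight : Continuous besselWeight :=
  continuous_iff_continuousAt.mpr fun w => (hasDerivAt_besselWeight w).continuousAt

lemma besselDensity_nonneg (w : ℝ) : 0 ≤ besselDensity w := by
  have hpos : 0 < 2 * Real.exp (-w) := by positivity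
  rw [besselDensity, sub_nonneg, div_le_iff₀ hpos]
  exact (logBessel_le_mul_deriv hpos.le).trans_eq (mul_comm _ _)

lemma besselWeight_nonneg (w : ℝ) : 0 ≤ besselWeight w :=
  div_nonneg (logBessel_nonneg (by positivity)) (by positivity)

lemma besselWeight_le (w : ℝ) : besselWeight w ≤ 2 * Real.exp (-w) := by
  have hpos : 0 < 2 * Real.exp (-w) := by positivity
  rw [besselWeight, div_le_iff₀ hpos, ← sq]
  exact logBessel_le_sq hpos.le

lemma besselWeight_le_one (w : ℝ) : besselWeight w ≤ 1 := by
  have hpos : 0 < 2 * Real.exp (-w) := by positivity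
  rw [besselWeight, div_le_one hpos]
  exact logBessel_le_self hpos.le

lemma exists_one_sub_besselWeight_le : ∃ C : ℝ, 0 < C ∧ ∀ w : ℝ,
    1 - besselWeight w ≤ C * Real.exp (w / 2) := by
  obtain ⟨C, hC, h⟩ := exists_self_sub_logBessel_le
  refine ⟨C, hC, fun w => ?_⟩
  have hpos : 0 < 2 * Real.exp (-w) := by positivity
  have h1 := h _ hpos.le
  have h2 : √(2 * Real.exp (-w)) ≤ 2 * Real.exp (-w) * Real.exp (w / 2) := by
    rw [Real.sqrt_mul (by norm_num), ← Real.exp_half, mul_assoc, ← Real.exp_add,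
      show -w + w / 2 = -w / 2 by ring]
    gcongr
    rw [Real.sqrt_le_left (by norm_num)]; norm_num
  rw [besselWeight, ← div_self hpos.ne', ← sub_div, div_le_iff₀ hpos]
  calc _ ≤ C * √(2 * Real.exp (-w)) := h1
    _ ≤ C * (2 * Real.exp (-w) * Real.exp (w / 2)) := by gcongr
    _ = _ := by ring

/-- For `w ≥ 0` the argument `t = 2e^(-w)` is at most `2` and `(log I₀)'(t) ≤ t`. For `w ≤ 0` the
density is at most `1 - besselWeight w`, which the `O(√t)` bound for `t - log I₀(t)` makes
`O(e^(w/2))`. All moments are thus finite. -/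
lemma exists_besselDensity_le : ∃ C : ℝ, 0 < C ∧ ∀ w : ℝ,
    besselDensity w ≤ C * Real.exp (-(1 / 2) * |w|) := by
  obtain ⟨C, hC, h⟩ := exists_one_sub_besselWeight_le
  refine ⟨C + 2, by positivity, fun w => ?_⟩
  have hpos : 0 < 2 * Real.exp (-w) := by positivity
  rcases le_total 0 w with hw | hw
  · rw [abs_of_nonneg hw]
    calc besselDensity w ≤ deriv logBessel (2 * Real.exp (-w)) :=
          sub_le_self _ (besselWeight_nonneg w)
      _ ≤ 2 * Real.exp (-w) := deriv_logBessel_le_self hpos.le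
      _ ≤ 2 * Real.exp (-(1 / 2) * w) := by gcongr; linarith
      _ ≤ _ := by gcongr; linarith
  · rw [abs_of_nonpos hw]
    calc besselDensity w ≤ 1 - besselWeight w := by
          unfold besselDensity besselWeight
          linarith [deriv_logBessel_le_one (2 * Real.exp (-w))]
      _ ≤ C * Real.exp (w / 2) := h w
      _ ≤ (C + 2) * Real.exp (w / 2) := by gcongr; linarith
      _ = _ := by congr 2; ring

lemma integrable_comp_abs_of_integrableOn {f : ℝ → ℝ} (hf : IntegrableOn f (Set.Ioi 0)) :
    Integrable fun x => f |x| := by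
  have h1 : IntegrableOn (fun x => f |x|) (Set.Ioi 0) :=
    hf.congr_fun (fun x hx => by rw [abs_of_pos hx]) measurableSet_Ioi
  have h2 : IntegrableOn (fun x => f |x|) (Set.Iio 0) := by
    simpa using h1.comp_neg
  rw [← integrableOn_univ, ← Set.Iic_union_Ioi (a := (0 : ℝ))]
  exact IntegrableOn.union ((integrableOn_congr_set_ae Iio_ae_eq_Iic).1 h2) h1

lemma integrable_pow_abs_mul_besselDensity (n : ℕ) :
    Integrable fun w => |w| ^ n * besselDensity w := by
  obtain ⟨C, hC, h⟩ := exists_besselDensity_le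
  have h1 := (integrable_comp_abs_of_integrableOn
    (integrableOn_pow_mul_exp n (σ := 1 / 2) (by norm_num))).const_mul C
  refine h1.mono' ((continuous_abs.pow n).mul continuous_besselDensity).aestronglyMeasurable
    (Eventually.of_forall fun w => ?_)
  rw [Real.norm_of_nonneg (mul_nonneg (by positivity) (besselDensity_nonneg w))]
  calc |w| ^ n * besselDensity w ≤ |w| ^ n * (C * Real.exp (-(1 / 2) * |w|)) := by
        gcongr; exact h w
    _ = _ := by ring

lemma integrable_besselDensity : Integrable besselDensity := by
  simpa using integrable_pow_abs_mul_besselDensity 0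

lemma integrable_mul_besselDensity : Integrable fun w => w * besselDensity w := by
  refine (integrable_pow_abs_mul_besselDensity 1).mono'
    (continuous_id.mul continuous_besselDensity).aestronglyMeasurable
    (Eventually.of_forall fun w => ?_)
  rw [norm_mul, Real.norm_eq_abs, Real.norm_of_nonneg (besselDensity_nonneg w), pow_one]

lemma integrable_besselDensity_sq : Integrable fun w => besselDensity w ^ 2 := by
  obtain ⟨C, hC, h⟩ := exists_besselDensity_le
  refine (integrable_besselDensity.const_mul C).mono'
    (continuous_besselDensity.pow 2).aestronglyMeasurable (Eventually.of_forall fun w => ?_)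
  rw [Real.norm_of_nonneg (by positivity), sq]
  have h1 : besselDensity w ≤ C := by
    refine (h w).trans (mul_le_of_le_one_right hC.le ?_)
    rw [Real.exp_le_one_iff]
    have := abs_nonneg w
    linarith
  have := besselDensity_nonneg w
  gcongr

lemma tendsto_besselWeight_atTop : Tendsto besselWeight atTop (𝓝 0) := by
  have h1 : Tendsto (fun w : ℝ => 2 * Real.exp (-w)) atTop (𝓝 0) := by
    simpa using (Real.tendsto_exp_neg_atTop_nhds_zero).const_mul 2
  exact squeeze_zero besselWeight_nonneg besselWeight_le h1

lemma tendsto_besselWeight_atBot : Tendsto besselWeight atBot (𝓝 1) := by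
  obtain ⟨C, hC, h⟩ := exists_one_sub_besselWeight_le
  have h1 : Tendsto (fun w : ℝ => C * Real.exp (w / 2)) atBot (𝓝 0) := by
    simpa using (Real.tendsto_exp_atBot.comp (tendsto_id.atBot_div_const (by norm_num : (0:ℝ) < 2))).const_mul C
  have h2 := squeeze_zero (fun w => sub_nonneg.mpr (besselWeight_le_one w)) h h1
  simpa using h2.const_sub 1

/-- The weight falls from `1` at `-∞` to `0` at `+∞`; being nonnegative, the density is therefore a
probability density. -/
lemma integral_besselDensity : ∫ x, besselDensity x = 1 := by
  have := integral_of_hasDerivAt_of_tendsto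
    hasDerivAt_besselWeight integrable_besselDensity.neg
    tendsto_besselWeight_atBot tendsto_besselWeight_atTop
  simp only [integral_neg] at this
  linarith

lemma integrableOn_besselWeight : IntegrableOn besselWeight (Set.Ioi 0) := by
  have h1 := (integrableOn_pow_mul_exp 0 (σ := 1) one_pos).const_mul 2
  refine h1.mono' continuous_besselWeight.aestronglyMeasurable (Eventually.of_forall fun w => ?_)
  rw [Real.norm_of_nonneg (besselWeight_nonneg w)]
  simpa using besselWeight_le w

lemma integrableOn_besselWeight_sub_one :
    IntegrableOn (fun w => besselWeight w - 1) (Set.Iic 0) := by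
  obtain ⟨C, hC, h⟩ := exists_one_sub_besselWeight_le
  have h1 : IntegrableOn (fun w : ℝ => C * Real.exp (w / 2)) (Set.Iic 0) := by
    have h2 : IntegrableOn (fun w : ℝ => C * Real.exp (1 / 2 * w)) (Set.Iic 0) :=
      (integrableOn_exp_mul_Iic (a := 1 / 2) (by norm_num) 0).const_mul C
    refine h2.congr_fun (fun w _ => ?_) measurableSet_Iic
    simp only
    congr 2
    ring
  refine h1.mono' (continuous_besselWeight.sub continuous_const).aestronglyMeasurable
    (Eventually.of_forall fun w => ?_)
  rw [Real.norm_eq_abs, abs_sub_comm, abs_of_nonneg (sub_nonneg.mpr (besselWeight_le_one w))]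
  exact h w

lemma integral_Ioi_mul_besselDensity :
    ∫ w in Set.Ioi 0, w * besselDensity w = ∫ w in Set.Ioi 0, besselWeight w := by
  have hd : ∀ w ∈ Set.Ici (0 : ℝ), HasDerivAt (fun w => w * besselWeight w)
      (besselWeight w - w * besselDensity w) w := fun w _ =>
    ((hasDerivAt_id' w).fun_mul (hasDerivAt_besselWeight w)).congr_deriv (by ring)
  have hlim : Tendsto (fun w => w * besselWeight w) atTop (𝓝 0) := by
    have h1 := (Real.tendsto_pow_mul_exp_neg_atTop_nhds_zero 1).const_mul 2
    rw [mul_zero] at h1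
    refine squeeze_zero' (eventually_atTop.mpr ⟨0, fun w hw => mul_nonneg hw (besselWeight_nonneg w)⟩)
      (eventually_atTop.mpr ⟨0, fun w hw => ?_⟩) h1
    calc w * besselWeight w ≤ w * (2 * Real.exp (-w)) := by gcongr; exact besselWeight_le w
      _ = _ := by ring
  have := integral_Ioi_of_hasDerivAt_of_tendsto' hd
    (integrableOn_besselWeight.sub integrable_mul_besselDensity.integrableOn) hlim
  rw [integral_sub integrableOn_besselWeight integrable_mul_besselDensity.integrableOn] at this
  simp only [zero_mul, sub_zero] at this
  linarith

lemma integral_Iic_mul_besselDensity :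
    ∫ w in Set.Iic 0, w * besselDensity w = ∫ w in Set.Iic 0, (besselWeight w - 1) := by
  have hd : ∀ w ∈ Set.Iic (0 : ℝ), HasDerivAt (fun w => w * (besselWeight w - 1))
      ((besselWeight w - 1) - w * besselDensity w) w := fun w _ =>
    ((hasDerivAt_id' w).fun_mul ((hasDerivAt_besselWeight w).sub_const 1)).congr_deriv (by ring)
  have hlim : Tendsto (fun w => w * (besselWeight w - 1)) atBot (𝓝 0) := by
    obtain ⟨C, hC, h⟩ := exists_one_sub_besselWeight_le
    have h1 := ((Real.tendsto_pow_mul_exp_neg_atTop_nhds_zero 1).comp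
      (tendsto_neg_atBot_atTop.comp (tendsto_id.atBot_div_const (by norm_num : (0:ℝ) < 2)))).const_mul
        (2 * C)
    rw [mul_zero] at h1
    refine squeeze_zero' (eventually_atBot.mpr ⟨0, fun w hw =>
      mul_nonneg_of_nonpos_of_nonpos hw (sub_nonpos.mpr (besselWeight_le_one w))⟩)
      (eventually_atBot.mpr ⟨0, fun w hw => ?_⟩) h1
    simp only [Function.comp, id, neg_neg, pow_one]
    calc w * (besselWeight w - 1) = -w * (1 - besselWeight w) := by ring
      _ ≤ -w * (C * Real.exp (w / 2)) := by
        gcongr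
        · linarith
        · exact h w
      _ = _ := by ring
  have := integral_Iic_of_hasDerivAt_of_tendsto' hd
    (integrableOn_besselWeight_sub_one.sub integrable_mul_besselDensity.integrableOn) hlim
  rw [integral_sub integrableOn_besselWeight_sub_one
    integrable_mul_besselDensity.integrableOn] at this
  simp only [zero_mul, sub_zero] at this
  linarith

lemma hasDerivAt_two_mul_exp_neg (w : ℝ) :
    HasDerivAt (fun w : ℝ => 2 * Real.exp (-w)) (-(2 * Real.exp (-w))) w :=
  ((((hasDerivAt_id' w).fun_neg).exp).const_mul 2).congr_deriv (by ring)

lemma injective_two_mul_exp_neg : Function.Injective fun w : ℝ => 2 * Real.exp (-w) := by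
  intro a b h
  simpa using h

/-- The first moment of `besselDensity` is the constant `A`. -/
lemma integral_mul_besselDensity : ∫ w, w * besselDensity w = constA := by
  -- The substitution `t = 2e^(-w)` moves the break `t = 2` in the definition of `A` to `w = 0`, and
  -- the subtraction of `t` there becomes the subtraction of the limit `1` of the weight at `-∞`.
  have himg1 : (fun w : ℝ => 2 * Real.exp (-w)) '' Set.Ioi 0 = Set.Ioo 0 2 := by
    ext t
    constructor
    · rintro ⟨w, hw, rfl⟩
      have hw : 0 < w := hw
      have h1 := Real.exp_lt_one_iff.mpr (neg_lt_zero.mpr hw)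
      have h2 := Real.exp_pos (-w)
      exact ⟨by simp only; linarith, by simp only; linarith⟩
    · rintro ⟨h0, h2⟩
      refine ⟨-Real.log (t / 2), ?_, ?_⟩
      · simp only [Set.mem_Ioi, Left.neg_pos_iff]
        exact Real.log_neg (by positivity) (by linarith)
      · simp only [neg_neg]
        rw [Real.exp_log (by positivity)]; ring
  have himg2 : (fun w : ℝ => 2 * Real.exp (-w)) '' Set.Iio 0 = Set.Ioi 2 := by
    ext t
    constructor
    · rintro ⟨w, hw, rfl⟩
      have hw : w < 0 := hw
      have h1 := Real.one_lt_exp_iff.mpr (neg_pos.mpr hw)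
      simp only [Set.mem_Ioi]; linarith
    · intro ht
      have ht : 2 < t := ht
      refine ⟨-Real.log (t / 2), ?_, ?_⟩
      · simp only [Set.mem_Iio, Left.neg_neg_iff]
        exact Real.log_pos (by linarith)
      · simp only [neg_neg]
        rw [Real.exp_log (by positivity)]; ring
  have e1 : ∫ t in (0 : ℝ)..2, Real.log (besselI0 t) / t ^ 2
      = ∫ w in Set.Ioi 0, besselWeight w := by
    rw [intervalIntegral.integral_of_le (by norm_num), integral_Ioc_eq_integral_Ioo, ← himg1,
      integral_image_eq_integral_abs_deriv_smul measurableSet_Ioi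
        (fun w _ => (hasDerivAt_two_mul_exp_neg w).hasDerivWithinAt)
        injective_two_mul_exp_neg.injOn]
    refine setIntegral_congr_fun measurableSet_Ioi fun w _ => ?_
    have hpos : 0 < 2 * Real.exp (-w) := by positivity
    simp only [abs_neg, abs_of_pos hpos, smul_eq_mul, besselWeight, logBessel]
    field_simp
  have e2 : ∫ t in Set.Ioi (2 : ℝ), (Real.log (besselI0 t) - t) / t ^ 2
      = ∫ w in Set.Iic 0, (besselWeight w - 1) := by
    rw [← himg2, integral_image_eq_integral_abs_deriv_smul measurableSet_Iio
        (fun w _ => (hasDerivAt_two_mul_exp_neg w).hasDerivWithinAt)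
        injective_two_mul_exp_neg.injOn, integral_Iic_eq_integral_Iio]
    refine setIntegral_congr_fun measurableSet_Iio fun w _ => ?_
    have hpos : 0 < 2 * Real.exp (-w) := by positivity
    simp only [abs_neg, abs_of_pos hpos, smul_eq_mul, besselWeight, logBessel]
    field_simp
  rw [constA, e1, e2, ← integral_Ioi_mul_besselDensity, ← integral_Iic_mul_besselDensity, add_comm,
    ← Set.compl_Iic, integral_add_compl measurableSet_Iic integrable_mul_besselDensity]

/-! ### Asymptotics of the prime sum of `log I₀(2k/n)` -/

lemma integral_Ioi_besselDensity_sub (V L : ℝ) :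
    ∫ v in Set.Ioi L, besselDensity (v - V) = besselWeight (L - V) := by
  have := integral_Ioi_of_hasDerivAt_of_tendsto' (a := L)
    (fun x _ => (hasDerivAt_besselWeight (x - V)).comp_sub_const x V)
    ((integrable_besselDensity.comp_sub_right V).neg.integrableOn)
    (tendsto_besselWeight_atTop.comp (tendsto_atTop_add_const_right atTop (-V) tendsto_id))
  rw [integral_neg] at this
  linarith

lemma integral_indicator_besselDensity (V : ℝ) (n : ℕ) :
    ∫ v in Set.Ioi (0 : ℝ), (Set.Ici (Real.log n)).indicator
        (fun v => Λ n / (n * Real.log n) * besselDensity (v - V)) v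
      = Λ n / (n * Real.log n) * besselWeight (Real.log n - V) := by
  by_cases h0 : Λ n / (n * Real.log n) = 0
  · simp [h0]
  have hL : 0 < Real.log n := by
    refine lt_of_le_of_ne (Real.log_natCast_nonneg n) fun h => h0 ?_
    rw [← h]; simp
  rw [setIntegral_indicator measurableSet_Ici, Set.inter_eq_right.mpr (Set.Ici_subset_Ioi.mpr hL),
    integral_Ici_eq_integral_Ioi, integral_const_mul, integral_Ioi_besselDensity_sub]

lemma mertensCoeff_mul_besselWeight {k : ℝ} (hk : 0 < k) (n : ℕ) :
    2 * k * (Λ n / (n * Real.log n) * besselWeight (Real.log n - Real.log k))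
      = Λ n / Real.log n * logBessel (2 * k / n) := by
  rcases Nat.eq_zero_or_pos n with rfl | hn
  · simp
  have hn' : (0 : ℝ) < n := by exact_mod_cast hn
  rw [besselWeight, neg_sub, Real.exp_sub, Real.exp_log hk, Real.exp_log hn', ← mul_div_assoc]
  field_simp

/-- Abel summation in integral form: `besselWeight (log n - log k)` is the integral of the
translated density beyond `log n`, so interchanging sum and integral collects the coefficients into
the Mertens sum. -/
lemma hasSum_logBessel {k : ℝ} (hk : 0 < k) :
    HasSum (fun n : ℕ => Λ n / Real.log n * logBessel (2 * k / n))
      (2 * k * ∫ v in Set.Ioi (0 : ℝ), mertensSum v * besselDensity (v - Real.log k)) := by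
  set V := Real.log k
  set F : ℕ → ℝ → ℝ := fun n => (Set.Ici (Real.log n)).indicator
        (fun v => Λ n / (n * Real.log n) * besselDensity (v - V))
  have hnonneg : ∀ n v, 0 ≤ F n v := fun n v => Set.indicator_nonneg
    (fun v _ => mul_nonneg (mertensCoeff_nonneg n) (besselDensity_nonneg _)) v
  have hint : ∀ n, IntegrableOn (F n) (Set.Ioi 0) := fun n =>
    (((integrable_besselDensity.comp_sub_right V).const_mul _).indicator
      measurableSet_Ici).integrableOn
  have hnorm : ∀ n, ∫ v in Set.Ioi (0 : ℝ), ‖F n v‖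
      = Λ n / (n * Real.log n) * besselWeight (Real.log n - V) := fun n => by
    simp_rw [fun v => Real.norm_of_nonneg (hnonneg n v)]
    exact integral_indicator_besselDensity V n
  have hsummable : Summable fun n => ∫ v in Set.Ioi (0 : ℝ), ‖F n v‖ := by
    simp_rw [hnorm]
    refine Summable.of_nonneg_of_le
      (fun n => mul_nonneg (mertensCoeff_nonneg n) (besselWeight_nonneg _)) (fun n => ?_)
      ((Real.summable_one_div_nat_pow.mpr one_lt_two).mul_left (2 * k))
    rcases Nat.eq_zero_or_pos n with rfl | hn
    · simp
    have hn' : (0 : ℝ) < n := by exact_mod_cast hn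
    calc _ ≤ 1 / (n : ℝ) * (2 * Real.exp (-(Real.log n - V))) :=
          mul_le_mul (mertensCoeff_le n) (besselWeight_le _) (besselWeight_nonneg _) (by positivity)
      _ = _ := by
          rw [neg_sub, Real.exp_sub, Real.exp_log hk, Real.exp_log hn']
          field_simp
  have hkey := hasSum_integral_of_summable_integral_norm hint hsummable
  have h1 : ∀ v, ∑' n, F n v = mertensSum v * besselDensity (v - V) := fun v => by
    rw [← ((hasSum_mertensSum v).mul_right (besselDensity (v - V))).tsum_eq]
    refine tsum_congr fun n => ?_
    by_cases h : v ∈ Set.Ici (Real.log n)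
    · simp only [F, Set.indicator_of_mem h]
    · simp only [F, Set.indicator_of_notMem h, zero_mul]
  simp_rw [h1] at hkey
  have h2 : ∀ n, 2 * k * ∫ v in Set.Ioi (0 : ℝ), F n v
      = Λ n / Real.log n * logBessel (2 * k / n) := fun n => by
    rw [← mertensCoeff_mul_besselWeight hk, ← integral_indicator_besselDensity]
  simpa only [h2] using hkey.mul_left (2 * k)

lemma abs_log_add_sub_le {V w : ℝ} (hV : 0 < V) (hw : -V / 2 ≤ w) :
    |Real.log (V + w) - (Real.log V + w / V)| ≤ 2 * w ^ 2 / V ^ 2 := by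
  have hpos : 0 < 1 + w / V := by
    have : -1 / 2 ≤ w / V := by rw [le_div_iff₀ hV]; linarith
    linarith
  have hge : 1 / 2 ≤ 1 + w / V := by
    have : -1 / 2 ≤ w / V := by rw [le_div_iff₀ hV]; linarith
    linarith
  have h1 : Real.log (V + w) = Real.log V + Real.log (1 + w / V) := by
    rw [← Real.log_mul hV.ne' hpos.ne']; congr 1; field_simp
  have e : 2 * w ^ 2 / V ^ 2 = 2 * (w / V) ^ 2 := by ring
  rw [h1, e]
  set u := w / V
  have h2 := Real.log_le_sub_one_of_pos hpos
  have h3 := Real.one_sub_inv_le_log_of_pos hpos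
  have h4 : 1 - (1 + u)⁻¹ ≥ u - 2 * u ^ 2 := by
    have : 1 - (1 + u)⁻¹ = u - u ^ 2 / (1 + u) := by field_simp; ring
    rw [this]
    have : u ^ 2 / (1 + u) ≤ 2 * u ^ 2 := by
      rw [div_le_iff₀ hpos]; nlinarith [sq_nonneg u]
    linarith
  rw [abs_le]
  constructor
  · linarith
  · linarith [sq_nonneg u]

/-- Pointwise comparison behind the asymptotic formula for `∑ Λ(n) / log n * log I₀(2 k / n)`. -/
lemma abs_mertensSum_mul_sub_le {V v : ℝ} (hV : 2 ≤ V) :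
    |(Set.Ioi (0 : ℝ)).indicator (fun v => mertensSum v * besselDensity (v - V)) v
      - (Real.log V + Real.eulerMascheroniConstant + (v - V) / V) * besselDensity (v - V)|
    ≤ V⁻¹ ^ 2 * (32 * (|v - V| ^ 3 * besselDensity (v - V))
        + 4 * (|v - V| ^ 2 * besselDensity (v - V))
        + (Set.Ioi (0 : ℝ)).indicator (fun v => 8 * (v ^ 4 * mertensError v ^ 2)) v
        + besselDensity (v - V) ^ 2) := by
  have hV0 : 0 < V := by linarith
  set w := v - V with hw
  set φ := besselDensity w
  have hφ : 0 ≤ φ := besselDensity_nonneg w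
  obtain ⟨g0, g1⟩ := eulerMascheroniConstant_nonneg_le_one
  set γ := Real.eulerMascheroniConstant
  -- In the left tail all quantities are bounded crudely, and `|w| ≥ V/2` trades powers of `V` for
  -- moments of the density. In the remaining range `v ≥ V/2`, so `log v` can be expanded at `V`.
  rcases le_or_gt w (-V / 2) with h | h
  · have habs : V / 2 ≤ |w| := by
      rw [abs_of_nonpos (by linarith)]; linarith
    have h1 : |(Set.Ioi (0 : ℝ)).indicator (fun v => mertensSum v * besselDensity (v - V)) v|
        ≤ V * φ := by
      by_cases hv : 0 < v
      · rw [Set.indicator_of_mem (Set.mem_Ioi.mpr hv), abs_of_nonneg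
          (mul_nonneg (mertensSum_nonneg v) hφ)]
        have := mertensSum_le hv.le
        exact mul_le_mul_of_nonneg_right (by linarith) hφ
      · rw [Set.indicator_of_notMem (by simpa using hv), abs_zero]
        positivity
    have hlog0 : 0 ≤ Real.log V := Real.log_nonneg (by linarith)
    have hlog1 : Real.log V ≤ V - 1 := Real.log_le_sub_one_of_pos hV0
    have h2 : |(Real.log V + γ + w / V) * φ| ≤ (V + |w| / V) * φ := by
      rw [abs_mul, abs_of_nonneg hφ]
      refine mul_le_mul_of_nonneg_right ((abs_add_le _ _).trans ?_) hφ
      rw [abs_of_nonneg (by positivity), abs_div, abs_of_pos hV0]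
      linarith
    have h3 : 2 * V ≤ V⁻¹ ^ 2 * (32 * |w| ^ 3) := by
      have : V ^ 3 ≤ 8 * |w| ^ 3 := by
        calc V ^ 3 = 8 * (V / 2) ^ 3 := by ring
          _ ≤ _ := by gcongr
      calc 2 * V ≤ V⁻¹ ^ 2 * (4 * V ^ 3) := by
            have : V⁻¹ ^ 2 * (4 * V ^ 3) = 4 * V := by field_simp
            linarith
        _ ≤ _ := by gcongr _ * ?_; linarith
    have h4 : |w| / V ≤ V⁻¹ ^ 2 * (4 * |w| ^ 2) := by
      have : |w| / V = V⁻¹ ^ 2 * (V * |w|) := by field_simp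
      rw [this]
      gcongr _ * ?_
      nlinarith [abs_nonneg w]
    have h5 : 0 ≤ (Set.Ioi (0 : ℝ)).indicator (fun v => 8 * (v ^ 4 * mertensError v ^ 2)) v :=
      Set.indicator_nonneg (fun v _ => by positivity) v
    calc _ ≤ V * φ + (V + |w| / V) * φ := (abs_sub _ _).trans (add_le_add h1 h2)
      _ = (2 * V + |w| / V) * φ := by ring
      _ ≤ (V⁻¹ ^ 2 * (32 * |w| ^ 3) + V⁻¹ ^ 2 * (4 * |w| ^ 2)) * φ := by gcongr
      _ = V⁻¹ ^ 2 * (32 * (|w| ^ 3 * φ) + 4 * (|w| ^ 2 * φ) + 0 + 0) := by ring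
      _ ≤ _ := by gcongr; positivity
  · have hv : 0 < v := by linarith
    have hvV : V ≤ 2 * v := by linarith
    rw [Set.indicator_of_mem (Set.mem_Ioi.mpr hv), Set.indicator_of_mem (Set.mem_Ioi.mpr hv)]
    have h1 := abs_log_add_sub_le hV0 h.le
    rw [show V + w = v by rw [hw]; ring] at h1
    have e : mertensSum v * φ - (Real.log V + γ + w / V) * φ
        = (Real.log v - (Real.log V + w / V)) * φ + mertensError v * φ := by
      unfold mertensError; ring
    -- Only the mean square of the error is available, so the product is split by `2xy ≤ x² + y²`
    -- with `x = V² |mertensError v|`, `y = φ`, together with `V⁴ ≤ 16 v⁴`.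
    have h2 : |mertensError v * φ| ≤ V⁻¹ ^ 2 * (8 * (v ^ 4 * mertensError v ^ 2) + φ ^ 2) := by
      have h3 : V ^ 2 * |mertensError v * φ| ≤ 8 * (v ^ 4 * mertensError v ^ 2) + φ ^ 2 := by
        rw [abs_mul, abs_of_nonneg hφ, ← sq_abs (mertensError v)]
        have h4 : V ^ 4 ≤ 16 * v ^ 4 := by
          calc V ^ 4 ≤ (2 * v) ^ 4 := by gcongr
            _ = _ := by ring
        have h5 := mul_le_mul_of_nonneg_right h4 (sq_nonneg |mertensError v|)
        nlinarith [sq_nonneg (V ^ 2 * |mertensError v| - φ), sq_nonneg φ]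
      calc _ = V⁻¹ ^ 2 * (V ^ 2 * |mertensError v * φ|) := by field_simp
        _ ≤ _ := by gcongr
    have h6 : 0 ≤ 32 * (|w| ^ 3 * φ) + 2 * (|w| ^ 2 * φ) := by positivity
    change |mertensSum v * φ - (Real.log V + γ + w / V) * φ| ≤ _
    rw [e]
    calc _ ≤ |(Real.log v - (Real.log V + w / V)) * φ| + |mertensError v * φ| := abs_add_le _ _
      _ ≤ 2 * w ^ 2 / V ^ 2 * φ + V⁻¹ ^ 2 * (8 * (v ^ 4 * mertensError v ^ 2) + φ ^ 2) := by
          rw [abs_mul, abs_of_nonneg hφ]; gcongr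
      _ = V⁻¹ ^ 2 * (2 * (|w| ^ 2 * φ) + 8 * (v ^ 4 * mertensError v ^ 2) + φ ^ 2) := by
          rw [sq_abs]; ring
      _ ≤ _ := by gcongr _ * ?_; linarith

/-- The linear approximation `log V + γ + (v - V)/V` integrates exactly to the main term, because
the density has mass `1` and mean `A`. What remains is `V⁻²` times finite integrals independent of
`V`. -/
lemma exists_abs_integral_mertensSum_sub_le : ∃ C : ℝ, ∀ V : ℝ, 2 ≤ V →
    |(∫ v in Set.Ioi (0 : ℝ), mertensSum v * besselDensity (v - V))
      - (Real.log V + Real.eulerMascheroniConstant + constA / V)| ≤ C / V ^ 2 := by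
  refine ⟨32 * (∫ w, |w| ^ 3 * besselDensity w) + 4 * (∫ w, |w| ^ 2 * besselDensity w)
    + 8 * (∫ v in Set.Ioi (0 : ℝ), v ^ 4 * mertensError v ^ 2) + ∫ w, besselDensity w ^ 2,
    fun V hV => ?_⟩
  set γ := Real.eulerMascheroniConstant
  have hV0 : 0 < V := by linarith
  have i3 := ((integrable_pow_abs_mul_besselDensity 3).comp_sub_right V).const_mul 32
  have i2 := ((integrable_pow_abs_mul_besselDensity 2).comp_sub_right V).const_mul 4
  have i4 : Integrable ((Set.Ioi (0 : ℝ)).indicator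
      (fun v => 8 * (v ^ 4 * mertensError v ^ 2))) :=
    (integrable_indicator_iff measurableSet_Ioi).mpr
      (integrableOn_pow_four_mul_mertensError_sq.const_mul 8)
  have i1 := integrable_besselDensity_sq.comp_sub_right V
  have iB : Integrable fun v => V⁻¹ ^ 2 * (32 * (|v - V| ^ 3 * besselDensity (v - V))
      + 4 * (|v - V| ^ 2 * besselDensity (v - V))
      + (Set.Ioi (0 : ℝ)).indicator (fun v => 8 * (v ^ 4 * mertensError v ^ 2)) v
      + besselDensity (v - V) ^ 2) := (((i3.add i2).add i4).add i1).const_mul (V⁻¹ ^ 2)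
  have iL1 := (integrable_besselDensity.comp_sub_right V).const_mul (Real.log V + γ)
  have iL2 := (integrable_mul_besselDensity.comp_sub_right V).const_mul V⁻¹
  have eL : (fun v => (Real.log V + γ + (v - V) / V) * besselDensity (v - V))
      = fun v => (Real.log V + γ) * besselDensity (v - V)
        + V⁻¹ * ((v - V) * besselDensity (v - V)) := by
    funext v; rw [div_eq_inv_mul]; ring
  have iL : Integrable fun v => (Real.log V + γ + (v - V) / V) * besselDensity (v - V) := by
    rw [eL]; exact iL1.add iL2
  have hL : ∫ v, (Real.log V + γ + (v - V) / V) * besselDensity (v - V)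
      = Real.log V + γ + constA / V := by
    rw [eL, integral_add iL1 iL2, integral_const_mul, integral_const_mul,
      integral_sub_right_eq_self (fun v => besselDensity v),
      integral_sub_right_eq_self (fun v => v * besselDensity v), integral_besselDensity,
      integral_mul_besselDensity]
    ring
  have hm : AEStronglyMeasurable ((Set.Ioi (0 : ℝ)).indicator
      (fun v => mertensSum v * besselDensity (v - V))) := by
    refine Measurable.aestronglyMeasurable (Measurable.indicator ?_ measurableSet_Ioi)
    exact monotone_mertensSum.measurable.mul
      (continuous_besselDensity.comp (continuous_id.sub continuous_const)).measurable
  have hpt := fun v => abs_mertensSum_mul_sub_le (v := v) hV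
  have hD : Integrable fun v => (Set.Ioi (0 : ℝ)).indicator
      (fun v => mertensSum v * besselDensity (v - V)) v
      - (Real.log V + γ + (v - V) / V) * besselDensity (v - V) :=
    Integrable.mono' iB (hm.sub iL.aestronglyMeasurable) (Eventually.of_forall fun v => hpt v)
  have hG : Integrable ((Set.Ioi (0 : ℝ)).indicator
      (fun v => mertensSum v * besselDensity (v - V))) := by
    refine (hD.add iL).congr (Eventually.of_forall fun v => ?_)
    simp
  rw [← integral_indicator measurableSet_Ioi, ← hL, ← integral_sub hG iL]
  rw [← Real.norm_eq_abs]
  refine (norm_integral_le_of_norm_le iB (Eventually.of_forall hpt)).trans_eq ?_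
  rw [integral_const_mul]
  have e1 := integral_add ((i3.add i2).add i4) i1
  have e2 := integral_add (i3.add i2) i4
  have e3 := integral_add i3 i2
  simp only [Pi.add_apply] at e1 e2 e3
  rw [e1, e2, e3, integral_const_mul, integral_const_mul, integral_indicator measurableSet_Ioi,
    integral_const_mul, integral_sub_right_eq_self (fun v => |v| ^ 3 * besselDensity v),
    integral_sub_right_eq_self (fun v => |v| ^ 2 * besselDensity v),
    integral_sub_right_eq_self (fun v => besselDensity v ^ 2)]
  ring

/-- The prime sum `∑ Λ(n) / log n * log I₀(2 k / n)` is
`2 k (log log k + γ + A / log k + O(1 / log² k))`. -/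
lemma exists_abs_tsum_logBessel_sub_le : ∃ C : ℝ, ∀ k : ℝ, Real.exp 2 ≤ k →
    |(∑' n : ℕ, Λ n / Real.log n * logBessel (2 * k / n))
      - 2 * k * (Real.log (Real.log k) + Real.eulerMascheroniConstant + constA / Real.log k)|
      ≤ C * k / Real.log k ^ 2 := by
  obtain ⟨C, hC⟩ := exists_abs_integral_mertensSum_sub_le
  refine ⟨2 * C, fun k hk => ?_⟩
  have hk0 : 0 < k := (Real.exp_pos 2).trans_le hk
  have h1 := hC (Real.log k) ((Real.le_log_iff_exp_le hk0).mpr hk)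
  rw [(hasSum_logBessel hk0).tsum_eq, ← mul_sub, abs_mul, abs_of_pos (by positivity : 0 < 2 * k)]
  calc _ ≤ 2 * k * (C / Real.log k ^ 2) := by gcongr
    _ = _ := by ring

/-! ### The divisor bound and the odd divisor series -/

lemma card_divisors_le_rpow {ε : ℝ} (hε : 0 < ε) :
    ∃ C : ℝ, 1 ≤ C ∧ ∀ n : ℕ, n ≠ 0 → (n.divisors.card : ℝ) ≤ C * (n : ℝ) ^ ε := by
  have hl2 : 0 < Real.log 2 := Real.log_pos one_lt_two
  -- `K` bounds `(a+1)/p^(εa)` for every prime. When `p^ε ≥ 2` the bound `1` is already enough, so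
  -- only the primes below `P` cost a factor `K`.
  set K : ℝ := 1 + 1 / (ε * Real.log 2) with hKdef
  have hK : 1 ≤ K := by
    have : 0 < 1 / (ε * Real.log 2) := by positivity
    linarith
  have hsmall : ∀ p a : ℕ, p.Prime → ((a + 1 : ℕ) : ℝ) ≤ K * ((p : ℝ) ^ ε) ^ a := by
    intro p a hp
    have h2 : (2 : ℝ) ≤ p := by exact_mod_cast hp.two_le
    have h3 : ((a : ℝ) * (ε * Real.log 2)) + 1 ≤ ((p : ℝ) ^ ε) ^ a := by
      calc _ ≤ Real.exp (a * (ε * Real.log 2)) := Real.add_one_le_exp _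
        _ = ((2 : ℝ) ^ ε) ^ a := by
            rw [Real.exp_nat_mul, Real.rpow_def_of_pos two_pos, mul_comm ε]
        _ ≤ _ := by gcongr
    have hpos : 0 < ε * Real.log 2 := by positivity
    calc ((a + 1 : ℕ) : ℝ) ≤ K * (a * (ε * Real.log 2) + 1) := by
          have e : K * (a * (ε * Real.log 2) + 1)
              = a * (ε * Real.log 2) + 1 + a + 1 / (ε * Real.log 2) := by
            rw [hKdef]; field_simp; ring
          rw [e]
          push_cast
          have : 0 ≤ (a : ℝ) * (ε * Real.log 2) := by positivity
          have : 0 < 1 / (ε * Real.log 2) := by positivity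
          linarith
      _ ≤ _ := by gcongr
  obtain ⟨P, hP⟩ := exists_nat_ge ((2 : ℝ) ^ (1 / ε))
  have hlarge : ∀ p a : ℕ, P ≤ p → ((a + 1 : ℕ) : ℝ) ≤ ((p : ℝ) ^ ε) ^ a := by
    intro p a hp
    have h1 : (2 : ℝ) ^ (1 / ε) ≤ p := hP.trans (by exact_mod_cast hp)
    have h2 : (2 : ℝ) ≤ (p : ℝ) ^ ε := by
      calc (2 : ℝ) = ((2 : ℝ) ^ (1 / ε)) ^ ε := by
            rw [← Real.rpow_mul two_pos.le, one_div_mul_cancel hε.ne', Real.rpow_one]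
        _ ≤ _ := by gcongr
    calc ((a + 1 : ℕ) : ℝ) ≤ (2 : ℝ) ^ a := by exact_mod_cast Nat.lt_two_pow_self
      _ ≤ _ := by gcongr
  refine ⟨K ^ P, one_le_pow₀ hK, fun n hn => ?_⟩
  have hn' : (n : ℝ) ^ ε = ∏ p ∈ n.primeFactors, ((p : ℝ) ^ ε) ^ n.factorization p := by
    have h0 : (n : ℝ) = ∏ p ∈ n.primeFactors, (p : ℝ) ^ n.factorization p := by
      exact_mod_cast (Nat.prod_factorization_pow_eq_self hn).symm
    conv_lhs => rw [h0]
    rw [← Real.finsetProd_rpow _ _ fun p _ => by positivity]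
    refine Finset.prod_congr rfl fun p _ => ?_
    rw [← Real.rpow_natCast, ← Real.rpow_natCast, ← Real.rpow_mul (by positivity),
      ← Real.rpow_mul (by positivity), mul_comm]
  rw [Nat.card_divisors hn, hn']
  push_cast
  calc ∏ p ∈ n.primeFactors, ((n.factorization p : ℝ) + 1)
      ≤ ∏ p ∈ n.primeFactors, ((if p < P then K else 1) * ((p : ℝ) ^ ε) ^ n.factorization p) := by
        refine Finset.prod_le_prod (fun _ _ => by positivity) fun p hp => ?_
        split_ifs with h
        · exact_mod_cast hsmall p _ (Nat.prime_of_mem_primeFactors hp)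
        · rw [one_mul]; exact_mod_cast hlarge p _ (not_lt.mp h)
    _ = (∏ p ∈ n.primeFactors, if p < P then K else 1)
        * ∏ p ∈ n.primeFactors, ((p : ℝ) ^ ε) ^ n.factorization p := Finset.prod_mul_distrib
    _ ≤ _ := by
        gcongr
        rw [Finset.prod_ite, Finset.prod_const_one, mul_one, Finset.prod_const]
        refine pow_le_pow_right₀ hK ?_
        calc _ ≤ (Finset.range P).card := Finset.card_le_card fun p hp => by
              rw [Finset.mem_filter] at hp; exact Finset.mem_range.mpr hp.2
          _ = P := Finset.card_range P

/-- The indicator function of the odd numbers. -/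
noncomputable def oddIndicator : ArithmeticFunction ℝ := ⟨fun n => if Odd n then 1 else 0, by simp⟩

/-- The indicator function of the odd numbers below `N`. -/
noncomputable def oddIndicatorBelow (N : ℕ) : ArithmeticFunction ℝ :=
  ⟨fun n => if Odd n ∧ n < N then 1 else 0, by simp⟩

lemma oddIndicator_apply (n : ℕ) : oddIndicator n = if Odd n then 1 else 0 := rfl

lemma oddIndicatorBelow_apply (N n : ℕ) :
    oddIndicatorBelow N n = if Odd n ∧ n < N then 1 else 0 := rfl

lemma oddIndicator_nonneg (n : ℕ) : 0 ≤ oddIndicator n := by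
  rw [oddIndicator_apply]; split_ifs <;> norm_num

lemma oddIndicatorBelow_nonneg (N n : ℕ) : 0 ≤ oddIndicatorBelow N n := by
  rw [oddIndicatorBelow_apply]; split_ifs <;> norm_num

lemma oddIndicatorBelow_le (N n : ℕ) : oddIndicatorBelow N n ≤ oddIndicator n := by
  rw [oddIndicatorBelow_apply, oddIndicator_apply]
  split_ifs with h1 h2 <;> norm_num
  exact absurd h1.1 h2

lemma isMultiplicative_oddIndicator : oddIndicator.IsMultiplicative := by
  refine ⟨by simp [oddIndicator_apply], fun {m n} _ => ?_⟩
  simp only [oddIndicator_apply, Nat.odd_mul]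
  split_ifs <;> simp_all

lemma pow_apply_nonneg {f : ArithmeticFunction ℝ} (hf : ∀ n, 0 ≤ f n) (k n : ℕ) :
    0 ≤ (f ^ k) n := by
  induction k generalizing n with
  | zero => rw [pow_zero, one_apply]; split_ifs <;> norm_num
  | succ k ih =>
    rw [pow_succ, mul_apply]
    exact Finset.sum_nonneg fun x _ => mul_nonneg (ih _) (hf _)

lemma pow_apply_le_pow_apply {f g : ArithmeticFunction ℝ} (hf : ∀ n, 0 ≤ f n)
    (hfg : ∀ n, f n ≤ g n) (k n : ℕ) : (f ^ k) n ≤ (g ^ k) n := by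
  induction k generalizing n with
  | zero => simp
  | succ k ih =>
    rw [pow_succ, mul_apply, pow_succ, mul_apply]
    refine Finset.sum_le_sum fun x _ => mul_le_mul (ih _) (hfg _) (hf _) ?_
    exact pow_apply_nonneg (fun n => (hf n).trans (hfg n)) k _

lemma pow_apply_eq_pow_apply {f g : ArithmeticFunction ℝ} {N : ℕ} (hfg : ∀ n < N, f n = g n)
    (k : ℕ) {n : ℕ} (hn : n < N) : (f ^ k) n = (g ^ k) n := by
  induction k generalizing n with
  | zero => simp
  | succ k ih =>
    rw [pow_succ, mul_apply, pow_succ, mul_apply]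
    refine Finset.sum_congr rfl fun x hx => ?_
    have h1 := Nat.divisor_le (Nat.fst_mem_divisors_of_mem_antidiagonal hx)
    have h2 := Nat.divisor_le (Nat.snd_mem_divisors_of_mem_antidiagonal hx)
    rw [ih (h1.trans_lt hn), hfg _ (h2.trans_lt hn)]

lemma oddIndicator_pow_le_card (k n : ℕ) :
    (oddIndicator ^ k) n ≤ (n.divisors.card : ℝ) ^ k := by
  induction k generalizing n with
  | zero => rw [pow_zero, one_apply, pow_zero]; split_ifs <;> norm_num
  | succ k ih =>
    rw [pow_succ, mul_apply, pow_succ]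
    calc _ ≤ ∑ x ∈ n.divisorsAntidiagonal, (n.divisors.card : ℝ) ^ k := by
          refine Finset.sum_le_sum fun x hx => ?_
          have h1 : oddIndicator x.2 ≤ 1 := by
            rw [oddIndicator_apply]; split_ifs <;> norm_num
          have h2 : x.1.divisors.card ≤ n.divisors.card := Finset.card_le_card
            (Nat.divisors_subset_of_dvd (Nat.mem_divisorsAntidiagonal.mp hx).2
              (Dvd.intro _ (Nat.mem_divisorsAntidiagonal.mp hx).1))
          calc _ ≤ (oddIndicator ^ k) x.1 * 1 := mul_le_mul_of_nonneg_left h1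
                (pow_apply_nonneg oddIndicator_nonneg k _)
            _ ≤ (x.1.divisors.card : ℝ) ^ k := by rw [mul_one]; exact ih _
            _ ≤ _ := by gcongr
      _ = _ := by
          rw [Finset.sum_const, nsmul_eq_mul, mul_comm, ← Nat.map_div_right_divisors,
            Finset.card_map]

lemma exists_oddIndicator_pow_le_rpow (k : ℕ) {ε : ℝ} (hε : 0 < ε) :
    ∃ C : ℝ, 1 ≤ C ∧ ∀ n : ℕ, (oddIndicator ^ k) n ≤ C * (n : ℝ) ^ ε := by
  obtain ⟨C, hC, h⟩ := card_divisors_le_rpow (ε := ε / (k + 1)) (by positivity)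
  refine ⟨C ^ k, one_le_pow₀ hC, fun n => ?_⟩
  rcases Nat.eq_zero_or_pos n with rfl | hn
  · simp only [ArithmeticFunction.map_zero]; positivity
  calc _ ≤ (n.divisors.card : ℝ) ^ k := oddIndicator_pow_le_card k n
    _ ≤ (C * (n : ℝ) ^ (ε / (k + 1))) ^ k := by gcongr; exact h n hn.ne'
    _ = C ^ k * (n : ℝ) ^ (ε / (k + 1) * k) := by
        rw [mul_pow, Real.rpow_mul_natCast (by positivity)]
    _ ≤ _ := by
        gcongr
        · exact_mod_cast hn
        · rw [div_mul_eq_mul_div, div_le_iff₀ (by positivity)]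
          nlinarith

lemma oddIndicator_pow_eq_zero {n : ℕ} (hn : ¬ Odd n) (k : ℕ) : (oddIndicator ^ k) n = 0 := by
  induction k generalizing n with
  | zero =>
    rw [pow_zero, one_apply, if_neg]
    rintro rfl
    exact hn odd_one
  | succ k ih =>
    rw [pow_succ, mul_apply]
    refine Finset.sum_eq_zero fun x hx => ?_
    have h1 : ¬ (Odd x.1 ∧ Odd x.2) := by
      rw [← Nat.odd_mul, (Nat.mem_divisorsAntidiagonal.mp hx).1]; exact hn
    by_cases h : Odd x.1
    · rw [oddIndicator_apply, if_neg fun h2 => h1 ⟨h, h2⟩, mul_zero]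
    · rw [ih h, zero_mul]

/-- The hockey-stick identity, by induction on the number of factors. The shift `k = j + 1` matches
the coefficients of `(1 - xz)^(-(j+1))` in `localFactor`. -/
lemma oddIndicator_pow_apply_prime_pow {p : ℕ} (hp : p.Prime) (hodd : Odd p) (j a : ℕ) :
    (oddIndicator ^ (j + 1)) (p ^ a) = ((a + j).choose j : ℝ) := by
  induction j generalizing a with
  | zero => simp [oddIndicator_apply, hodd.pow]
  | succ j ih =>
    rw [pow_succ, mul_apply,
      Nat.sum_divisorsAntidiagonal (fun x y => (oddIndicator ^ (j + 1)) x * oddIndicator y),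
      Nat.sum_divisors_prime_pow hp]
    have : ∀ i ∈ Finset.range (a + 1), (oddIndicator ^ (j + 1)) (p ^ i)
        * oddIndicator (p ^ a / p ^ i) = (((i + j).choose j : ℕ) : ℝ) := by
      intro i hi
      rw [ih, oddIndicator_apply, Nat.pow_div (Finset.mem_range_succ_iff.mp hi) hp.pos,
        if_pos hodd.pow, mul_one]
    rw [Finset.sum_congr rfl this, ← Nat.cast_sum, Nat.sum_range_add_choose]
    rfl

/-- The Dirichlet series `∑_{n odd} d_k(n)² / n²`. -/
noncomputable def oddDivisorSeries (k : ℕ) : ℝ := ∑' n : ℕ, ((oddIndicator ^ k) n / n) ^ 2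

lemma summable_oddIndicator_pow_sq (k : ℕ) {ε : ℝ} (hε : 0 < ε) :
    Summable fun n : ℕ => (oddIndicator ^ k) n ^ 2 * (n : ℝ) ^ (-1 - ε) := by
  obtain ⟨C, hC, h⟩ := exists_oddIndicator_pow_le_rpow k (ε := ε / 4) (by positivity)
  refine Summable.of_nonneg_of_le (fun n => by positivity) (fun n => ?_)
    ((Real.summable_nat_rpow.mpr (by linarith : -1 - ε / 2 < -1)).mul_left (C ^ 2))
  rcases Nat.eq_zero_or_pos n with rfl | hn
  · rw [ArithmeticFunction.map_zero, zero_pow two_ne_zero, zero_mul]; positivity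
  have hn' : (0 : ℝ) < n := by exact_mod_cast hn
  calc _ ≤ (C * (n : ℝ) ^ (ε / 4)) ^ 2 * (n : ℝ) ^ (-1 - ε) := by
        gcongr
        · exact pow_apply_nonneg oddIndicator_nonneg k n
        · exact h n
    _ = _ := by
        rw [mul_pow, ← Real.rpow_mul_natCast hn'.le, mul_assoc, ← Real.rpow_add hn']
        congr 2
        push_cast; ring

lemma summable_oddDivisorSeries (k : ℕ) :
    Summable fun n : ℕ => ((oddIndicator ^ k) n / n) ^ 2 := by
  refine (summable_oddIndicator_pow_sq k one_pos).congr fun n => ?_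
  rw [div_pow, div_eq_mul_inv]
  congr 1
  rw [show (-1 - 1 : ℝ) = -((2 : ℕ) : ℝ) by norm_num, Real.rpow_neg (by positivity),
    Real.rpow_natCast]

/-- The Euler product of `∑_{n odd} d_k(n)² / n²`. -/
lemma hasProd_oddDivisorSeries (j : ℕ) :
    HasProd (fun p : Nat.Primes => if (p : ℕ) = 2 then 1 else localFactor j (1 / (p : ℕ)))
      (oddDivisorSeries (j + 1)) := by
  have hmul := isMultiplicative_oddIndicator.pow (k := j + 1)
  have h := EulerProduct.eulerProduct_hasProd (f := fun n : ℕ => ((oddIndicator ^ (j + 1)) n / n) ^ 2)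
    (by simp [hmul.1]) (fun {m n} hmn => by
      simp only [hmul.2 hmn]
      push_cast
      rw [mul_div_mul_comm, mul_pow])
    (summable_oddDivisorSeries (j + 1)).norm (by simp)
  have he : (fun p : Nat.Primes => ∑' e, ((oddIndicator ^ (j + 1)) ((p : ℕ) ^ e) / ((p ^ e : ℕ) : ℝ)) ^ 2)
      = fun p : Nat.Primes => if (p : ℕ) = 2 then 1 else localFactor j (1 / (p : ℕ)) := by
    funext p
    split_ifs with hp
    · rw [hp, tsum_eq_single 0 fun e he => ?_]
      · simp [hmul.1]
      · rw [oddIndicator_pow_eq_zero, zero_div, sq, zero_mul]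
        rw [Nat.not_odd_iff_even]
        exact even_two.pow_of_ne_zero he
    · refine tsum_congr fun e => ?_
      rw [oddIndicator_pow_apply_prime_pow p.2 (p.2.odd_of_ne_two hp)]
      push_cast
      rw [one_div, inv_pow, div_eq_mul_inv]
  rwa [he] at h

/-! ### From the Euler product to the prime sum -/

/-- The contribution `∑_{i ≥ 1} log I₀(T x^i) / i` of a prime to the main prime sum, `x = 1 / p`. -/
noncomputable def besselLogSeries (T x : ℝ) : ℝ := ∑' i : ℕ, logBessel (T * x ^ (i + 1)) / (i + 1)

lemma hasSum_mul_pow_div {T x : ℝ} (h0 : 0 ≤ x) (h1 : x ≤ 1 / 2) :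
    HasSum (fun i : ℕ => T * x ^ (i + 1) / (i + 1)) (T * -Real.log (1 - x)) := by
  have := (Real.hasSum_pow_div_log_of_abs_lt_one
    (show |x| < 1 by rw [abs_of_nonneg h0]; linarith)).mul_left T
  simpa only [mul_div_assoc] using this

lemma besselLogSeries_term_nonneg {T x : ℝ} (hT : 0 ≤ T) (h0 : 0 ≤ x) (i : ℕ) :
    0 ≤ logBessel (T * x ^ (i + 1)) / (i + 1) :=
  div_nonneg (logBessel_nonneg (by positivity)) (by positivity)

lemma summable_besselLogSeries {T x : ℝ} (hT : 0 ≤ T) (h0 : 0 ≤ x) (h1 : x ≤ 1 / 2) :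
    Summable fun i : ℕ => logBessel (T * x ^ (i + 1)) / (i + 1) := by
  refine Summable.of_nonneg_of_le (besselLogSeries_term_nonneg hT h0) (fun i => ?_)
    (hasSum_mul_pow_div (T := T) h0 h1).summable
  gcongr
  exact logBessel_le_self (by positivity)

lemma besselLogSeries_le {T x : ℝ} (hT : 0 ≤ T) (h0 : 0 ≤ x) (h1 : x ≤ 1 / 2) :
    besselLogSeries T x ≤ T * -Real.log (1 - x) := by
  refine (summable_besselLogSeries hT h0 h1).tsum_le_of_sum_le fun s => ?_
  refine (Finset.sum_le_sum fun i _ => ?_).trans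
    (sum_le_hasSum s (fun i _ => ?_) (hasSum_mul_pow_div (T := T) h0 h1))
  · gcongr
    exact logBessel_le_self (by positivity)
  · positivity

/-- The deficit `t - log I₀(t) = O(√t)`, summed over `t = T x^(i+1)`, is dominated by a geometric
series of ratio `√x ≤ 3/4`. -/
lemma exists_sub_besselLogSeries_le : ∃ C : ℝ, 0 < C ∧ ∀ T x : ℝ, 0 ≤ T → 0 ≤ x → x ≤ 1 / 2 →
    T * -Real.log (1 - x) - besselLogSeries T x ≤ C * √T := by
  obtain ⟨C, hC, h⟩ := exists_self_sub_logBessel_le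
  refine ⟨4 * C, by positivity, fun T x hT h0 h1 => ?_⟩
  have hs : √x ≤ 3 / 4 := by
    rw [Real.sqrt_le_left (by norm_num)]; linarith
  have hs0 := Real.sqrt_nonneg x
  have hg := (hasSum_geometric_of_lt_one hs0 (by linarith)).mul_left (C * √T)
  have h2 := (hasSum_mul_pow_div (T := T) h0 h1).sub (summable_besselLogSeries hT h0 h1).hasSum
  refine (hasSum_le (fun i => ?_) h2 hg).trans ?_
  · rw [← sub_div]
    refine (div_le_self ?_ (by linarith [i.cast_nonneg (α := ℝ)])).trans ((h _ (by positivity)).trans ?_)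
    · exact sub_nonneg.mpr (logBessel_le_self (by positivity))
    · rw [Real.sqrt_mul hT, mul_assoc]
      gcongr
      have e : √(x ^ (i + 1)) = √x ^ (i + 1) := by
        rw [Real.sqrt_eq_iff_mul_self_eq (by positivity) (by positivity), ← mul_pow,
          Real.mul_self_sqrt h0]
      rw [e]
      exact pow_le_pow_of_le_one hs0 (by linarith) (Nat.le_succ i)
  · have : (1 - √x)⁻¹ ≤ 4 := by
      rw [inv_le_comm₀ (by linarith) (by norm_num)]; linarith
    calc _ ≤ C * √T * 4 := by gcongr
      _ = _ := by ring

lemma logBessel_le_besselLogSeries {T x : ℝ} (hT : 0 ≤ T) (h0 : 0 ≤ x) (h1 : x ≤ 1 / 2) :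
    logBessel (T * x) ≤ besselLogSeries T x := by
  have := (summable_besselLogSeries hT h0 h1).le_tsum 0
    fun i _ => besselLogSeries_term_nonneg hT h0 i
  simpa [besselLogSeries] using this

lemma besselLogSeries_le_add {T x : ℝ} (hT : 0 ≤ T) (h0 : 0 ≤ x) (h1 : x ≤ 1 / 2) :
    besselLogSeries T x ≤ logBessel (T * x) + T * x ^ 2 := by
  have hs := summable_besselLogSeries hT h0 h1
  rw [besselLogSeries, hs.tsum_eq_zero_add]
  have hg := (hasSum_geometric_of_lt_one h0 (by linarith)).mul_left (T * x ^ 2 / 2)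
  have h2 : ∑' i : ℕ, logBessel (T * x ^ (i + 1 + 1)) / ((i + 1 : ℕ) + 1) ≤ T * x ^ 2 := by
    refine (hasSum_le (fun i => ?_) ((summable_nat_add_iff 1).mpr hs).hasSum hg).trans ?_
    · have h3 := logBessel_le_self (t := T * x ^ (i + 1 + 1)) (by positivity)
      have h4 : (2 : ℝ) ≤ ((i + 1 : ℕ) + 1 : ℝ) := by
        push_cast; linarith [i.cast_nonneg (α := ℝ)]
      calc _ ≤ T * x ^ (i + 1 + 1) / 2 := by gcongr
        _ = _ := by ring
    · have : (1 - x)⁻¹ ≤ 2 := by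
        rw [inv_le_comm₀ (by linarith) (by norm_num)]; linarith
      calc _ ≤ T * x ^ 2 / 2 * 2 := by gcongr
        _ = _ := by ring
  simp only [zero_add, pow_one, Nat.cast_zero, div_one]
  linarith

lemma log_localFactor_le (j : ℕ) {x : ℝ} (h0 : 0 ≤ x) (h1 : x ≤ 1 / 2) :
    Real.log (localFactor j x) ≤ 2 * (j + 1) * -Real.log (1 - x) := by
  have hB := one_le_localFactor j h0 (by linarith : x < 1)
  have := Real.log_le_log (by linarith) (localFactor_le_pow j h0 (by linarith : x < 1))
  rw [Real.log_pow, one_div, Real.log_inv] at this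
  exact_mod_cast this

lemma le_log_localFactor (j : ℕ) {x : ℝ} (h0 : 0 ≤ x) (h1 : x ≤ 1 / 2) :
    2 * (j + 1) * -Real.log (1 - x) - Real.log (4 * j + 32) ≤ Real.log (localFactor j x) := by
  have hB := one_le_localFactor j h0 (by linarith : x < 1)
  have hx : 0 < 1 - x := by linarith
  have := Real.log_le_log (by positivity) (pow_le_localFactor j h0 h1)
  rw [Real.log_pow, one_div, Real.log_inv, Real.log_mul (by positivity) (by linarith)] at this
  push_cast at this
  linarith

lemma log_add_le_sqrt (j : ℕ) : Real.log (4 * j + 32) ≤ 8 * √(2 * (j + 1)) := by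
  have hT : (0 : ℝ) < 2 * (j + 1) := by positivity
  have h7 : Real.log (4 * j + 32) ≤ Real.log ((4 * √(2 * (j + 1))) ^ 2) := by
    refine Real.log_le_log (by positivity) ?_
    rw [mul_pow, Real.sq_sqrt hT.le]
    linarith [j.cast_nonneg (α := ℝ)]
  rw [Real.log_pow] at h7
  have h8 := Real.log_le_self (show 0 ≤ 4 * √(2 * ((j : ℝ) + 1)) by positivity)
  push_cast at h7
  linarith

/-- Two bounds hold for the difference: `O(√T)`, both quantities being close to `-T log(1 - x)`, and
`T x²`, both being close to `log I₀(T x)`. The first is not summable over primes and the second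
saves nothing in `T`. Their geometric mean with weights `1/4` and `3/4` does both. -/
lemma exists_abs_log_localFactor_sub_le : ∃ A : ℝ, 1 ≤ A ∧ ∀ (j : ℕ) (x : ℝ), 0 ≤ x → x ≤ 1 / 2 →
    |Real.log (localFactor j x) - besselLogSeries (2 * (j + 1)) x|
      ≤ A * (2 * (j + 1)) ^ (7 / 8 : ℝ) * x ^ (3 / 2 : ℝ) := by
  obtain ⟨C, hC, h⟩ := exists_sub_besselLogSeries_le
  refine ⟨C + 8, by linarith, fun j x h0 h1 => ?_⟩
  set T : ℝ := 2 * (j + 1) with hTdef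
  have hT : 0 < T := by positivity
  have hB := one_le_localFactor j h0 (by linarith : x < 1)
  set D := |Real.log (localFactor j x) - besselLogSeries T x| with hD
  have hD0 : 0 ≤ D := abs_nonneg _
  have b1 : D ≤ (C + 8) * √T := by
    have u1 := log_localFactor_le j h0 h1
    have u2 := le_log_localFactor j h0 h1
    have u3 := log_add_le_sqrt j
    have u4 := besselLogSeries_le hT.le h0 h1
    have u5 := h T x hT.le h0 h1
    have : 0 ≤ C * √T := by positivity
    have : 0 ≤ √T := by positivity
    rw [hD, abs_le]
    rw [← hTdef] at u1 u2 u3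
    constructor <;> linarith
  have b2 : D ≤ T * x ^ 2 := by
    have u1 := Real.log_le_log (by linarith) (localFactor_le_besselI0 j h0 h1)
    rw [Real.log_mul (besselI0_pos _).ne' (Real.exp_ne_zero _), Real.log_exp] at u1
    have u2 := Real.log_le_log (besselI0_pos _) (besselI0_le_localFactor j h0 (by linarith : x < 1))
    rw [← hTdef] at u1 u2
    change _ ≤ logBessel (T * x) + _ at u1
    change logBessel (T * x) ≤ _ at u2
    have u3 := logBessel_le_besselLogSeries hT.le h0 h1
    have u4 := besselLogSeries_le_add hT.le h0 h1
    rw [hD, abs_le]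
    constructor <;> linarith
  have e1 : D = D ^ (1 / 4 : ℝ) * D ^ (3 / 4 : ℝ) := by
    rw [← Real.rpow_add_of_nonneg hD0 (by norm_num) (by norm_num)]; norm_num
  calc D = D ^ (1 / 4 : ℝ) * D ^ (3 / 4 : ℝ) := e1
    _ ≤ ((C + 8) * √T) ^ (1 / 4 : ℝ) * (T * x ^ 2) ^ (3 / 4 : ℝ) := by gcongr
    _ = (C + 8) ^ (1 / 4 : ℝ) * T ^ (7 / 8 : ℝ) * x ^ (3 / 2 : ℝ) := by
        rw [Real.mul_rpow (by positivity) (by positivity), Real.mul_rpow hT.le (by positivity),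
          Real.sqrt_eq_rpow, ← Real.rpow_mul hT.le, ← Real.rpow_natCast, ← Real.rpow_mul h0,
          show (7 / 8 : ℝ) = 1 / 2 * (1 / 4) + 3 / 4 by norm_num, Real.rpow_add hT]
        norm_num
        ring
    _ ≤ _ := by
        gcongr
        calc (C + 8) ^ (1 / 4 : ℝ) ≤ (C + 8) ^ (1 : ℝ) :=
              Real.rpow_le_rpow_of_exponent_le (by linarith) (by norm_num)
          _ = _ := Real.rpow_one _

lemma one_div_prime_le (p : Nat.Primes) : (1 : ℝ) / (p : ℕ) ≤ 1 / 2 :=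
  one_div_le_one_div_of_le two_pos (by exact_mod_cast p.2.two_le)

lemma summable_log_localFactor (j : ℕ) :
    Summable fun p : Nat.Primes => Real.log (localFactor j (1 / (p : ℕ))) := by
  have hs : Summable fun p : Nat.Primes => ((p : ℕ) : ℝ) ^ (-2 : ℝ) :=
    Nat.Primes.summable_rpow.mpr (by norm_num)
  refine Summable.of_nonneg_of_le (fun p => Real.log_nonneg
    (one_le_localFactor j (by positivity) ((one_div_prime_le p).trans_lt (by norm_num))))
    (fun p => ?_) (hs.mul_left ((2 * ((j : ℝ) + 1)) ^ 2 + 2 * ((j : ℝ) + 1)))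
  have h0 : (0 : ℝ) ≤ 1 / (p : ℕ) := by positivity
  have hB := one_le_localFactor j h0 ((one_div_prime_le p).trans_lt (by norm_num))
  have u1 := Real.log_le_log (by linarith) (localFactor_le_besselI0 j h0 (one_div_prime_le p))
  rw [Real.log_mul (besselI0_pos _).ne' (Real.exp_ne_zero _), Real.log_exp] at u1
  have u2 := logBessel_le_sq (t := 2 * (j + 1) * (1 / (p : ℕ))) (by positivity)
  unfold logBessel at u2
  refine u1.trans ((add_le_add u2 le_rfl).trans_eq ?_)
  rw [Real.rpow_neg (by positivity), Real.rpow_two]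
  field_simp

lemma tsum_logBessel_eq_tsum_primes {k : ℝ} (hk : 0 < k) :
    ∑' n : ℕ, Λ n / Real.log n * logBessel (2 * k / n)
      = ∑' p : Nat.Primes, besselLogSeries (2 * k) (1 / (p : ℕ)) := by
  rw [tsum_eq_tsum_primes_of_support_subset_prime_powers (hasSum_logBessel hk).summable]
  · refine tsum_congr fun p => tsum_congr fun i => ?_
    have hl : Real.log (p : ℕ) ≠ 0 := (Real.log_pos (by exact_mod_cast p.2.one_lt)).ne'
    rw [vonMangoldt_apply_pow (Nat.succ_ne_zero i), vonMangoldt_apply_prime p.2]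
    push_cast
    rw [Real.log_pow, one_div, inv_pow, ← div_eq_mul_inv]
    push_cast
    field_simp
  · intro n hn
    rw [Function.mem_support] at hn
    have h1 : Λ n ≠ 0 := fun h => hn (by rw [h, zero_div, zero_mul])
    exact vonMangoldt_ne_zero_iff.mp h1

/-- The logarithm of the odd divisor series in terms of the main prime sum. -/
lemma exists_abs_log_oddDivisorSeries_sub_le : ∃ A : ℝ, 0 ≤ A ∧ ∀ j : ℕ,
    0 < oddDivisorSeries (j + 1) ∧
    |Real.log (oddDivisorSeries (j + 1))
      - ((∑' n : ℕ, Λ n / Real.log n * logBessel (2 * (j + 1) / n)) - 2 * (j + 1) * Real.log 2)|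
      ≤ A * (2 * (j + 1)) ^ (7 / 8 : ℝ) := by
  obtain ⟨A, hA, h⟩ := exists_abs_log_localFactor_sub_le
  have hs : Summable fun p : Nat.Primes => ((p : ℕ) : ℝ) ^ (-(3 / 2) : ℝ) :=
    Nat.Primes.summable_rpow.mpr (by norm_num)
  set Z := ∑' p : Nat.Primes, ((p : ℕ) : ℝ) ^ (-(3 / 2) : ℝ)
  have hZ : 0 ≤ Z := tsum_nonneg fun p => by positivity
  refine ⟨A * Z + 8, by positivity, fun j => ?_⟩
  set T : ℝ := 2 * (j + 1) with hTdef
  have hT : 2 ≤ T := by linarith [j.cast_nonneg (α := ℝ)]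
  have hpt : ∀ p : Nat.Primes, ‖Real.log (localFactor j (1 / (p : ℕ)))
      - besselLogSeries T (1 / (p : ℕ))‖ ≤ A * T ^ (7 / 8 : ℝ) * ((p : ℕ) : ℝ) ^ (-(3 / 2) : ℝ) := by
    intro p
    refine (h j _ (by positivity) (one_div_prime_le p)).trans_eq ?_
    rw [one_div, Real.inv_rpow (by positivity), Real.rpow_neg (by positivity)]
  have hsD := Summable.of_norm_bounded (hs.mul_left _) hpt
  have hsℓ := summable_log_localFactor j
  have hsum : |∑' p : Nat.Primes, Real.log (localFactor j (1 / (p : ℕ)))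
      - ∑' n : ℕ, Λ n / Real.log n * logBessel (T / n)| ≤ A * T ^ (7 / 8 : ℝ) * Z := by
    have hsb : Summable fun p : Nat.Primes => besselLogSeries T (1 / (p : ℕ)) :=
      (hsℓ.sub hsD).congr fun p => by ring
    rw [hTdef, tsum_logBessel_eq_tsum_primes (by positivity), ← hTdef, ← hsℓ.tsum_sub hsb]
    exact tsum_of_norm_bounded (hs.hasSum.mul_left _) hpt
  set p2 : Nat.Primes := ⟨2, Nat.prime_two⟩
  have hodd : HasSum (fun p : Nat.Primes => if (p : ℕ) = 2 then 0
      else Real.log (localFactor j (1 / (p : ℕ))))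
      (∑' p : Nat.Primes, Real.log (localFactor j (1 / (p : ℕ))) - Real.log (localFactor j (1 / 2))) := by
    have h1 := hsℓ.hasSum.update p2 0
    have e1 : (fun p : Nat.Primes => if (p : ℕ) = 2 then 0
        else Real.log (localFactor j (1 / (p : ℕ))))
        = Function.update (fun p : Nat.Primes => Real.log (localFactor j (1 / (p : ℕ)))) p2 0 := by
      funext p
      by_cases hp : p = p2
      · rw [hp, Function.update_self, if_pos rfl]
      · rw [Function.update_of_ne hp, if_neg fun h => hp (Subtype.ext h)]
    have e2 : ((p2 : ℕ) : ℝ) = 2 := by norm_num [p2]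
    rw [e1]
    rwa [e2, zero_sub, neg_add_eq_sub] at h1
  have hexp := hodd.rexp.unique (by
    convert hasProd_oddDivisorSeries j using 2 with p
    simp only [Function.comp]
    split_ifs
    · exact Real.exp_zero
    · rw [Real.exp_log]
      linarith [one_le_localFactor j (x := 1 / (p : ℕ)) (by positivity)
        ((one_div_prime_le p).trans_lt (by norm_num))])
  rw [← hexp, Real.log_exp]
  refine ⟨Real.exp_pos _, ?_⟩
  -- The prime `2` occurs in the prime sum but not in the odd series. Its local factor has logarithm
  -- `T log 2 + O(√T)`, which is the subtracted main term.
  have u1 := log_localFactor_le j (x := 1 / 2) (by norm_num) le_rfl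
  have u2 := le_log_localFactor j (x := 1 / 2) (by norm_num) le_rfl
  have u3 := log_add_le_sqrt j
  rw [show (1 - 1 / 2 : ℝ) = 2⁻¹ by norm_num, Real.log_inv, neg_neg, ← hTdef] at u1 u2
  rw [← hTdef] at u3
  have u4 : √T ≤ T ^ (7 / 8 : ℝ) := by
    rw [Real.sqrt_eq_rpow]
    exact Real.rpow_le_rpow_of_exponent_le (by linarith) (by norm_num)
  have u5 : (A * Z + 8) * T ^ (7 / 8 : ℝ) = A * T ^ (7 / 8 : ℝ) * Z + 8 * T ^ (7 / 8 : ℝ) := by ring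
  have u6 := abs_le.mp hsum
  have u7 : 0 ≤ T ^ (7 / 8 : ℝ) := by positivity
  rw [u5, abs_le]
  constructor <;> linarith

/-! ### The size of `E_k` -/

/-- The error term `E_k` of the main theorem. -/
noncomputable def momentError (k : ℕ) : ℝ :=
  Real.log k / (2 * k) * (Real.log (oddDivisorSeries k) - Real.log 2 + 2 * k * Real.log 2
    - 2 * k * Real.eulerMascheroniConstant - 2 * k * Real.log (Real.log k)) - constA

/-- An identity by design: `momentError` is obtained by solving it, so nothing asymptotic happens
here. -/
lemma oddDivisorSeries_eq {k : ℕ} (hk : 2 ≤ k) :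
    1 / 2 * (2 / Real.pi) ^ (2 * k) * oddDivisorSeries k
      = (Real.exp Real.eulerMascheroniConstant / Real.pi) ^ (2 * k) * Real.log k ^ (2 * k)
        * Real.exp (2 * (k : ℝ) / Real.log k * (constA + momentError k)) := by
  obtain ⟨A, -, h⟩ := exists_abs_log_oddDivisorSeries_sub_le
  obtain ⟨j, rfl⟩ : ∃ j, k = j + 1 := ⟨k - 1, by omega⟩
  have hD := (h j).1
  set k := j + 1
  have hl : 0 < Real.log k := Real.log_pos (by exact_mod_cast (by omega : 1 < k))
  have hk0 : (0 : ℝ) < k := by exact_mod_cast (by omega : 0 < k)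
  have e1 : 2 * (k : ℝ) / Real.log k * (constA + momentError k)
      = Real.log (oddDivisorSeries k) - Real.log 2 + (2 * k : ℕ) * Real.log 2
        - (2 * k : ℕ) * Real.eulerMascheroniConstant - (2 * k : ℕ) * Real.log (Real.log k) := by
    unfold momentError
    push_cast
    field_simp
    ring
  rw [e1, Real.exp_sub, Real.exp_sub, Real.exp_add, Real.exp_sub, Real.exp_log hD,
    Real.exp_log two_pos, Real.exp_nat_mul, Real.exp_nat_mul, Real.exp_nat_mul, Real.exp_log hl,
    Real.exp_log two_pos, div_pow, div_pow]
  field_simp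

/-- The claim amounts to a remainder of size `O(k/log² k)` in `log D_k`. The prime sum supplies
exactly this, and the `k^(7/8)` of the Euler product is smaller. The prime sum estimate needs `k ≥
e²`; the finitely many `k < 8` are put into the constant. -/
lemma exists_abs_momentError_le : ∃ C : ℝ, ∀ k : ℕ, 2 ≤ k → |momentError k| ≤ C / Real.log k := by
  obtain ⟨A, hA, h⟩ := exists_abs_log_oddDivisorSeries_sub_le
  obtain ⟨C, h'⟩ := exists_abs_tsum_logBessel_sub_le
  refine ⟨(∑ k ∈ Finset.range 8, |momentError k| * Real.log k) + (256 + 256 * A + |C|), fun k hk => ?_⟩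
  have hl : 0 < Real.log k := Real.log_pos (by exact_mod_cast (by omega : 1 < k))
  have hk0 : (0 : ℝ) < k := by exact_mod_cast (by omega : 0 < k)
  have hk1 : (1 : ℝ) ≤ k := by exact_mod_cast (by omega : 1 ≤ k)
  rw [le_div_iff₀ hl]
  have hterm : ∀ k ∈ Finset.range 8, 0 ≤ |momentError k| * Real.log k := fun k _ =>
    mul_nonneg (abs_nonneg _) (Real.log_natCast_nonneg k)
  rcases lt_or_ge k 8 with hk8 | hk8
  · have h1 := Finset.single_le_sum hterm (Finset.mem_range.mpr hk8)
    have h2 := abs_nonneg C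
    linarith
  have h8 : Real.exp 2 ≤ k := by
    have h1 : Real.exp 2 ≤ 8 := by
      have := Real.exp_one_lt_d9
      have e : Real.exp 2 = Real.exp 1 * Real.exp 1 := by rw [← Real.exp_add]; norm_num
      rw [e]
      nlinarith [Real.exp_pos 1]
    exact h1.trans (by exact_mod_cast hk8)
  have b1 := h' k h8
  obtain ⟨j, hj⟩ : ∃ j, k = j + 1 := ⟨k - 1, by omega⟩
  have b2 := (h j).2
  have hj' : (j : ℝ) + 1 = k := by rw [hj]; push_cast; rfl
  rw [← hj, hj'] at b2
  set W := ∑' n : ℕ, Λ n / Real.log n * logBessel (2 * k / n)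
  set R := Real.log (oddDivisorSeries k) - Real.log 2 + 2 * k * Real.log 2
    - 2 * k * Real.eulerMascheroniConstant - 2 * k * Real.log (Real.log k)
    - 2 * k * (constA / Real.log k) with hR
  have hE : momentError k * Real.log k = Real.log k ^ 2 / (2 * k) * R := by
    unfold momentError
    rw [hR]
    field_simp
  have hlog2 : 0 < Real.log 2 := Real.log_pos one_lt_two
  have hlog2' : Real.log 2 < 1 := by linarith [Real.log_two_lt_d9]
  have hRle : |R| ≤ 1 + A * (2 * k) ^ (7 / 8 : ℝ) + |C| * k / Real.log k ^ 2 := by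
    have hC : C * k / Real.log k ^ 2 ≤ |C| * k / Real.log k ^ 2 := by
      gcongr; exact le_abs_self C
    have b1' := abs_le.mp (b1.trans hC)
    have b2' := abs_le.mp b2
    rw [hR, abs_le]
    constructor <;> nlinarith [b1'.1, b1'.2, b2'.1, b2'.2]
  have hlsq : Real.log k ^ 2 ≤ 256 * (k : ℝ) ^ (1 / 8 : ℝ) := by
    have h1 := Real.log_le_rpow_div hk0.le (show (0 : ℝ) < 1 / 16 by norm_num)
    calc Real.log k ^ 2 ≤ ((k : ℝ) ^ (1 / 16 : ℝ) / (1 / 16)) ^ 2 := by gcongr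
      _ = 256 * ((k : ℝ) ^ (1 / 16 : ℝ)) ^ 2 := by ring
      _ = _ := by
        rw [← Real.rpow_natCast, ← Real.rpow_mul hk0.le]; norm_num
  have hlsq1 : Real.log k ^ 2 / (2 * k) ≤ 256 := by
    rw [div_le_iff₀ (by positivity)]
    have : (k : ℝ) ^ (1 / 8 : ℝ) ≤ k := by
      calc _ ≤ (k : ℝ) ^ (1 : ℝ) := Real.rpow_le_rpow_of_exponent_le hk1 (by norm_num)
        _ = _ := Real.rpow_one _
    linarith
  have hlsq2 : Real.log k ^ 2 / (2 * k) * (2 * k) ^ (7 / 8 : ℝ) ≤ 256 := by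
    have e : (2 * (k : ℝ)) = (2 * k) ^ (7 / 8 : ℝ) * (2 * k) ^ (1 / 8 : ℝ) := by
      rw [← Real.rpow_add (by positivity)]; norm_num
    rw [div_mul_eq_mul_div, div_le_iff₀ (by positivity)]
    conv_rhs => rw [e]
    have : (k : ℝ) ^ (1 / 8 : ℝ) ≤ (2 * (k : ℝ)) ^ (1 / 8 : ℝ) := by
      gcongr; linarith
    calc _ ≤ 256 * (2 * (k : ℝ)) ^ (1 / 8 : ℝ) * (2 * k) ^ (7 / 8 : ℝ) := by gcongr; linarith
      _ = _ := by ring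
  have hlsq3 : Real.log k ^ 2 / (2 * k) * (|C| * k / Real.log k ^ 2) ≤ |C| := by
    have : Real.log k ^ 2 / (2 * k) * (|C| * k / Real.log k ^ 2) = |C| / 2 := by field_simp
    rw [this]
    linarith [abs_nonneg C]
  have hsum := Finset.sum_nonneg hterm
  calc |momentError k| * Real.log k = |momentError k * Real.log k| := by
        rw [abs_mul, abs_of_pos hl]
    _ = Real.log k ^ 2 / (2 * k) * |R| := by
        rw [hE, abs_mul, abs_of_nonneg (by positivity)]
    _ ≤ Real.log k ^ 2 / (2 * k) * (1 + A * (2 * k) ^ (7 / 8 : ℝ) + |C| * k / Real.log k ^ 2) := by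
        gcongr
    _ = Real.log k ^ 2 / (2 * k) + A * (Real.log k ^ 2 / (2 * k) * (2 * k) ^ (7 / 8 : ℝ))
        + Real.log k ^ 2 / (2 * k) * (|C| * k / Real.log k ^ 2) := by ring
    _ ≤ 256 + A * 256 + |C| := by gcongr
    _ ≤ _ := by linarith

/-! ### Powers of the odd character sum, and orthogonality of odd characters -/

lemma mul_sum_Icc_eq_sum_mul {f g : ArithmeticFunction ℝ} {A B : ℕ} (hf : ∀ n, A < n → f n = 0)
    (hg : ∀ n, B < n → g n = 0) {w : ℕ → ℂ} (hw : ∀ m n, w (m * n) = w m * w n) :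
    (∑ a ∈ Finset.Icc 1 A, (f a : ℂ) * w a) * ∑ b ∈ Finset.Icc 1 B, (g b : ℂ) * w b
      = ∑ n ∈ Finset.Icc 1 (A * B), ((f * g) n : ℂ) * w n := by
  rw [Finset.sum_mul_sum, ← Finset.sum_product']
  rw [← Finset.sum_fiberwise_of_maps_to (t := Finset.Icc 1 (A * B)) (g := fun x : ℕ × ℕ => x.1 * x.2)]
  · refine Finset.sum_congr rfl fun n hn => ?_
    rw [Finset.mem_Icc] at hn
    rw [mul_apply]
    push_cast
    rw [Finset.sum_mul]
    refine (Finset.sum_subset (fun x hx => ?_) fun x hx hx' => ?_).trans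
      (Finset.sum_congr rfl fun x hx => ?_)
    · rw [Finset.mem_filter] at hx
      exact Nat.mem_divisorsAntidiagonal.mpr ⟨hx.2, by omega⟩
    · obtain ⟨h1, h2⟩ := Nat.mem_divisorsAntidiagonal.mp hx
      have hx1 : 1 ≤ x.1 := Nat.pos_of_ne_zero fun h => by rw [h, zero_mul] at h1; omega
      have hx2 : 1 ≤ x.2 := Nat.pos_of_ne_zero fun h => by rw [h, mul_zero] at h1; omega
      by_cases hA : A < x.1
      · simp [hf _ hA]
      by_cases hB : B < x.2
      · simp [hg _ hB]
      exact absurd (Finset.mem_filter.mpr ⟨Finset.mem_product.mpr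
        ⟨Finset.mem_Icc.mpr ⟨hx1, not_lt.mp hA⟩, Finset.mem_Icc.mpr ⟨hx2, not_lt.mp hB⟩⟩, h1⟩) hx'
    · rw [← (Nat.mem_divisorsAntidiagonal.mp hx).1, hw]; ring
  · intro x hx
    simp only [Finset.mem_product, Finset.mem_Icc] at hx ⊢
    exact ⟨Nat.mul_pos hx.1.1 hx.2.1, Nat.mul_le_mul hx.1.2 hx.2.2⟩

lemma pow_apply_eq_zero_of_lt {f : ArithmeticFunction ℝ} {A : ℕ} (hf : ∀ n, A < n → f n = 0)
    (k n : ℕ) (hn : A ^ k < n) : (f ^ k) n = 0 := by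
  induction k generalizing n with
  | zero =>
    rw [pow_zero, one_apply, if_neg]
    rw [pow_zero] at hn; omega
  | succ k ih =>
    rw [pow_succ, mul_apply]
    refine Finset.sum_eq_zero fun x hx => ?_
    by_cases h1 : A ^ k < x.1
    · rw [ih _ h1, zero_mul]
    by_cases h2 : A < x.2
    · rw [hf _ h2, mul_zero]
    have h3 := Nat.mul_le_mul (not_lt.mp h1) (not_lt.mp h2)
    rw [(Nat.mem_divisorsAntidiagonal.mp hx).1, ← pow_succ] at h3
    omega

lemma sum_Icc_pow_eq {f : ArithmeticFunction ℝ} {A : ℕ} (hf : ∀ n, A < n → f n = 0)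
    {w : ℕ → ℂ} (h1 : w 1 = 1) (hw : ∀ m n, w (m * n) = w m * w n) (k : ℕ) :
    (∑ a ∈ Finset.Icc 1 A, (f a : ℂ) * w a) ^ k
      = ∑ n ∈ Finset.Icc 1 (A ^ k), ((f ^ k) n : ℂ) * w n := by
  induction k with
  | zero => simp [h1]
  | succ k ih =>
    rw [pow_succ, ih, mul_sum_Icc_eq_sum_mul (pow_apply_eq_zero_of_lt hf k) hf hw, pow_succ, pow_succ]

/-- The partial sum `∑_{m < N odd} χ(m) / m`. -/
noncomputable def oddCharSum {q : ℕ} (N : ℕ) (χ : DirichletCharacter ℂ q) : ℂ :=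
  ∑ m ∈ Finset.Icc 1 N, (oddIndicatorBelow N m : ℂ) * (χ (m : ZMod q) / m)

lemma oddCharSum_pow {q : ℕ} (N : ℕ) (χ : DirichletCharacter ℂ q) (k : ℕ) :
    oddCharSum N χ ^ k = ∑ n ∈ Finset.Icc 1 (N ^ k),
      (((oddIndicatorBelow N ^ k) n / n : ℝ) : ℂ) * χ (n : ZMod q) := by
  rw [oddCharSum, sum_Icc_pow_eq (fun n hn => ?_) (by simp) (fun m n => by
    push_cast; rw [map_mul, mul_div_mul_comm])]
  · refine Finset.sum_congr rfl fun n _ => ?_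
    push_cast
    ring
  · rw [oddIndicatorBelow_apply, if_neg]
    omega

section Orthogonality

-- The indicator of oddness is `(1 - χ(-1))/2`, so full orthogonality is applied at `a` and at `-a`;
-- the condition `b = -a` comes with a minus sign.
open Classical in
lemma sum_odd_mul_conj {q : ℕ} [Fact q.Prime] (a b : ZMod q) :
    ∑ χ : DirichletCharacter ℂ q, (if χ.Odd then χ a * (starRingEnd ℂ) (χ b) else 0)
      = (q.totient : ℂ) / 2 * (if b ≠ 0 then (if b = a then 1 else 0) - (if b = -a then 1 else 0) else 0) := by
  by_cases hb : b = 0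
  · rw [if_neg (not_not.mpr hb), mul_zero]
    refine Finset.sum_eq_zero fun χ _ => ?_
    simp [hb, MulChar.map_nonunit]
  rw [if_pos hb]
  have hbu : IsUnit b := isUnit_iff_ne_zero.mpr hb
  have hterm : ∀ χ : DirichletCharacter ℂ q, (if χ.Odd then χ a * (starRingEnd ℂ) (χ b) else 0)
      = (χ b⁻¹ * χ a) / 2 - (χ b⁻¹ * χ (-a)) / 2 := by
    intro χ
    have h1 : (starRingEnd ℂ) (χ b) = χ b⁻¹ := by
      have := MulChar.star_apply' χ b
      rwa [MulChar.inv_apply'] at this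
    rw [h1, ← neg_one_mul a, map_mul χ (-1) a]
    rcases χ.even_or_odd with h | h
    · have hno : ¬ χ.Odd := fun h' => by
        rw [DirichletCharacter.Even] at h
        rw [DirichletCharacter.Odd, h] at h'
        norm_num at h'
      rw [if_neg hno, h]; ring
    · rw [if_pos h, h]; ring
  rw [Finset.sum_congr rfl fun χ _ => hterm χ, Finset.sum_sub_distrib, ← Finset.sum_div,
    ← Finset.sum_div, DirichletCharacter.sum_char_inv_mul_char_eq ℂ hbu,
    DirichletCharacter.sum_char_inv_mul_char_eq ℂ hbu]
  split_ifs <;> ring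

open Classical in
lemma sum_odd_norm_sq {q : ℕ} [Fact q.Prime] (S : Finset ℕ) (a : ℕ → ℝ) :
    1 / (q.totient : ℝ) * ∑ χ : DirichletCharacter ℂ q,
        (if χ.Odd then ‖∑ n ∈ S, (a n : ℂ) * χ (n : ZMod q)‖ ^ 2 else 0)
      = 1 / 2 * ∑ m ∈ S, ∑ n ∈ S, a m * a n * (if (n : ZMod q) ≠ 0 then
        (if (n : ZMod q) = m then 1 else 0) - (if (n : ZMod q) = -m then 1 else 0) else 0) := by
  have hφ : (q.totient : ℂ) ≠ 0 := by
    exact_mod_cast (Nat.totient_pos.mpr (Fact.out : q.Prime).pos).ne'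
  have hterm : ∀ χ : DirichletCharacter ℂ q,
      (((if χ.Odd then ‖∑ n ∈ S, (a n : ℂ) * χ (n : ZMod q)‖ ^ 2 else 0 : ℝ)) : ℂ)
      = ∑ m ∈ S, ∑ n ∈ S, (a m : ℂ) * a n *
        (if χ.Odd then χ (m : ZMod q) * (starRingEnd ℂ) (χ (n : ZMod q)) else 0) := by
    intro χ
    split_ifs
    · rw [Complex.ofReal_pow, ← Complex.mul_conj', map_sum, Finset.sum_mul_sum]
      refine Finset.sum_congr rfl fun m _ => Finset.sum_congr rfl fun n _ => ?_
      rw [map_mul, Complex.conj_ofReal]; ring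
    · simp
  have h1 : ((∑ χ : DirichletCharacter ℂ q,
      (if χ.Odd then ‖∑ n ∈ S, (a n : ℂ) * χ (n : ZMod q)‖ ^ 2 else 0 : ℝ) : ℝ) : ℂ)
      = ∑ m ∈ S, ∑ n ∈ S, (a m : ℂ) * a n * ((q.totient : ℂ) / 2 * (if (n : ZMod q) ≠ 0 then
        (if (n : ZMod q) = m then 1 else 0) - (if (n : ZMod q) = -m then 1 else 0) else 0)) := by
    rw [Complex.ofReal_sum, Finset.sum_congr rfl fun χ _ => hterm χ, Finset.sum_comm]
    refine Finset.sum_congr rfl fun m _ => ?_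
    rw [Finset.sum_comm]
    refine Finset.sum_congr rfl fun n _ => ?_
    rw [← Finset.mul_sum, sum_odd_mul_conj]
  apply Complex.ofReal_injective
  rw [Complex.ofReal_mul, h1]
  push_cast
  rw [Finset.mul_sum, Finset.mul_sum]
  refine Finset.sum_congr rfl fun m _ => ?_
  rw [Finset.mul_sum, Finset.mul_sum]
  refine Finset.sum_congr rfl fun n _ => ?_
  field_simp
  congr 1
  split_ifs <;> norm_num

end Orthogonality

/-! ### Diagonal and off-diagonal terms of the moment -/

lemma sum_inv_Icc_le (M : ℕ) : ∑ l ∈ Finset.Icc 1 M, (1 : ℝ) / l ≤ 1 + Real.log (M + 1) := by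
  have h := harmonic_le_one_add_log M
  rw [harmonic_eq_sum_Icc] at h
  push_cast at h
  simp_rw [one_div]
  refine h.trans ?_
  rcases Nat.eq_zero_or_pos M with rfl | hM
  · simp
  · have : (0 : ℝ) < M := by exact_mod_cast hM
    gcongr
    linarith

/-- The restriction `q ≤ 2n` removes the possibly small first member of the progression. Then `2n ≥
q(⌊n/q⌋ + 1)`, and the quotients `⌊n/q⌋` are distinct within a residue class, so a harmonic sum
divided by `q` remains. -/
lemma sum_inv_residue_le {q : ℕ} (hq : 0 < q) (M : ℕ) (r : ZMod q) :
    ∑ n ∈ (Finset.Icc 1 M).filter (fun n : ℕ => (n : ZMod q) = r ∧ q ≤ 2 * n), (1 : ℝ) / n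
      ≤ 2 / q * (1 + Real.log (M + 2)) := by
  set s := (Finset.Icc 1 M).filter (fun n : ℕ => (n : ZMod q) = r ∧ q ≤ 2 * n)
  have hmem : ∀ n ∈ s, 1 ≤ n ∧ n ≤ M ∧ (n : ZMod q) = r ∧ q ≤ 2 * n := fun n hn => by
    simpa [s, and_assoc] using hn
  have hinj : Set.InjOn (fun n : ℕ => n / q + 1) s := by
    intro n hn n' hn' h
    have h1 : n / q = n' / q := Nat.succ_injective h
    have h2 : n % q = n' % q := by
      have := (hmem n hn).2.2.1.trans (hmem n' hn').2.2.1.symm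
      exact (ZMod.natCast_eq_natCast_iff' _ _ _).mp this
    rw [← Nat.div_add_mod n q, ← Nat.div_add_mod n' q, h1, h2]
  have hq' : (0 : ℝ) < q := by exact_mod_cast hq
  calc _ ≤ ∑ n ∈ s, 2 / q * ((1 : ℝ) / ((n / q + 1 : ℕ) : ℝ)) := by
        refine Finset.sum_le_sum fun n hn => ?_
        obtain ⟨h1, -, -, h4⟩ := hmem n hn
        have h5 : q * (n / q + 1) ≤ 2 * n := by
          rcases Nat.eq_zero_or_pos (n / q) with h | h
          · rw [h]; omega
          · have h6 := Nat.mul_div_le n q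
            have h7 := Nat.mul_le_mul_left q h
            rw [mul_add]; omega
        have h5' : (q : ℝ) * ((n / q + 1 : ℕ) : ℝ) ≤ 2 * n := by exact_mod_cast h5
        have h6 : (0 : ℝ) < ((n / q + 1 : ℕ) : ℝ) := by positivity
        have h7 : (0 : ℝ) < n := by exact_mod_cast h1
        rw [div_mul_div_comm, mul_one, div_le_div_iff₀ h7 (by positivity)]
        linarith
    _ = 2 / q * ∑ l ∈ s.image (fun n : ℕ => n / q + 1), (1 : ℝ) / l := by
        rw [← Finset.mul_sum, Finset.sum_image hinj]
    _ ≤ 2 / q * ∑ l ∈ Finset.Icc 1 (M + 1), (1 : ℝ) / l := by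
        gcongr
        intro l hl
        obtain ⟨n, hn, rfl⟩ := Finset.mem_image.mp hl
        exact Finset.mem_Icc.mpr ⟨Nat.succ_pos _,
          Nat.succ_le_succ ((Nat.div_le_self n q).trans (hmem n hn).2.1)⟩
    _ ≤ _ := by
        have := sum_inv_Icc_le (M + 1)
        push_cast at this
        rw [show (M : ℝ) + 1 + 1 = M + 2 by ring] at this
        gcongr

lemma ite_or_and_or_le (A B P R : Prop) [Decidable A] [Decidable B] [Decidable P] [Decidable R] :
    (if (A ∨ B) ∧ (P ∨ R) then (1 : ℝ) else 0)
      ≤ ((if A ∧ P then 1 else 0) + if B ∧ P then 1 else 0)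
        + ((if A ∧ R then 1 else 0) + if B ∧ R then 1 else 0) := by
  by_cases hA : A <;> by_cases hB : B <;> by_cases hP : P <;> by_cases hR : R <;>
    simp only [hA, hB, hP, hR, or_true, or_false, and_true, and_false, if_true, if_false] <;>
    norm_num

lemma abs_ite_sub_ite_le {A B Z E X : Prop} [Decidable A] [Decidable B] [Decidable Z] [Decidable E]
    [Decidable X] (h1 : A → E → X) (h2 : B → X) (h3 : A → B → Z) :
    |if ¬ Z then (if A ∧ E then (1 : ℝ) else 0) - (if B then 1 else 0) else 0|
      ≤ if (A ∨ B) ∧ X then 1 else 0 := by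
  by_cases hZ : Z
  · rw [if_neg (not_not.mpr hZ), abs_zero]
    split_ifs <;> norm_num
  rw [if_pos hZ]
  by_cases hB : B
  · have hA : ¬ A := fun hA => hZ (h3 hA hB)
    rw [if_neg fun h => hA h.1, if_pos hB, if_pos ⟨Or.inr hB, h2 hB⟩]
    norm_num
  by_cases hAE : A ∧ E
  · rw [if_pos hAE, if_neg hB, if_pos ⟨Or.inl hAE.1, h1 hAE.1 hAE.2⟩]
    norm_num
  · rw [if_neg hAE, if_neg hB, sub_zero, abs_zero]
    split_ifs <;> norm_num

/-- The off-diagonal pairs `n ≡ ± m` contribute little. -/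
lemma sum_offDiag_le {q : ℕ} (hq : 0 < q) (M : ℕ) {a : ℕ → ℝ} (ha : ∀ n, 0 ≤ a n) {B : ℝ}
    (hB : ∀ n ∈ Finset.Icc 1 M, a n ≤ B / n) :
    ∑ m ∈ Finset.Icc 1 M, ∑ n ∈ Finset.Icc 1 M, a m * a n *
        (if ((n : ZMod q) = m ∨ (n : ZMod q) = -m) ∧ (q ≤ 2 * n ∨ q ≤ 2 * m) then 1 else 0)
      ≤ 8 * B ^ 2 / q * (1 + Real.log (M + 2)) ^ 2 := by
  set S := Finset.Icc 1 M
  -- `G m n` collects the pairs in which `n` is the large variable: it is summed over a residue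
  -- class, `m` freely. The other pairs are the transpose `G n m`.
  set G : ℕ → ℕ → ℝ := fun m n => a m * a n *
    ((if (n : ZMod q) = m ∧ q ≤ 2 * n then 1 else 0) + if (n : ZMod q) = -m ∧ q ≤ 2 * n then 1 else 0)
  have h1 : ∑ m ∈ S, ∑ n ∈ S, a m * a n *
        (if ((n : ZMod q) = m ∨ (n : ZMod q) = -m) ∧ (q ≤ 2 * n ∨ q ≤ 2 * m) then 1 else 0)
      ≤ ∑ m ∈ S, ∑ n ∈ S, G m n + ∑ m ∈ S, ∑ n ∈ S, G n m := by
    rw [← Finset.sum_add_distrib]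
    refine Finset.sum_le_sum fun m _ => ?_
    rw [← Finset.sum_add_distrib]
    refine Finset.sum_le_sum fun n _ => ?_
    have e : (m : ZMod q) = n ↔ (n : ZMod q) = m := eq_comm
    have e' : (m : ZMod q) = -n ↔ (n : ZMod q) = -m := by
      rw [eq_neg_iff_add_eq_zero, eq_neg_iff_add_eq_zero, add_comm]
    have h2 : 0 ≤ a m * a n := mul_nonneg (ha m) (ha n)
    simp only [G, e, e', mul_comm (a n) (a m), ← mul_add]
    exact mul_le_mul_of_nonneg_left (ite_or_and_or_le _ _ _ _) h2
  have hlog : 0 ≤ 1 + Real.log (M + 2) := by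
    have := Real.log_nonneg (by linarith [M.cast_nonneg (α := ℝ)] : (1 : ℝ) ≤ M + 2)
    linarith
  have hres : ∀ r : ZMod q, ∑ n ∈ S, (1 : ℝ) / n * (if (n : ZMod q) = r ∧ q ≤ 2 * n then 1 else 0)
      ≤ 2 / q * (1 + Real.log (M + 2)) := fun r => by
    refine le_trans (le_of_eq ?_) (sum_inv_residue_le hq M r)
    simp only [mul_ite, mul_one, mul_zero, S, ← Finset.sum_filter]
  have h3 : ∑ m ∈ S, ∑ n ∈ S, G m n ≤ 4 * B ^ 2 / q * (1 + Real.log (M + 2)) ^ 2 := by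
    calc ∑ m ∈ S, ∑ n ∈ S, G m n
        ≤ ∑ m ∈ S, ∑ n ∈ S, B ^ 2 * (1 / m * (1 / n *
          (if (n : ZMod q) = m ∧ q ≤ 2 * n then 1 else 0)
          + 1 / n * if (n : ZMod q) = -m ∧ q ≤ 2 * n then 1 else 0)) := by
          refine Finset.sum_le_sum fun m hm => Finset.sum_le_sum fun n hn => ?_
          have h4 : a m * a n ≤ B ^ 2 * (1 / m * (1 / n)) :=
            (mul_le_mul (hB m hm) (hB n hn) (ha n) ((ha m).trans (hB m hm))).trans_eq (by ring)
          rw [← mul_add, ← mul_assoc (1 / (m : ℝ)), ← mul_assoc (B ^ 2)]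
          refine mul_le_mul_of_nonneg_right h4 ?_
          split_ifs <;> norm_num
      _ = B ^ 2 * ∑ m ∈ S, 1 / (m : ℝ) * (∑ n ∈ S, 1 / (n : ℝ) *
          (if (n : ZMod q) = m ∧ q ≤ 2 * n then 1 else 0)
          + ∑ n ∈ S, 1 / (n : ℝ) * if (n : ZMod q) = -m ∧ q ≤ 2 * n then 1 else 0) := by
          simp only [← Finset.mul_sum, ← Finset.sum_add_distrib]
      _ ≤ B ^ 2 * ∑ m ∈ S, 1 / (m : ℝ) * (2 / q * (1 + Real.log (M + 2))
          + 2 / q * (1 + Real.log (M + 2))) := by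
          gcongr
          · exact hres _
          · exact hres _
      _ = 4 * B ^ 2 / q * (1 + Real.log (M + 2)) * ∑ m ∈ S, 1 / (m : ℝ) := by
          rw [← Finset.sum_mul]; ring
      _ ≤ 4 * B ^ 2 / q * (1 + Real.log (M + 2)) * (1 + Real.log (M + 2)) := by
          gcongr
          refine (sum_inv_Icc_le M).trans ?_
          gcongr
          linarith
      _ = _ := by ring
  have h5 : ∑ m ∈ S, ∑ n ∈ S, G n m = ∑ m ∈ S, ∑ n ∈ S, G m n := Finset.sum_comm
  rw [h5] at h1
  calc _ ≤ _ := h1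
    _ ≤ 4 * B ^ 2 / q * (1 + Real.log (M + 2)) ^ 2 + 4 * B ^ 2 / q * (1 + Real.log (M + 2)) ^ 2 := by
        gcongr
    _ = _ := by ring

/-- The terms of the odd divisor series from `q` on contribute little. -/
lemma abs_sum_sub_oddDivisorSeries_le (k : ℕ) {ε : ℝ} (hε : 0 < ε) (hε1 : ε ≤ 1) :
    ∃ K : ℝ, 0 ≤ K ∧ ∀ q : ℕ, 0 < q → ∀ (S : Finset ℕ) (a : ℕ → ℝ),
      (∀ n, 0 ≤ a n) → (∀ n, a n ≤ (oddIndicator ^ k) n / n) →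
      (∀ n, 1 ≤ n → n < q → n ∈ S ∧ a n = (oddIndicator ^ k) n / n) →
      |∑ n ∈ S, a n ^ 2 - oddDivisorSeries k| ≤ K * (q : ℝ) ^ (-1 + ε) := by
  have hsum := summable_oddIndicator_pow_sq k hε
  refine ⟨∑' n : ℕ, (oddIndicator ^ k) n ^ 2 * (n : ℝ) ^ (-1 - ε),
    tsum_nonneg fun n => by positivity, fun q hq S a ha0 ha hS => ?_⟩
  classical
  have hsumS : HasSum (fun n => if n ∈ S then a n ^ 2 else 0) (∑ n ∈ S, a n ^ 2) := by
    have : ∑ n ∈ S, a n ^ 2 = ∑ n ∈ S, (if n ∈ S then a n ^ 2 else 0) :=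
      Finset.sum_congr rfl fun n hn => (if_pos hn).symm
    rw [this]
    exact hasSum_sum_of_ne_finset_zero fun n hn => if_neg hn
  have hd := (summable_oddDivisorSeries k).hasSum.sub hsumS
  rw [abs_sub_comm]
  change |(∑' n : ℕ, ((oddIndicator ^ k) n / n) ^ 2) - _| ≤ _
  rw [← hd.tsum_eq, ← Real.norm_eq_abs]
  refine tsum_of_norm_bounded (hsum.hasSum.mul_right ((q : ℝ) ^ (-1 + ε))) fun n => ?_
  have hsq : a n ^ 2 ≤ ((oddIndicator ^ k) n / n) ^ 2 := pow_le_pow_left₀ (ha0 n) (ha n) 2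
  have hle : ‖((oddIndicator ^ k) n / n) ^ 2 - (if n ∈ S then a n ^ 2 else 0)‖
      ≤ ((oddIndicator ^ k) n / n) ^ 2 := by
    rw [Real.norm_eq_abs, abs_of_nonneg]
    · split_ifs
      · linarith [sq_nonneg (a n)]
      · linarith
    · split_ifs
      · linarith
      · rw [sub_zero]; positivity
  rcases Nat.eq_zero_or_pos n with rfl | hn
  · refine hle.trans ?_
    simp only [ArithmeticFunction.map_zero, zero_div]
    rw [zero_pow two_ne_zero]
    positivity
  rcases lt_or_ge n q with hnq | hnq
  · obtain ⟨h1, h2⟩ := hS n hn hnq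
    rw [if_pos h1, h2, sub_self, norm_zero]
    positivity
  · refine hle.trans ?_
    have hn' : (0 : ℝ) < n := by exact_mod_cast hn
    have hq' : (0 : ℝ) < q := by exact_mod_cast hq
    rw [div_pow, div_eq_mul_inv, mul_assoc]
    gcongr
    calc ((n : ℝ) ^ 2)⁻¹ = (n : ℝ) ^ (-1 - ε) * (n : ℝ) ^ (-1 + ε) := by
          rw [← Real.rpow_add hn', ← Real.rpow_natCast, ← Real.rpow_neg hn'.le]
          congr 1
          push_cast; ring
      _ ≤ _ := by
          have : (n : ℝ) ^ (-1 + ε) ≤ (q : ℝ) ^ (-1 + ε) :=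
            Real.rpow_le_rpow_of_nonpos hq' (by exact_mod_cast hnq) (by linarith)
          gcongr

open Classical in
/-- The `2k`-th moment of `∑_{m < N odd} χ(m) / m` over the odd characters. -/
lemma exists_abs_moment_oddCharSum_sub_le (k : ℕ) (hk : 1 ≤ k) {ε : ℝ} (hε : 0 < ε) (hε1 : ε ≤ 1) :
    ∃ K : ℝ, 0 ≤ K ∧ ∀ (q : ℕ) [Fact q.Prime], q ≠ 2 → ∀ N : ℕ, q ≤ N → N ≤ q ^ 5 →
      |1 / (q.totient : ℝ) * (∑ χ : DirichletCharacter ℂ q,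
          if χ.Odd then ‖oddCharSum N χ‖ ^ (2 * k) else 0) - 1 / 2 * oddDivisorSeries k|
        ≤ K * (q : ℝ) ^ (-1 + ε) := by
  obtain ⟨K₁, hK₁, hdiag⟩ := abs_sum_sub_oddDivisorSeries_le k hε hε1
  -- All variables lie below `Q = q^(5k+2)`. The factor `Q^η` enters four times, twice through the
  -- divisor bound and twice through the logarithms, and `(Q^η)⁴ = q^ε`.
  set η : ℝ := ε / (4 * (5 * k + 2)) with hη
  have hη0 : 0 < η := by positivity
  obtain ⟨C, hC, hdiv⟩ := exists_oddIndicator_pow_le_rpow k hη0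
  refine ⟨1 / 2 * (K₁ + 8 * C ^ 2 * (1 + 1 / η) ^ 2), by positivity, fun q hq hq2 N hqN hNq => ?_⟩
  have hq0 : 0 < q := (Fact.out : q.Prime).pos
  have hq3 : 3 ≤ q := by
    have := (Fact.out : q.Prime).two_le
    omega
  set M := N ^ k
  set a : ℕ → ℝ := fun n => (oddIndicatorBelow N ^ k) n / n with ha
  have ha0 : ∀ n, 0 ≤ a n := fun n =>
    div_nonneg (pow_apply_nonneg (oddIndicatorBelow_nonneg N) k n) n.cast_nonneg
  have hale : ∀ n, a n ≤ (oddIndicator ^ k) n / n := fun n => div_le_div_of_nonneg_right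
    (pow_apply_le_pow_apply (oddIndicatorBelow_nonneg N) (oddIndicatorBelow_le N) k n) n.cast_nonneg
  have hmom : ∀ χ : DirichletCharacter ℂ q, (if χ.Odd then ‖oddCharSum N χ‖ ^ (2 * k) else 0)
      = if χ.Odd then ‖∑ n ∈ Finset.Icc 1 M, (a n : ℂ) * χ (n : ZMod q)‖ ^ 2 else 0 := fun χ => by
    rw [← oddCharSum_pow, norm_pow, ← pow_mul, mul_comm k 2]
  rw [Finset.sum_congr rfl fun χ _ => hmom χ, sum_odd_norm_sq]
  set S := Finset.Icc 1 M
  have hqM : q ≤ M := hqN.trans (Nat.le_self_pow (by omega) N)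
  have hcast : ∀ n : ℕ, (n : ZMod q) = 0 ↔ q ∣ n := fun n => ZMod.natCast_eq_zero_iff n q
  have hsplit : ∑ m ∈ S, ∑ n ∈ S, a m * a n * (if (n : ZMod q) ≠ 0 then
        (if (n : ZMod q) = m then 1 else 0) - (if (n : ZMod q) = -m then 1 else 0) else 0)
      = ∑ m ∈ S.filter (fun m : ℕ => (m : ZMod q) ≠ 0), a m ^ 2
        + ∑ m ∈ S, ∑ n ∈ S, a m * a n * (if (n : ZMod q) ≠ 0 then
        (if (n : ZMod q) = m ∧ n ≠ m then 1 else 0) - (if (n : ZMod q) = -m then 1 else 0) else 0) := by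
    rw [Finset.sum_filter, ← Finset.sum_add_distrib]
    refine Finset.sum_congr rfl fun m hm => ?_
    have : (if (m : ZMod q) ≠ 0 then a m ^ 2 else 0)
        = ∑ n ∈ S, if n = m then (if (m : ZMod q) ≠ 0 then a m ^ 2 else 0) else 0 := by
      rw [Finset.sum_ite_eq', if_pos hm]
    rw [this, ← Finset.sum_add_distrib]
    refine Finset.sum_congr rfl fun n _ => ?_
    by_cases hnm : n = m
    · subst hnm
      by_cases h0 : (n : ZMod q) = 0
      · simp [h0]
      · simp only [h0, ne_eq, not_false_eq_true, if_true, not_true_eq_false, and_false, if_false]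
        ring
    · simp [hnm]
  have hoff : |∑ m ∈ S, ∑ n ∈ S, a m * a n * (if (n : ZMod q) ≠ 0 then
        (if (n : ZMod q) = m ∧ n ≠ m then 1 else 0) - (if (n : ZMod q) = -m then 1 else 0) else 0)|
      ≤ ∑ m ∈ S, ∑ n ∈ S, a m * a n *
        (if ((n : ZMod q) = m ∨ (n : ZMod q) = -m) ∧ (q ≤ 2 * n ∨ q ≤ 2 * m) then 1 else 0) := by
    refine (Finset.abs_sum_le_sum_abs _ _).trans (Finset.sum_le_sum fun m hm => ?_)
    refine (Finset.abs_sum_le_sum_abs _ _).trans (Finset.sum_le_sum fun n hn => ?_)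
    rw [abs_mul, abs_of_nonneg (mul_nonneg (ha0 m) (ha0 n))]
    refine mul_le_mul_of_nonneg_left ?_ (mul_nonneg (ha0 m) (ha0 n))
    have hm1 := (Finset.mem_Icc.mp hm).1
    have hn1 := (Finset.mem_Icc.mp hn).1
    have c1 : (n : ZMod q) = m → n ≠ m → q ≤ 2 * n ∨ q ≤ 2 * m := by
      intro h hne
      rw [ZMod.natCast_eq_natCast_iff] at h
      rcases lt_or_gt_of_ne hne with hlt | hlt
      · have := Nat.le_of_dvd (by omega) ((Nat.modEq_iff_dvd' hlt.le).mp h)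
        omega
      · have := Nat.le_of_dvd (by omega) ((Nat.modEq_iff_dvd' hlt.le).mp h.symm)
        omega
    have c2 : (n : ZMod q) = -m → q ≤ 2 * n ∨ q ≤ 2 * m := by
      intro h
      rw [eq_neg_iff_add_eq_zero] at h
      have h' : ((n + m : ℕ) : ZMod q) = 0 := by push_cast; exact h
      have := Nat.le_of_dvd (by omega) ((hcast _).mp h')
      omega
    -- Here `q ≠ 2` matters: the two congruences together give `q ∣ 2n`, hence `q ∣ n`. So the two
    -- indicators never overlap off multiples of `q`.
    have c3 : (n : ZMod q) = m → (n : ZMod q) = -m → (n : ZMod q) = 0 := by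
      intro h h'
      have h2 : ((2 * n : ℕ) : ZMod q) = 0 := by
        push_cast
        rw [two_mul]
        nth_rewrite 1 [h']
        rw [h]; ring
      rw [hcast] at h2 ⊢
      refine ((Fact.out : q.Prime).dvd_mul.mp h2).resolve_left fun h3 => ?_
      have := Nat.le_of_dvd two_pos h3
      omega
    exact abs_ite_sub_ite_le c1 c2 c3
  set Q : ℝ := (q : ℝ) ^ (5 * k + 2) with hQ
  have hq1 : (1 : ℝ) ≤ q := by exact_mod_cast hq0
  have hQ1 : 1 ≤ Q := one_le_pow₀ hq1
  have hMQ : (M : ℝ) + 2 ≤ Q := by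
    have h1 : M ≤ q ^ (5 * k) := by
      rw [pow_mul]; exact Nat.pow_le_pow_left hNq k
    have h2 : M + 2 ≤ q ^ (5 * k + 2) := by
      have h3 : 1 ≤ q ^ (5 * k) := Nat.one_le_pow _ _ hq0
      have h4 : 3 ≤ q ^ 2 := by nlinarith
      have h5 := Nat.mul_le_mul_left (q ^ (5 * k)) h4
      rw [pow_add]
      omega
    rw [hQ]
    exact_mod_cast h2
  have hB : ∀ n ∈ S, a n ≤ C * Q ^ η / n := fun n hn => by
    refine (hale n).trans ?_
    have h1 : (n : ℝ) ≤ Q := by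
      have : (n : ℝ) ≤ M := by exact_mod_cast (Finset.mem_Icc.mp hn).2
      linarith
    gcongr
    refine (hdiv n).trans ?_
    gcongr
  have hlogQ : 1 + Real.log (M + 2) ≤ (1 + 1 / η) * Q ^ η := by
    have h1 : Real.log (M + 2) ≤ Q ^ η / η :=
      (Real.log_le_log (by positivity) hMQ).trans (Real.log_le_rpow_div (by positivity) hη0)
    have h2 : 1 ≤ Q ^ η := Real.one_le_rpow hQ1 hη0.le
    calc _ ≤ Q ^ η + Q ^ η / η := add_le_add h2 h1
      _ = _ := by ring
  have hlog0 : 0 ≤ 1 + Real.log (M + 2) := by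
    have := Real.log_nonneg (by linarith [M.cast_nonneg (α := ℝ)] : (1 : ℝ) ≤ M + 2)
    linarith
  have hQη : (Q ^ η) ^ 4 = (q : ℝ) ^ ε := by
    rw [← Real.rpow_natCast, ← Real.rpow_mul (by positivity), hQ, ← Real.rpow_natCast (q : ℝ),
      ← Real.rpow_mul (by positivity)]
    congr 1
    rw [hη]
    push_cast
    field_simp
  have h1 := hdiag q hq0 (S.filter fun m : ℕ => (m : ZMod q) ≠ 0) a ha0 hale fun n hn hnq => by
    refine ⟨Finset.mem_filter.mpr ⟨Finset.mem_Icc.mpr ⟨hn, by omega⟩, fun h => ?_⟩, ?_⟩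
    · have := Nat.le_of_dvd hn ((hcast n).mp h)
      omega
    · simp only [ha]
      rw [pow_apply_eq_pow_apply (N := N) (fun m hm => ?_) k (hnq.trans_le hqN)]
      simp only [oddIndicatorBelow_apply, oddIndicator_apply, hm, and_true]
  have h2 := sum_offDiag_le hq0 M ha0 hB
  have h3 : 8 * (C * Q ^ η) ^ 2 / q * (1 + Real.log (M + 2)) ^ 2
      ≤ 8 * C ^ 2 * (1 + 1 / η) ^ 2 * (q : ℝ) ^ (-1 + ε) := by
    calc _ ≤ 8 * (C * Q ^ η) ^ 2 / q * ((1 + 1 / η) * Q ^ η) ^ 2 := by gcongr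
      _ = 8 * C ^ 2 * (1 + 1 / η) ^ 2 * ((Q ^ η) ^ 4 / q) := by ring
      _ = _ := by
        rw [hQη, Real.rpow_add (by positivity), Real.rpow_neg_one]; ring
  rw [hsplit, ← mul_sub, abs_mul, abs_of_pos (by norm_num : (0 : ℝ) < 1 / 2), mul_assoc]
  gcongr
  rw [add_sub_right_comm, add_mul]
  exact (abs_add_le _ _).trans (add_le_add h1 ((hoff.trans h2).trans h3))

/-! ### Truncated cotangent expansion and the conjugate Dirichlet kernel -/

lemma norm_cotTerm_le {y : ℝ} (hy : |y| ≤ 1 / 2) {j : ℕ} (hj : 1 ≤ j) :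
    ‖cotTerm (y : ℂ) j‖ ≤ 1 / j - 1 / ((j + 1 : ℕ) : ℝ) := by
  have hj' : (1 : ℝ) ≤ j := by exact_mod_cast hj
  obtain ⟨h1, h2⟩ := abs_le.mp hy
  have e : cotTerm (y : ℂ) j = (((1 / (y - (j + 1)) + 1 / (y + (j + 1)) : ℝ)) : ℂ) := by
    simp [cotTerm]
  have a1 : y - (j + 1) < 0 := by linarith
  have a2 : 0 < y + (j + 1) := by linarith
  have e2 : 1 / (y - (j + 1)) + 1 / (y + (j + 1)) = -(2 * y) / (((j : ℝ) + 1) ^ 2 - y ^ 2) := by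
    have : ((j : ℝ) + 1) ^ 2 - y ^ 2 ≠ 0 := by nlinarith
    rw [div_add_div _ _ a1.ne a2.ne', div_eq_div_iff (mul_ne_zero a1.ne a2.ne') this]
    ring
  have hden : 0 < ((j : ℝ) + 1) ^ 2 - y ^ 2 := by nlinarith
  have e3 : (1 : ℝ) / j - 1 / ((j + 1 : ℕ) : ℝ) = 1 / (j * (j + 1)) := by
    push_cast; field_simp; ring
  rw [e, Complex.norm_real, Real.norm_eq_abs, e2, abs_div, abs_of_pos hden, abs_neg, abs_mul,
    abs_two, e3]
  gcongr
  · linarith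
  · nlinarith

lemma sum_range_cotTerm (z : ℂ) (T : ℕ) :
    1 / z + ∑ j ∈ Finset.range T, cotTerm z j = ∑ n ∈ Finset.Icc (-(T : ℤ)) T, 1 / (z + n) := by
  induction T with
  | zero => simp
  | succ T ih =>
    have := Finset.sum_Icc_succ_eq_add_endpoints (fun n : ℤ => 1 / (z + n)) (N := T)
    push_cast at this ⊢
    rw [Finset.sum_range_succ, ← add_assoc, ih, this, cotTerm]
    ring

/-- Truncated partial fraction expansion of the cotangent. -/
lemma abs_pi_mul_cot_sub_sum_le {y : ℝ} (hy0 : y ≠ 0) (hy : |y| ≤ 1 / 2) {T : ℕ} (hT : 1 ≤ T) :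
    |Real.pi * (Real.cos (Real.pi * y) / Real.sin (Real.pi * y))
      - ∑ n ∈ Finset.Icc (-(T : ℤ)) T, 1 / (y + n)| ≤ 1 / T := by
  have hy' : (y : ℂ) ∈ Complex.integerComplement := by
    rw [Complex.mem_integerComplement_iff]
    rintro ⟨n, hn⟩
    have hn' : (n : ℝ) = y := by exact_mod_cast hn
    have h1 : |(n : ℝ)| < 1 := by rw [hn']; linarith
    have h2 : n = 0 := by
      rw [← Int.abs_lt_one_iff]; exact_mod_cast h1
    rw [h2] at hn'
    exact hy0 (by rw [← hn']; simp)
  have hlim := tendsto_logDeriv_euler_cot_sub hy'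
  -- The termwise bound `1/j - 1/(j+1)` telescopes, leaving `1/T` for the whole tail.
  have hbound : ∀ R : ℕ, T ≤ R → ‖(∑ j ∈ Finset.range R, cotTerm (y : ℂ) j)
      - ∑ j ∈ Finset.range T, cotTerm (y : ℂ) j‖ ≤ 1 / T - 1 / R := by
    intro R hR
    induction R, hR using Nat.le_induction with
    | base => simp
    | succ R hR ih =>
      rw [Finset.sum_range_succ, add_sub_right_comm]
      refine (norm_add_le _ _).trans ((add_le_add ih (norm_cotTerm_le hy (hT.trans hR))).trans_eq ?_)
      ring
  have hle := le_of_tendsto (hlim.sub_const (∑ j ∈ Finset.range T, cotTerm (y : ℂ) j)).norm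
    (eventually_atTop.mpr ⟨T, fun R hR => (hbound R hR).trans
      (sub_le_self _ (by positivity : (0 : ℝ) ≤ 1 / R))⟩)
  rw [← Real.norm_eq_abs, ← Complex.norm_real]
  refine le_of_eq_of_le ?_ hle
  congr 1
  push_cast
  rw [← sum_range_cotTerm, Complex.cot]
  ring

lemma two_mul_sin_mul_sum_sin (θ : ℝ) (h : ℕ) :
    2 * Real.sin (θ / 2) * ∑ n ∈ Finset.Icc 1 h, Real.sin (n * θ)
      = Real.cos (θ / 2) - Real.cos ((h + 1 / 2) * θ) := by
  induction h with
  | zero =>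
    rw [Finset.Icc_eq_empty (by norm_num), Finset.sum_empty]
    push_cast
    ring_nf
  | succ h ih =>
    rw [Finset.sum_Icc_succ_top (by omega), mul_add, ih]
    have e1 : ((h : ℝ) + 1 / 2) * θ = ((h + 1 : ℕ) : ℝ) * θ - θ / 2 := by push_cast; ring
    have e2 : (((h + 1 : ℕ) : ℝ) + 1 / 2) * θ = ((h + 1 : ℕ) : ℝ) * θ + θ / 2 := by ring
    rw [e1, e2, Real.cos_sub, Real.cos_add]
    ring

/-- The conjugate Dirichlet kernel at odd multiples of `2π / q`. -/
lemma sum_sin_eq_cot {q h : ℕ} (hq : q = 2 * h + 1) {a : ℤ} (ha : Odd a) (haq : |a| < q) :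
    ∑ n ∈ Finset.Icc 1 h, Real.sin (2 * Real.pi * n * a / q)
      = 1 / 2 * (Real.cos (Real.pi * (a / (2 * q))) / Real.sin (Real.pi * (a / (2 * q)))) := by
  have hq0 : (0 : ℝ) < q := by exact_mod_cast (by omega : 0 < q)
  set φ : ℝ := Real.pi * (a / (2 * q)) with hφ
  have hqh : (q : ℝ) = 2 * h + 1 := by exact_mod_cast hq
  have key := two_mul_sin_mul_sum_sin (4 * φ) h
  obtain ⟨b, hb⟩ := ha
  -- This angle is `πa`. Since `a` is odd its cosine is `-1`, so the kernel is a pure cotangent of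
  -- the half angle; this is the reason for working with odd representatives.
  have e1 : ((h : ℝ) + 1 / 2) * (4 * φ) = Real.pi + b * (2 * Real.pi) := by
    have : ((h : ℝ) + 1 / 2) = q / 2 := by rw [hqh]; ring
    rw [this, hφ, hb]
    push_cast
    field_simp
    ring
  rw [e1, Real.cos_add_int_mul_two_pi, Real.cos_pi, show 4 * φ / 2 = 2 * φ by ring,
    Real.sin_two_mul, Real.cos_two_mul] at key
  have haq' : |(a : ℝ)| < q := by exact_mod_cast haq
  obtain ⟨l, u⟩ := abs_lt.mp haq'
  have hpi := Real.pi_pos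
  have e2 : φ = Real.pi / 2 * (a / q) := by rw [hφ]; field_simp
  have hlt1 : a / q < (1 : ℝ) := by rw [div_lt_one hq0]; exact u
  have hlt2 : (-1 : ℝ) < a / q := by rw [lt_div_iff₀ hq0]; linarith
  have hcos : Real.cos φ ≠ 0 := (Real.cos_pos_of_mem_Ioo ⟨by rw [e2]; nlinarith,
    by rw [e2]; nlinarith⟩).ne'
  have ha0 : (a : ℝ) ≠ 0 := by
    have : a ≠ 0 := by omega
    exact_mod_cast this
  have hsin : Real.sin φ ≠ 0 := by
    have hφ0 : φ ≠ 0 := by rw [e2]; positivity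
    rw [Ne, Real.sin_eq_zero_iff_of_lt_of_lt (by rw [e2]; nlinarith) (by rw [e2]; nlinarith)]
    exact hφ0
  have e3 : ∀ n ∈ Finset.Icc 1 h, Real.sin (2 * Real.pi * n * a / q) = Real.sin (n * (4 * φ)) := by
    intro n _
    congr 1
    rw [hφ]
    field_simp
    ring
  rw [Finset.sum_congr rfl e3]
  set sigmaSum := ∑ n ∈ Finset.Icc 1 h, Real.sin (n * (4 * φ))
  have e4 : Real.sin φ * sigmaSum = 1 / 2 * Real.cos φ := by
    apply mul_left_cancel₀ (mul_ne_zero (by norm_num : (4 : ℝ) ≠ 0) hcos)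
    linear_combination key
  rw [eq_comm, ← mul_div_assoc, div_eq_iff hsin]
  linarith

/-! ### Half sums of characters as sums over odd integers -/

/-- The odd representative of a residue class in `[-q, q)`. -/
def oddRep {q : ℕ} (x : ZMod q) : ℤ := if Odd x.val then (x.val : ℤ) else (x.val : ℤ) - q

lemma oddRep_cast {q : ℕ} [NeZero q] (x : ZMod q) : ((oddRep x : ℤ) : ZMod q) = x := by
  unfold oddRep
  split_ifs <;> simp

lemma odd_oddRep {q : ℕ} (hq : Odd q) (x : ZMod q) : Odd (oddRep x) := by
  unfold oddRep
  split_ifs with h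
  · exact_mod_cast h
  · rw [Nat.not_odd_iff_even] at h
    exact Even.sub_odd (by exact_mod_cast h) (by exact_mod_cast hq)

lemma oddRep_mem {q : ℕ} [NeZero q] (x : ZMod q) : -(q : ℤ) ≤ oddRep x ∧ oddRep x < q := by
  have := ZMod.val_lt x
  unfold oddRep
  split_ifs <;> omega

lemma abs_oddRep_lt {q : ℕ} [NeZero q] {x : ZMod q} (hx : x ≠ 0) : |oddRep x| < q := by
  have h1 := ZMod.val_lt x
  have h2 : x.val ≠ 0 := by rwa [Ne, ZMod.val_eq_zero]
  rw [abs_lt]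
  unfold oddRep
  split_ifs <;> omega

/-- The difference is even and divisible by the odd number `q`, hence by `2q`. Thus the translates
`a + 2qn` in the cotangent expansion are all the odd integers in the class of `a`. -/
lemma exists_eq_oddRep_add {q : ℕ} [NeZero q] (hq : Odd q) {m : ℤ} (hm : Odd m) :
    ∃ d : ℤ, m = oddRep (m : ZMod q) + 2 * q * d := by
  have h1 : (2 : ℤ) ∣ m - oddRep (m : ZMod q) := (hm.sub_odd (odd_oddRep hq _)).two_dvd
  have h2 : (q : ℤ) ∣ m - oddRep (m : ZMod q) := by
    rw [← ZMod.intCast_zmod_eq_zero_iff_dvd]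
    push_cast
    rw [oddRep_cast, sub_self]
  have h3 : IsCoprime (2 : ℤ) q := by
    exact_mod_cast Nat.isCoprime_iff_coprime.mpr (Nat.coprime_two_left.mpr hq)
  obtain ⟨d, hd⟩ := h3.mul_dvd h1 h2
  exact ⟨d, by linarith⟩

/-- Summing over residues and translates by multiples of `2q` is summing over odd integers. -/
lemma sum_oddRep_add {q : ℕ} [NeZero q] (hq : Odd q) (T : ℕ) (g : ℤ → ℂ) :
    ∑ x : ZMod q, ∑ n ∈ Finset.Icc (-(T : ℤ)) T, g (oddRep x + 2 * q * n)
      = ∑ m ∈ (Finset.Ico (-((2 * T + 1) * q : ℕ) : ℤ) ((2 * T + 1) * q : ℕ)).filter Odd, g m := by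
  have hq0 : (0 : ℤ) < q := by exact_mod_cast Nat.pos_of_ne_zero (NeZero.ne q)
  rw [← Finset.sum_product']
  refine Finset.sum_bij' (fun p _ => oddRep p.1 + 2 * q * p.2)
    (fun m _ => ((m : ZMod q), (m - oddRep (m : ZMod q)) / (2 * q))) ?_ ?_ ?_ ?_ ?_
  · rintro ⟨x, n⟩ hp
    simp only [Finset.mem_product, Finset.mem_univ, true_and, Finset.mem_Icc] at hp
    obtain ⟨h1, h2⟩ := oddRep_mem x
    rw [Finset.mem_filter, Finset.mem_Ico]
    push_cast
    refine ⟨⟨by nlinarith, by nlinarith⟩, ?_⟩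
    rw [mul_assoc]
    exact (odd_oddRep hq x).add_even (even_two_mul _)
  · intro m hm
    rw [Finset.mem_filter, Finset.mem_Ico] at hm
    obtain ⟨⟨h1, h2⟩, hodd⟩ := hm
    obtain ⟨h3, h4⟩ := oddRep_mem (m : ZMod q)
    obtain ⟨d, hd⟩ := exists_eq_oddRep_add hq hodd
    have e : (m - oddRep (m : ZMod q)) / (2 * q) = d := by
      rw [show m - oddRep (m : ZMod q) = 2 * q * d by linarith]
      exact Int.mul_ediv_cancel_left _ (by positivity)
    push_cast at h1 h2
    simp only [Finset.mem_product, Finset.mem_univ, true_and, Finset.mem_Icc, e]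
    constructor
    · by_contra hlt
      have : d ≤ -(T : ℤ) - 1 := by omega
      nlinarith
    · by_contra hlt
      have : (T : ℤ) + 1 ≤ d := by omega
      nlinarith
  · rintro ⟨x, n⟩ hp
    have e : ((oddRep x + 2 * q * n : ℤ) : ZMod q) = x := by
      push_cast
      rw [oddRep_cast]; simp
    simp only [e, add_sub_cancel_left, Prod.mk.injEq, true_and]
    exact Int.mul_ediv_cancel_left _ (by positivity)
  · intro m hm
    rw [Finset.mem_filter] at hm
    obtain ⟨d, hd⟩ := exists_eq_oddRep_add hq hm.2
    have e : (m - oddRep (m : ZMod q)) / (2 * q) = d := by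
      rw [show m - oddRep (m : ZMod q) = 2 * q * d by linarith]
      exact Int.mul_ediv_cancel_left _ (by positivity)
    simp only [e]
    exact hd.symm
  · rintro ⟨x, n⟩ hp
    rfl

lemma sum_Icc_one_eq_sum_range {M : Type*} [AddCommMonoid M] (f : ℕ → M) (h : ℕ) :
    ∑ n ∈ Finset.Icc 1 h, f n = ∑ j ∈ Finset.range h, f (j + 1) := by
  induction h with
  | zero => simp
  | succ h ih => rw [Finset.sum_Icc_succ_top (by omega), ih, Finset.sum_range_succ]

lemma sum_zmod_eq_sum_Icc {q h : ℕ} [NeZero q] (hq : q = 2 * h + 1) (f : ZMod q → ℂ) :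
    ∑ x : ZMod q, f x = f 0 + ∑ n ∈ Finset.Icc 1 h, (f n + f (-n)) := by
  have h1 : ∑ x : ZMod q, f x = ∑ n ∈ Finset.range q, f (n : ZMod q) := by
    refine Finset.sum_bij' (fun x _ => x.val) (fun n _ => (n : ZMod q)) ?_ ?_ ?_ ?_ ?_
    · exact fun x _ => Finset.mem_range.mpr (ZMod.val_lt x)
    · exact fun n _ => Finset.mem_univ _
    · exact fun x _ => ZMod.natCast_zmod_val x
    · exact fun n hn => ZMod.val_cast_of_lt (Finset.mem_range.mp hn)
    · exact fun x _ => by rw [ZMod.natCast_zmod_val]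
  have h2 : Finset.range q = Finset.range ((h + 1) + h) := by rw [hq]; congr 1; ring
  rw [h1, h2, Finset.sum_range_add, Finset.sum_range_succ', Finset.sum_add_distrib,
    sum_Icc_one_eq_sum_range, sum_Icc_one_eq_sum_range,
    ← Finset.sum_range_reflect (fun x => f ((h + 1 + x : ℕ) : ZMod q))]
  have h3 : ∑ j ∈ Finset.range h, f ((h + 1 + (h - 1 - j) : ℕ) : ZMod q)
      = ∑ j ∈ Finset.range h, f (-((j + 1 : ℕ) : ZMod q)) := by
    refine Finset.sum_congr rfl fun j hj => ?_
    congr 1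
    rw [eq_neg_iff_add_eq_zero, ← Nat.cast_add]
    have := Finset.mem_range.mp hj
    have e : h + 1 + (h - 1 - j) + (j + 1) = q := by omega
    rw [e, ZMod.natCast_self]
  rw [h3, Nat.cast_zero]
  ring

lemma charSum_half {q h : ℕ} (hq : q = 2 * h + 1) (χ : DirichletCharacter ℂ q) :
    charSum χ ((q : ℝ) / 2) = ∑ n ∈ Finset.Icc 1 h, χ (n : ZMod q) := by
  have : ⌊(q : ℝ) / 2⌋₊ = h := by
    rw [show (2 : ℝ) = ((2 : ℕ) : ℝ) by norm_num, Nat.floor_div_eq_div]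
    omega
  rw [charSum, this]

/-- The complete sum vanishes, and folding it by `n ↦ -n` makes it twice the half sum. -/
lemma charSum_half_eq_zero_of_even {q h : ℕ} [Fact q.Prime] (hq : q = 2 * h + 1)
    {χ : DirichletCharacter ℂ q} (hχ : χ ≠ 1) (he : χ.Even) : charSum χ ((q : ℝ) / 2) = 0 := by
  have h1 := MulChar.sum_eq_zero_of_ne_one hχ
  rw [sum_zmod_eq_sum_Icc hq, MulChar.map_zero, zero_add] at h1
  have h2 : ∀ n ∈ Finset.Icc 1 h, χ (n : ZMod q) + χ (-(n : ZMod q)) = 2 * χ (n : ZMod q) := by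
    intro n _
    rw [he.eval_neg]; ring
  rw [Finset.sum_congr rfl h2, ← Finset.mul_sum] at h1
  rw [charSum_half hq]
  simpa using h1

/-- With `ω` odd the summand is even in `m`, so positive and negative `m` contribute equally. The
asymmetric endpoints are harmless, because `q ∣ N` gives `ω(N) = 0`. -/
lemma sum_odd_Ico_eq {q : ℕ} [Fact q.Prime] {ω : DirichletCharacter ℂ q} (hω : ω.Odd) {N : ℕ}
    (hN : q ∣ N) :
    ∑ m ∈ (Finset.Ico (-(N : ℤ)) N).filter Odd, ω (m : ZMod q) / m = 2 * oddCharSum N ω := by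
  set g : ℤ → ℂ := fun m => if Odd m then ω (m : ZMod q) / m else 0 with hg
  have hge : Function.Even g := by
    intro m
    simp only [hg, Int.cast_neg, hω.eval_neg, neg_div_neg_eq]
    by_cases h : Odd m
    · rw [if_pos h, if_pos h.neg]
    · rw [if_neg h, if_neg fun h' => h (by simpa using h'.neg)]
  have hN0 : ω ((N : ℕ) : ZMod q) = 0 := by
    rw [(ZMod.natCast_eq_zero_iff N q).mpr hN, MulChar.map_zero]
  have hgN : g N = 0 := by
    simp [hg, hN0]
  have hg0 : g 0 = 0 := by simp [hg]
  have h1 := Finset.sum_Icc_of_even_eq_range hge N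
  have h2 : ∑ m ∈ Finset.Icc (-(N : ℤ)) N, g m = ∑ m ∈ Finset.Ico (-(N : ℤ)) N, g m := by
    rw [← Finset.Ico_insert_right (by omega), Finset.sum_insert (by simp), hgN, zero_add]
  have h3 : ∑ m ∈ Finset.range (N + 1), g m = oddCharSum N ω := by
    rw [Finset.sum_range_succ', Nat.cast_zero, hg0, add_zero, oddCharSum,
      sum_Icc_one_eq_sum_range]
    refine Finset.sum_congr rfl fun j hj => ?_
    have hj' := Finset.mem_range.mp hj
    rw [oddIndicatorBelow_apply]
    by_cases hodd : Odd (j + 1)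
    · have hodd' : Odd (((j + 1 : ℕ) : ℕ) : ℤ) := by exact_mod_cast hodd
      rcases lt_or_ge (j + 1) N with h | h
      · rw [if_pos ⟨hodd, h⟩]
        simp only [hg, if_pos hodd']
        push_cast; ring
      · have e : j + 1 = N := by omega
        rw [e, hgN, if_neg (by omega)]
        push_cast; ring
    · have hodd' : ¬ Odd (((j + 1 : ℕ) : ℕ) : ℤ) := by exact_mod_cast hodd
      rw [if_neg fun h => hodd h.1]
      simp only [hg, if_neg hodd']
      push_cast; ring
  rw [Finset.sum_filter, ← h2, h1, h3, hg0, sub_zero, two_nsmul, two_mul]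

lemma norm_gaussSum_eq {q : ℕ} [Fact q.Prime] {χ : DirichletCharacter ℂ q} (hχ : χ ≠ 1) :
    ‖gaussSum χ ZMod.stdAddChar‖ = √q := by
  have h1 := gaussSum_mul_gaussSum_eq_card hχ (ZMod.isPrimitive_stdAddChar q)
  rw [← star_gaussSum_eq, ZMod.card] at h1
  have h2 : ((‖gaussSum χ (ZMod.stdAddChar (N := q))‖ ^ 2 : ℝ) : ℂ) = (q : ℝ) := by
    push_cast
    rw [← Complex.mul_conj', ← h1]
    rfl
  rw [eq_comm, Real.sqrt_eq_iff_mul_self_eq (by positivity) (norm_nonneg _), ← sq]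
  exact (Complex.ofReal_injective h2).symm

/-- Pólya's finite Fourier expansion of the half sum of an odd character. -/
lemma gaussSum_mul_charSum {q h : ℕ} [Fact q.Prime] (hq : q = 2 * h + 1)
    {χ : DirichletCharacter ℂ q} (hχ : χ.Odd) :
    gaussSum χ⁻¹ ZMod.stdAddChar * charSum χ ((q : ℝ) / 2)
      = Complex.I * ∑ x : ZMod q, χ⁻¹ x *
        ((∑ n ∈ Finset.Icc 1 h, Real.sin (2 * Real.pi * n * oddRep x / q) : ℝ) : ℂ) := by
  set ψ : AddChar (ZMod q) ℂ := ZMod.stdAddChar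
  set P : ZMod q → ℂ := fun x => ∑ n ∈ Finset.Icc 1 h, ψ ((n : ZMod q) * x)
  have h1 : gaussSum χ⁻¹ ψ * charSum χ ((q : ℝ) / 2) = ∑ x : ZMod q, χ⁻¹ x * P x := by
    rw [charSum_half hq, Finset.mul_sum]
    simp only [P, Finset.mul_sum]
    rw [Finset.sum_comm]
    refine Finset.sum_congr rfl fun n hn => ?_
    rw [Finset.mem_Icc] at hn
    have hn0 : (n : ZMod q) ≠ 0 := by
      rw [Ne, ZMod.natCast_eq_zero_iff]
      intro hd
      have := Nat.le_of_dvd hn.1 hd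
      omega
    have := gaussSum_mulShift_eq χ⁻¹ ψ (Units.mk0 (n : ZMod q) hn0)
    rw [inv_inv, Units.val_mk0] at this
    rw [mul_comm, ← this]
    rfl
  have hodd : ∀ x, χ⁻¹ (-x) = -χ⁻¹ x := fun x => by
    rw [MulChar.inv_apply', MulChar.inv_apply', ← neg_inv, hχ.eval_neg]
  -- Oddness of `χ⁻¹` allows `P` to be replaced by its odd part, which turns the exponentials into
  -- sines.
  have h2 : ∑ x : ZMod q, χ⁻¹ x * P x = -∑ x : ZMod q, χ⁻¹ x * P (-x) := by
    rw [← Finset.sum_neg_distrib]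
    refine Fintype.sum_equiv (Equiv.neg _) _ _ fun x => ?_
    simp only [Equiv.neg_apply, hodd, neg_neg]
    ring
  have h3 : ∀ x : ZMod q, P x - P (-x) = 2 * Complex.I *
      ((∑ n ∈ Finset.Icc 1 h, Real.sin (2 * Real.pi * n * oddRep x / q) : ℝ) : ℂ) := by
    intro x
    push_cast
    rw [Finset.mul_sum, ← Finset.sum_sub_distrib]
    refine Finset.sum_congr rfl fun n _ => ?_
    have e1 : (n : ZMod q) * x = ((n * oddRep x : ℤ) : ZMod q) := by
      push_cast; rw [oddRep_cast]
    have e2 : (n : ZMod q) * -x = ((-(n * oddRep x) : ℤ) : ZMod q) := by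
      push_cast; rw [oddRep_cast, mul_neg]
    rw [e1, e2, ZMod.stdAddChar_coe, ZMod.stdAddChar_coe, Complex.sin]
    have hI := Complex.I_mul_I
    push_cast
    have a1 : (2 * Real.pi * Complex.I * (n * oddRep x) / q : ℂ)
      = 2 * Real.pi * n * oddRep x / q * Complex.I := by ring
    have a2 : (2 * Real.pi * Complex.I * -(n * oddRep x) / q : ℂ)
      = -(2 * Real.pi * n * oddRep x / q) * Complex.I := by ring
    rw [a1, a2]
    linear_combination (Complex.exp (2 * Real.pi * n * oddRep x / q * Complex.I)
      - Complex.exp (-(2 * Real.pi * n * oddRep x / q) * Complex.I)) * hI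
  have h4 : 2 * ∑ x : ZMod q, χ⁻¹ x * P x = ∑ x : ZMod q, χ⁻¹ x * (P x - P (-x)) := by
    simp only [mul_sub, Finset.sum_sub_distrib]
    linear_combination h2
  rw [h1]
  have h5 : ∑ x : ZMod q, χ⁻¹ x * (P x - P (-x)) = 2 * (Complex.I * ∑ x : ZMod q, χ⁻¹ x *
        ((∑ n ∈ Finset.Icc 1 h, Real.sin (2 * Real.pi * n * oddRep x / q) : ℝ) : ℂ)) := by
    rw [Finset.mul_sum, Finset.mul_sum]
    refine Finset.sum_congr rfl fun x _ => ?_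
    rw [h3]; ring
  exact mul_left_cancel₀ two_ne_zero (h4.trans h5)

/-- The half sum of an odd character in terms of `∑_{m < N odd} χ(m) / m`. -/
lemma abs_norm_charSum_sub_le {q : ℕ} [Fact q.Prime] (hq2 : q ≠ 2) {χ : DirichletCharacter ℂ q}
    (hχ : χ.Odd) {T : ℕ} (hT : 1 ≤ T) :
    |‖charSum χ ((q : ℝ) / 2)‖ - 2 * √q / Real.pi * ‖oddCharSum ((2 * T + 1) * q) χ‖| ≤ √q / T := by
  have hqodd : Odd q := (Fact.out : q.Prime).odd_of_ne_two hq2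
  obtain ⟨h, hq⟩ := hqodd
  have hqodd : Odd q := ⟨h, hq⟩
  have hq0 : (0 : ℝ) < q := by exact_mod_cast (Fact.out : q.Prime).pos
  have hpi := Real.pi_pos
  set N := (2 * T + 1) * q
  have hχ1 : χ⁻¹ ≠ 1 := by
    rw [Ne, inv_eq_one]
    rintro rfl
    rw [DirichletCharacter.Odd, MulChar.one_apply isUnit_one.neg] at hχ
    norm_num at hχ
  have hodd : (χ⁻¹).Odd := by
    rw [DirichletCharacter.Odd, MulChar.inv_apply', inv_neg, inv_one]; exact hχ
  -- `e x` is the cotangent truncation error at the class `x`, at most `1/T` for `x ≠ 0`; at `x = 0`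
  -- no bound is needed because `χ⁻¹ 0 = 0`. Summing over `q` classes and dividing by the Gauss sum
  -- of modulus `√q` gives the error `√q / T`.
  set e : ZMod q → ℝ := fun x => 2 * Real.pi *
    (∑ n ∈ Finset.Icc 1 h, Real.sin (2 * Real.pi * n * oddRep x / q))
    - ∑ n ∈ Finset.Icc (-(T : ℤ)) T, 2 * (q : ℝ) / (oddRep x + 2 * q * n) with he
  have hebound : ∀ x ≠ 0, |e x| ≤ 1 / T := by
    intro x hx
    have hlt := abs_oddRep_lt hx
    have hlt' : |(oddRep x : ℝ)| < q := by exact_mod_cast hlt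
    have ho := odd_oddRep hqodd x
    have h0 : (oddRep x : ℝ) ≠ 0 := by
      intro h0
      have : oddRep x = 0 := by exact_mod_cast h0
      rw [this] at ho
      exact absurd ho (by decide)
    have h1 := abs_pi_mul_cot_sub_sum_le (y := oddRep x / (2 * q)) (by positivity)
      (by rw [abs_div, abs_of_pos (by positivity : (0 : ℝ) < 2 * q), div_le_iff₀ (by positivity)]
          linarith) hT
    refine le_of_eq_of_le ?_ h1
    rw [he]
    simp only
    rw [sum_sin_eq_cot hq ho hlt]
    congr 2
    · ring
    · refine Finset.sum_congr rfl fun n _ => ?_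
      have : (oddRep x : ℝ) / (2 * q) + n = (oddRep x + 2 * q * n) / (2 * q) := by field_simp
      rw [this, one_div_div]
  have hmain : ∑ x : ZMod q, χ⁻¹ x * ((∑ n ∈ Finset.Icc (-(T : ℤ)) T,
      2 * q / (oddRep x + 2 * q * n) : ℝ) : ℂ) = 4 * q * oddCharSum N χ⁻¹ := by
    have h1 := sum_oddRep_add hqodd T fun m => χ⁻¹ (m : ZMod q) / m
    rw [sum_odd_Ico_eq hodd (Dvd.intro_left _ rfl)] at h1
    rw [show (4 : ℂ) * q * oddCharSum N χ⁻¹ = 2 * q * (2 * oddCharSum N χ⁻¹) by ring, ← h1,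
      Finset.mul_sum]
    refine Finset.sum_congr rfl fun x _ => ?_
    push_cast
    rw [Finset.mul_sum, Finset.mul_sum]
    refine Finset.sum_congr rfl fun n _ => ?_
    rw [oddRep_cast]
    simp only [ZMod.natCast_self, mul_zero, zero_mul, add_zero]
    ring
  have hkey := gaussSum_mul_charSum hq hχ
  have hsum : (2 * Real.pi : ℂ) * (gaussSum χ⁻¹ ZMod.stdAddChar * charSum χ ((q : ℝ) / 2))
      = Complex.I * (4 * q * oddCharSum N χ⁻¹ + ∑ x : ZMod q, χ⁻¹ x * (e x : ℂ)) := by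
    rw [hkey, ← hmain, ← Finset.sum_add_distrib, ← mul_assoc, mul_comm _ Complex.I, mul_assoc,
      Finset.mul_sum]
    congr 1
    refine Finset.sum_congr rfl fun x _ => ?_
    simp only [he]
    rw [Complex.ofReal_sub, Complex.ofReal_mul]
    push_cast
    ring
  have hconj : ‖oddCharSum N χ⁻¹‖ = ‖oddCharSum N χ‖ := by
    have : oddCharSum N χ⁻¹ = (starRingEnd ℂ) (oddCharSum N χ) := by
      simp only [oddCharSum, map_sum, map_mul, map_div₀, Complex.conj_ofReal, map_natCast]
      refine Finset.sum_congr rfl fun m _ => ?_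
      rw [← MulChar.star_apply' χ]
      rfl
    rw [this, RCLike.norm_conj]
  have herr : ‖∑ x : ZMod q, χ⁻¹ x * (e x : ℂ)‖ ≤ q / T := by
    refine (norm_sum_le _ _).trans ((Finset.sum_le_card_nsmul _ _ (1 / T : ℝ) fun x _ => ?_).trans_eq ?_)
    · by_cases hx : x = 0
      · rw [hx, MulChar.map_zero, zero_mul, norm_zero]; positivity
      · rw [norm_mul, Complex.norm_real]
        calc _ ≤ 1 * (1 / (T : ℝ)) := by
              gcongr
              · exact DirichletCharacter.norm_le_one _ _
              · exact hebound x hx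
          _ = _ := one_mul _
    · rw [Finset.card_univ, ZMod.card, nsmul_eq_mul]; ring
  have hnorm := congrArg norm hsum
  rw [norm_mul, norm_mul (gaussSum _ _), norm_mul Complex.I, norm_gaussSum_eq hχ1, Complex.norm_I, one_mul] at hnorm
  have h2pi : ‖(2 * Real.pi : ℂ)‖ = 2 * Real.pi := by
    rw [norm_mul, Complex.norm_real, Real.norm_of_nonneg hpi.le]; norm_num
  have h4q : ‖(4 * q * oddCharSum N χ⁻¹ : ℂ)‖ = 4 * q * ‖oddCharSum N χ‖ := by
    rw [norm_mul, norm_mul, hconj]; simp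
  rw [h2pi] at hnorm
  have htri := abs_norm_sub_norm_le (4 * q * oddCharSum N χ⁻¹ + ∑ x : ZMod q, χ⁻¹ x * (e x : ℂ))
    (4 * q * oddCharSum N χ⁻¹)
  rw [add_sub_cancel_left, ← hnorm, h4q] at htri
  have hs : √(q : ℝ) * √q = q := Real.mul_self_sqrt hq0.le
  have hs0 : 0 < √(q : ℝ) := Real.sqrt_pos.mpr hq0
  have hfac : 2 * Real.pi * (√q * ‖charSum χ ((q : ℝ) / 2)‖) - 4 * q * ‖oddCharSum N χ‖
      = 2 * Real.pi * √q * (‖charSum χ ((q : ℝ) / 2)‖ - 2 * √q / Real.pi * ‖oddCharSum N χ‖) := by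
    have : 2 * Real.pi * √q * (2 * √q / Real.pi * ‖oddCharSum N χ‖)
        = 4 * (√q * √q) * ‖oddCharSum N χ‖ := by
      field_simp; ring
    rw [mul_sub, this, hs]; ring
  rw [hfac, abs_mul, abs_of_pos (by positivity)] at htri
  have hfin := htri.trans herr
  have hT0 : (0 : ℝ) < T := by exact_mod_cast hT
  have : (q : ℝ) / T = √q * (√q / T) := by rw [← mul_div_assoc, hs]
  rw [this] at hfin
  have h2 : 1 ≤ 2 * Real.pi := by linarith [Real.pi_gt_three]
  have h3 : √q * |‖charSum χ ((q : ℝ) / 2)‖ - 2 * √q / Real.pi * ‖oddCharSum N χ‖| ≤ √q * (√q / T) := by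
    refine le_trans ?_ hfin
    gcongr
    nlinarith
  exact le_of_mul_le_mul_left h3 hs0

/-! ### Moments of the half sums -/

lemma norm_oddCharSum_le {q : ℕ} (N : ℕ) (χ : DirichletCharacter ℂ q) :
    ‖oddCharSum N χ‖ ≤ 1 + Real.log (N + 1) := by
  refine (norm_sum_le _ _).trans (le_trans (Finset.sum_le_sum fun m _ => ?_) (sum_inv_Icc_le N))
  rw [norm_mul, Complex.norm_real, norm_div, Complex.norm_natCast]
  have h1 : ‖oddIndicatorBelow N m‖ ≤ 1 := by
    rw [oddIndicatorBelow_apply]; split_ifs <;> norm_num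
  calc _ ≤ 1 * (1 / (m : ℝ)) := by
        gcongr
        exact DirichletCharacter.norm_le_one _ _
    _ = _ := one_mul _

open Classical in
lemma sum_nonprincipalChars_eq {q : ℕ} [Fact q.Prime] (hq2 : q ≠ 2) {k : ℕ} (hk : k ≠ 0) :
    ∑ χ ∈ nonprincipalChars q, ‖charSum χ ((q : ℝ) / 2)‖ ^ (2 * k)
      = ∑ χ : DirichletCharacter ℂ q,
        if χ.Odd then ‖charSum χ ((q : ℝ) / 2)‖ ^ (2 * k) else 0 := by
  obtain ⟨h, hq⟩ := (Fact.out : q.Prime).odd_of_ne_two hq2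
  rw [nonprincipalChars, Finset.sum_filter]
  refine Finset.sum_congr rfl fun χ _ => ?_
  rcases χ.even_or_odd with he | ho
  · have hno : ¬ χ.Odd := fun h' => by
      rw [DirichletCharacter.Even] at he
      rw [DirichletCharacter.Odd, he] at h'
      norm_num at h'
    rw [if_neg hno]
    split_ifs with h1
    · rw [charSum_half_eq_zero_of_even hq h1 he, norm_zero, zero_pow (by omega)]
    · rfl
  · have h1 : χ ≠ 1 := by
      rintro rfl
      rw [DirichletCharacter.Odd, MulChar.one_apply isUnit_one.neg] at ho
      norm_num at ho
    rw [if_pos ho, if_pos h1]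

/-- The cutoff `T = q³` makes the error `√q/q³` in the base. The logarithmic size of the odd sum is
absorbed as `q^(1/(2k))`, so its `2k`-th power costs one factor `q`, leaving `q^(k-3+1)`. The
resulting length stays below `q⁵`, as the moment estimate requires. -/
lemma abs_norm_charSum_pow_sub_le {k : ℕ} (hk : 1 ≤ k) {q : ℕ} [Fact q.Prime] (hq2 : q ≠ 2)
    {χ : DirichletCharacter ℂ q} (hχ : χ.Odd) :
    |‖charSum χ ((q : ℝ) / 2)‖ ^ (2 * k)
        - (2 * √q / Real.pi * ‖oddCharSum ((2 * q ^ 3 + 1) * q) χ‖) ^ (2 * k)|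
      ≤ 2 * k * (2 + 12 * k) ^ (2 * k) * (q : ℝ) ^ ((k : ℝ) - 2) := by
  have hq3 : 3 ≤ q := by
    have := (Fact.out : q.Prime).two_le
    omega
  have hq0 : (0 : ℝ) < q := by exact_mod_cast (by omega : 0 < q)
  have hq1 : (1 : ℝ) ≤ q := by exact_mod_cast (by omega : 1 ≤ q)
  have hk' : (1 : ℝ) ≤ k := by exact_mod_cast hk
  have hb := abs_norm_charSum_sub_le hq2 hχ (T := q ^ 3) (Nat.one_le_pow _ _ (by omega))
  set N := (2 * q ^ 3 + 1) * q
  set s := ‖charSum χ ((q : ℝ) / 2)‖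
  set v := ‖oddCharSum N χ‖
  have hv0 : 0 ≤ v := norm_nonneg _
  have hs0 : 0 ≤ s := norm_nonneg _
  have hsq0 : 0 ≤ √(q : ℝ) := Real.sqrt_nonneg _
  have hA : 2 * √q / Real.pi * v ≤ √q * v := by
    gcongr
    rw [div_le_iff₀ Real.pi_pos]
    nlinarith [Real.pi_gt_three]
  have hA0 : 0 ≤ 2 * √q / Real.pi * v := by positivity
  have hT : √(q : ℝ) / ((q ^ 3 : ℕ) : ℝ) ≤ √q := by
    refine div_le_self hsq0 ?_
    exact_mod_cast Nat.one_le_pow _ _ (by omega : 0 < q)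
  have hmax : max |s| |2 * √q / Real.pi * v| ≤ √q * (v + 1) := by
    rw [abs_of_nonneg hs0, abs_of_nonneg hA0, max_le_iff]
    have := (abs_le.mp hb).2
    constructor <;> nlinarith
  have hvle : v + 1 ≤ (2 + 12 * k) * (q : ℝ) ^ (1 / (2 * k : ℝ)) := by
    have h1 : v ≤ 1 + Real.log (N + 1) := norm_oddCharSum_le N χ
    have h2 : N + 1 ≤ q ^ 6 := by
      have e : N = 2 * q ^ 4 + q := by simp only [N]; ring
      have a1 : 3 * q ^ 4 ≤ q ^ 5 := by
        rw [pow_succ q 4, mul_comm (q ^ 4)]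
        exact Nat.mul_le_mul_right _ hq3
      have a2 : 3 * q ^ 5 ≤ q ^ 6 := by
        rw [pow_succ q 5, mul_comm (q ^ 5)]
        exact Nat.mul_le_mul_right _ hq3
      have a3 : q ≤ q ^ 4 := Nat.le_self_pow (by norm_num) q
      omega
    have h3 : Real.log (N + 1) ≤ 6 * Real.log q := by
      calc Real.log (N + 1) ≤ Real.log ((q : ℝ) ^ 6) :=
            Real.log_le_log (by positivity) (by exact_mod_cast h2)
        _ = _ := by rw [Real.log_pow]; norm_num
    have h4 : Real.log q ≤ 2 * k * (q : ℝ) ^ (1 / (2 * k : ℝ)) := by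
      refine (Real.log_le_rpow_div hq0.le (by positivity : (0 : ℝ) < 1 / (2 * k))).trans_eq ?_
      rw [div_div_eq_mul_div, div_one]; ring
    have h5 : 1 ≤ (q : ℝ) ^ (1 / (2 * k : ℝ)) := Real.one_le_rpow hq1 (by positivity)
    nlinarith
  have hvpow : (v + 1) ^ (2 * k - 1) ≤ (2 + 12 * k) ^ (2 * k) * (q : ℝ) := by
    calc (v + 1) ^ (2 * k - 1) ≤ (v + 1) ^ (2 * k) :=
          pow_le_pow_right₀ (by linarith) (Nat.sub_le _ _)
      _ ≤ ((2 + 12 * k) * (q : ℝ) ^ (1 / (2 * k : ℝ))) ^ (2 * k) := by gcongr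
      _ = _ := by
          rw [mul_pow, ← Real.rpow_natCast ((q : ℝ) ^ (1 / (2 * k : ℝ))), ← Real.rpow_mul hq0.le]
          push_cast
          rw [one_div_mul_cancel (by positivity), Real.rpow_one]
  have hsqpow : √(q : ℝ) * √q ^ (2 * k - 1) = (q : ℝ) ^ k := by
    rw [← pow_succ', show 2 * k - 1 + 1 = 2 * k by omega, pow_mul, Real.sq_sqrt hq0.le]
  have hpow : (q : ℝ) ^ ((k : ℝ) - 2) = (q : ℝ) ^ k * q / (q : ℝ) ^ 3 := by
    rw [Real.rpow_sub hq0, Real.rpow_natCast, Real.rpow_two]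
    field_simp
  calc _ ≤ |s - 2 * √q / Real.pi * v| * (2 * k : ℕ) * max |s| |2 * √q / Real.pi * v| ^ (2 * k - 1) :=
        abs_pow_sub_pow_le _ _ _
    _ ≤ √q / ((q ^ 3 : ℕ) : ℝ) * (2 * k : ℕ) * (√q * (v + 1)) ^ (2 * k - 1) := by gcongr
    _ = 2 * k * (√q * √q ^ (2 * k - 1)) / (q : ℝ) ^ 3 * (v + 1) ^ (2 * k - 1) := by
        rw [mul_pow]; push_cast; ring
    _ ≤ 2 * k * (√q * √q ^ (2 * k - 1)) / (q : ℝ) ^ 3 * ((2 + 12 * k) ^ (2 * k) * (q : ℝ)) := by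
        gcongr
    _ = _ := by rw [hsqpow, hpow]; ring

/-- The moment formula for odd primes. -/
lemma exists_abs_moment_sub_le {k : ℕ} (hk : 1 ≤ k) {ε : ℝ} (hε : 0 < ε) (hε1 : ε ≤ 1) :
    ∃ K : ℝ, 0 ≤ K ∧ ∀ (q : ℕ) [Fact q.Prime], q ≠ 2 →
      |(1 / (Nat.totient q : ℝ)) * ∑ χ ∈ nonprincipalChars q, ‖charSum χ ((q : ℝ) / 2)‖ ^ (2 * k)
          - (q : ℝ) ^ k * (1 / 2 * (2 / Real.pi) ^ (2 * k) * oddDivisorSeries k)|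
        ≤ K * (q : ℝ) ^ ((k : ℝ) - 1 + ε) := by
  classical
  obtain ⟨K₁, hK₁, hmom⟩ := exists_abs_moment_oddCharSum_sub_le k hk hε hε1
  refine ⟨2 * k * (2 + 12 * k) ^ (2 * k) + (2 / Real.pi) ^ (2 * k) * K₁, by positivity,
    fun q hq hq2 => ?_⟩
  have hq3 : 3 ≤ q := by
    have := (Fact.out : q.Prime).two_le
    omega
  have hq0 : (0 : ℝ) < q := by exact_mod_cast (by omega : 0 < q)
  have hq1 : (1 : ℝ) ≤ q := by exact_mod_cast (by omega : 1 ≤ q)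
  set N := (2 * q ^ 3 + 1) * q
  have hN1 : q ≤ N := Nat.le_mul_of_pos_left q (by positivity)
  have hN2 : N ≤ q ^ 5 := by
    have e : N = 2 * q ^ 4 + q := by simp only [N]; ring
    have a1 : 3 * q ^ 4 ≤ q ^ 5 := by
      rw [pow_succ q 4, mul_comm (q ^ 4)]
      exact Nat.mul_le_mul_right _ hq3
    have a3 : q ≤ q ^ 4 := Nat.le_self_pow (by norm_num) q
    omega
  have h1 := hmom q hq2 N hN1 hN2
  set V := ∑ χ : DirichletCharacter ℂ q, if χ.Odd then ‖oddCharSum N χ‖ ^ (2 * k) else 0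
  set B : ℝ := 2 * k * (2 + 12 * k) ^ (2 * k) * (q : ℝ) ^ ((k : ℝ) - 2)
  have hApow : (2 * √q / Real.pi) ^ (2 * k) = (2 / Real.pi) ^ (2 * k) * (q : ℝ) ^ k := by
    rw [mul_div_right_comm, mul_pow, pow_mul √(q : ℝ), Real.sq_sqrt hq0.le]
  have hφ : (0 : ℝ) < q.totient := by
    exact_mod_cast Nat.totient_pos.mpr (by omega : 0 < q)
  have h2 : |(1 / (Nat.totient q : ℝ)) * ∑ χ ∈ nonprincipalChars q,
      ‖charSum χ ((q : ℝ) / 2)‖ ^ (2 * k)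
      - (2 / Real.pi) ^ (2 * k) * (q : ℝ) ^ k * (1 / (q.totient : ℝ) * V)| ≤ B := by
    rw [sum_nonprincipalChars_eq hq2 (by omega), mul_left_comm, ← mul_sub, ← hApow, Finset.mul_sum,
      ← Finset.sum_sub_distrib, abs_mul, abs_of_pos (by positivity)]
    have h3 : |∑ χ : DirichletCharacter ℂ q,
        ((if χ.Odd then ‖charSum χ ((q : ℝ) / 2)‖ ^ (2 * k) else 0)
        - (2 * √q / Real.pi) ^ (2 * k) * if χ.Odd then ‖oddCharSum N χ‖ ^ (2 * k) else 0)|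
        ≤ q.totient * B := by
      refine (Finset.abs_sum_le_sum_abs _ _).trans
        ((Finset.sum_le_card_nsmul _ _ B fun χ _ => ?_).trans_eq ?_)
      · split_ifs with ho
        · rw [← mul_pow]
          exact abs_norm_charSum_pow_sub_le hk hq2 ho
        · rw [mul_zero, sub_zero, abs_zero]; positivity
      · rw [Finset.card_univ, ← Nat.card_eq_fintype_card,
          DirichletCharacter.card_eq_totient_of_hasEnoughRootsOfUnity, nsmul_eq_mul]
    calc _ ≤ 1 / (q.totient : ℝ) * (q.totient * B) := by gcongr
      _ = B := by field_simp
  have h3 : |(2 / Real.pi) ^ (2 * k) * (q : ℝ) ^ k * (1 / (q.totient : ℝ) * V)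
      - (q : ℝ) ^ k * (1 / 2 * (2 / Real.pi) ^ (2 * k) * oddDivisorSeries k)|
      ≤ (2 / Real.pi) ^ (2 * k) * K₁ * (q : ℝ) ^ ((k : ℝ) - 1 + ε) := by
    have e : (2 / Real.pi) ^ (2 * k) * (q : ℝ) ^ k * (1 / (q.totient : ℝ) * V)
        - (q : ℝ) ^ k * (1 / 2 * (2 / Real.pi) ^ (2 * k) * oddDivisorSeries k)
        = (2 / Real.pi) ^ (2 * k) * (q : ℝ) ^ k *
          (1 / (q.totient : ℝ) * V - 1 / 2 * oddDivisorSeries k) := by ring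
    have hpi := Real.pi_pos
    rw [e, abs_mul, abs_of_pos (by positivity), show (k : ℝ) - 1 + ε = k + (-1 + ε) by ring,
      Real.rpow_add hq0, Real.rpow_natCast]
    calc _ ≤ (2 / Real.pi) ^ (2 * k) * (q : ℝ) ^ k * (K₁ * (q : ℝ) ^ (-1 + ε)) := by gcongr
      _ = _ := by ring
  have h4 : B ≤ 2 * k * (2 + 12 * k) ^ (2 * k) * (q : ℝ) ^ ((k : ℝ) - 1 + ε) := by
    have : (q : ℝ) ^ ((k : ℝ) - 2) ≤ (q : ℝ) ^ ((k : ℝ) - 1 + ε) :=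
      Real.rpow_le_rpow_of_exponent_le hq1 (by linarith)
    simp only [B]
    gcongr
  rw [add_mul]
  exact (abs_sub_le _ _ _).trans (add_le_add (h2.trans h4) h3)

end

theorem theorem2p1 :
    ∃ (C : ℝ) (E : ℕ → ℝ), (∀ k : ℕ, 2 ≤ k → |E k| ≤ C / Real.log k) ∧
      ∀ k : ℕ, 2 ≤ k → ∀ ε : ℝ, 0 < ε → ∃ K : ℝ, ∀ (q : ℕ) [Fact q.Prime],
        |(1 / (Nat.totient q : ℝ)) *
              ∑ χ ∈ nonprincipalChars q, ‖charSum χ ((q : ℝ) / 2)‖ ^ (2 * k)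
            - (Real.exp Real.eulerMascheroniConstant / Real.pi) ^ (2 * k) * (q : ℝ) ^ k
                * Real.log k ^ (2 * k)
                * Real.exp (2 * (k : ℝ) / Real.log k * (constA + E k))|
          ≤ K * (q : ℝ) ^ ((k : ℝ) - 1 + ε) := by
  obtain ⟨C, hC⟩ := exists_abs_momentError_le
  refine ⟨C, momentError, hC, fun k hk ε hε => ?_⟩
  -- The moment estimate is stated for exponents at most `1`; a larger `ε` only weakens the claim.
  obtain ⟨K, hK, h⟩ := exists_abs_moment_sub_le (k := k) (by omega) (lt_min hε one_pos)
    (min_le_right ε 1)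
  have hk' : (2 : ℝ) ≤ k := by exact_mod_cast hk
  have key : ∀ (q : ℕ) [Fact q.Prime], q ≠ 2 → |(1 / (Nat.totient q : ℝ)) *
              ∑ χ ∈ nonprincipalChars q, ‖charSum χ ((q : ℝ) / 2)‖ ^ (2 * k)
            - (Real.exp Real.eulerMascheroniConstant / Real.pi) ^ (2 * k) * (q : ℝ) ^ k
                * Real.log k ^ (2 * k)
                * Real.exp (2 * (k : ℝ) / Real.log k * (constA + momentError k))|
          ≤ K * (q : ℝ) ^ ((k : ℝ) - 1 + ε) := by
    intro q hq hq2
    have e : (Real.exp Real.eulerMascheroniConstant / Real.pi) ^ (2 * k) * (q : ℝ) ^ k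
        * Real.log k ^ (2 * k) * Real.exp (2 * (k : ℝ) / Real.log k * (constA + momentError k))
        = (q : ℝ) ^ k * (1 / 2 * (2 / Real.pi) ^ (2 * k) * oddDivisorSeries k) := by
      rw [oddDivisorSeries_eq hk]; ring
    have hq1 : (1 : ℝ) ≤ q := by exact_mod_cast (Fact.out : q.Prime).one_le
    rw [e]
    refine (h q hq2).trans ?_
    gcongr
    · exact min_le_left ε 1
  have := Nat.fact_prime_two
  -- The single prime `q = 2`, excluded by the parity arguments, is covered by enlarging the
  -- constant.
  refine ⟨max K |(1 / (Nat.totient 2 : ℝ)) *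
              ∑ χ ∈ nonprincipalChars 2, ‖charSum χ (((2 : ℕ) : ℝ) / 2)‖ ^ (2 * k)
            - (Real.exp Real.eulerMascheroniConstant / Real.pi) ^ (2 * k) * ((2 : ℕ) : ℝ) ^ k
                * Real.log k ^ (2 * k)
                * Real.exp (2 * (k : ℝ) / Real.log k * (constA + momentError k))|, fun q hq => ?_⟩
  rcases eq_or_ne q 2 with rfl | hq2
  · refine (le_max_right K _).trans (le_mul_of_one_le_right (hK.trans (le_max_left _ _)) ?_)
    exact Real.one_le_rpow (by norm_num) (by linarith)
  · refine (key q hq2).trans ?_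
    gcongr
    exact le_max_left _ _
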